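/- Let $\alpha>3$ be a quadratic unit with positive conjugate $\alpha_2$, i.e. $\alpha,\alpha_2$ are the two roots of $x^2-bx+1$ with $b\in\mathbb N$ (so $\alpha_2=1/\alpha$). Let $\|x\|$ be the distance from $x\in\mathbb R$ to the nearest integer and $\mathcal L(\alpha)=\{\limsup_{n\to\infty}\|\xi\alpha^n\| : \xi\in\mathbb R\}$. Define integers $p_n,q_n$ $(n\ge 0)$ by $$p_0=0,\ p_2=1,\ p_{2n+2}=bp_{2n}-p_{2n-2},\ p_{2n-1}=p_{2n-2}+p_{2n},$$ $$q_0=1,\ q_2=1+b,\ q_{2n+2}=bq_{2n}-q_{2n-2},\ q_{2n-1}=q_{2n-2}+q_{2n}\qquad(n\ge 1).$$ *Notation for words.* A finite word over $\{0,1\}$ is balanced if the numbers of $1$'s in any two factors of equal length differ by at most $1$. A property holds eventually locally for a right infinite word $y$ if there are $m_0$ and $q(m)\to\infty$ such that for each $m\ge m_0$ it holds for the factor of $y$ at the positions within distance $q(m)$ of $m$; $y\in\{0,1\}^{\mathbb N}$ is eventually balanced if it is eventually locally balanced. For coprime $0\le p\le q$ the lower and upper Christoffel words of slope $p/q$ are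 $(\lfloor p(i+1)/q\rfloor-\lfloor pi/q\rfloor)_{0\le i<q}$ and $(\lceil p(i+1)/q\rceil-\lceil pi/q\rceil)_{0\le i<q}$. Let $\gamma$ be the morphism $0\mapsto 0$, $1\mapsto 1\,\overline 1$, where $\overline 1=-1$. For a bounded integer word $s=s_1s_2\dots$ put $g(s)=\frac1{\alpha-\alpha_2}\sum_{i\ge1}s_i\alpha^{-i}$, and let $M=\frac1{\alpha-\alpha_2}\mathbb Z[\alpha]$. Then: 1. $(p_n/q_n)_{n\ge0}$ is strictly increasing and converges to $1/(1+\alpha)$. 2. Let $P_n/Q_n=[0;\underbrace{1+b,b,\dots,b}_{n}]_{neg}$ in lowest terms, where $[0;a_1,\dots,a_n]_{neg}=1/(a_1-1/(a_2-\cdots-1/a_n))$ (and $P_0/Q_0=0/1$). Then $P_n/Q_n\to 1/(1+\alpha)$, $p_{2n}/q_{2n}=P_n/Q_n$ for $n\ge 0$ and $p_{2n-1}/q_{2n-1}=(P_{n-1}+P_n)/(Q_{n-1}+Q_n)$ for $n\ge 1$. 3. $\mathcal L(\alpha)\cap[0,\tfrac1{1+\alpha}]=\{p_n/q_n: n\ge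 0\}\cup\{\tfrac1{1+\alpha}\}$, and $1/(1+\alpha)$ is the smallest limit point of $\mathcal L(\alpha)$. 4. For each $n\ge0$ the set $X_n=\{\xi\in\mathbb R:\limsup_{m\to\infty}\|\xi\alpha^m\|=p_n/q_n\}$ is contained in $\mathbb Q(\alpha)$, and $X_n$ is the set of all $\pm g(s_{k+1}s_{k+2}\dots)+x$ where $s=\gamma(\nu\nu\nu\dots)$ with a Christoffel word $\nu$ such that $\gamma(\nu)$ has length $n+1$, $0\le k\le n$, and $x\in M$. 5. The set $X_\infty=\{\xi\in\mathbb R:\limsup_{m\to\infty}\|\xi\alpha^m\|=1/(1+\alpha)\}$ is uncountable. It contains $\pm g(s_ks_{k+1}\dots)+x$ whenever $k\in\{1,2\}$, $x\in M$ and $s=\gamma(y)$ with an eventually balanced word $y\in\{0,1\}^{\mathbb N}$ that is not eventually periodic. Moreover $X_\infty$ is exactly the set of all $g(s)+x$ where $x\in M$ and $s$ is an integer word that is not eventually periodic and such that, eventually locally, $s$ is a factor of $\gamma(u)$ or of $-\gamma(u)$ for some balanced finite word $u$. -/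

import Mathlib

open Filter Topology

noncomputable section

/-! ### The spectrum -/

/-- Distance `‖x‖` from a real number to the nearest integer. -/
def nint (x : ℝ) : ℝ := |x - round x|

/-- `limsup_{n → ∞} ‖ξ αⁿ‖`. -/
def limsupDist (α ξ : ℝ) : ℝ := limsup (fun n : ℕ => nint (ξ * α ^ n)) atTop

/-- The Lagrange spectrum of the geometric progressions with ratio `α`. -/
def lagrangeSpectrum (α : ℝ) : Set ℝ := Set.range (limsupDist α)

/-- The set of all `ξ` whose limit superior is `t`. -/
def levelSet (α t : ℝ) : Set ℝ := {ξ : ℝ | limsupDist α ξ = t}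

/-! ### The sequences `p` and `q` and negative continued fractions -/

/-- The sequence `u, v, b v - u, …` with `e (n+2) = b e (n+1) - e n`. -/
def recSeq (b u v : ℤ) : ℕ → ℤ
  | 0 => u
  | 1 => v
  | n + 2 => b * recSeq b u v (n + 1) - recSeq b u v n

/-- The sequence with value `e m` at `2m` and `e m + e (m+1)` at `2m+1`. -/
def interleave (e : ℕ → ℤ) (n : ℕ) : ℤ :=
  if n % 2 = 0 then e (n / 2) else e (n / 2) + e (n / 2 + 1)

/-- `p₀ = 0, p₂ = 1, p_{2n+2} = b p_{2n} - p_{2n-2}, p_{2n-1} = p_{2n-2} + p_{2n}`. -/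
def pSeq (b : ℕ) : ℕ → ℤ := interleave (recSeq b 0 1)

/-- `q₀ = 1, q₂ = 1 + b, q_{2n+2} = b q_{2n} - q_{2n-2}, q_{2n-1} = q_{2n-2} + q_{2n}`. -/
def qSeq (b : ℕ) : ℕ → ℤ := interleave (recSeq b 1 (1 + b))

/-- `[0; a₁, …, aₙ]_neg = 1 / (a₁ - 1 / (a₂ - ⋯ - 1 / aₙ))`. -/
def negCF : List ℚ → ℚ
  | [] => 0
  | a :: l => 1 / (a - negCF l)

/-- The `n`-th convergent `[0; 1+b, b, …, b]_neg` (with `n` partial quotients). -/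
def negConv (b : ℕ) : ℕ → ℚ
  | 0 => negCF []
  | n + 1 => negCF ((1 + b : ℚ) :: List.replicate n (b : ℚ))

/-! ### Words. The letters `0` and `1` are `false` and `true`. -/

/-- Balanced finite words over `{0,1}`. -/
def BalancedWord (x : List Bool) : Prop :=
  ∀ u v : List Bool, u <:+: x → v <:+: x → u.length = v.length →
    u.count true ≤ v.count true + 1

/-- The factor `y_i y_{i+1} … y_j` of a right infinite word. -/
def window {A : Type} (y : ℕ → A) (i j : ℕ) : List A :=
  (List.range' i (j + 1 - i)).map y

/-- There are `m₀` and `q(m) → ∞` such that for every `m ≥ m₀` the factor of `y` on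
`[max(0, m - q(m)), m + q(m)]` satisfies `P` (the subtraction of naturals truncates at `0`). -/
def EventuallyLocally {A : Type} (P : List A → Prop) (y : ℕ → A) : Prop :=
  ∃ (m₀ : ℕ) (q : ℕ → ℕ), Tendsto q atTop atTop ∧
    ∀ m, m₀ ≤ m → P (window y (m - q m) (m + q m))

/-- Eventually balanced right infinite words. -/
def EventuallyBalanced (y : ℕ → Bool) : Prop := EventuallyLocally BalancedWord y

/-- Eventually periodic right infinite words. -/
def EventuallyPeriodic {A : Type} (y : ℕ → A) : Prop :=
  ∃ N T : ℕ, 0 < T ∧ ∀ n, N ≤ n → y (n + T) = y n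

/-- The lower Christoffel word of slope `p/q`. -/
def lowerChristoffel (p q : ℕ) : List Bool :=
  (List.range q).map fun i : ℕ =>
    decide (⌊(p * (i + 1) : ℚ) / q⌋ - ⌊(p * i : ℚ) / q⌋ = 1)

/-- The upper Christoffel word of slope `p/q`. -/
def upperChristoffel (p q : ℕ) : List Bool :=
  (List.range q).map fun i : ℕ =>
    decide (⌈(p * (i + 1) : ℚ) / q⌉ - ⌈(p * i : ℚ) / q⌉ = 1)

/-- Christoffel words (coprimality of `p ≤ q` forces `q ≥ 1`). -/
def IsChristoffel (ν : List Bool) : Prop :=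
  ∃ p q : ℕ, p ≤ q ∧ p.Coprime q ∧ (ν = lowerChristoffel p q ∨ ν = upperChristoffel p q)

/-- The periodic right infinite word `ν ν ν …` (for a non-empty `ν`). -/
def periodicWord (ν : List Bool) : ℕ → Bool := fun i => ν.getD (i % ν.length) false

/-! ### Coding and realization -/

/-- The morphism with `0 ↦ 0` and `1 ↦ 1, -1` on finite words. -/
def gam (x : List Bool) : List ℤ := x.flatMap fun c => if c then [1, -1] else [0]

/-- The same morphism on right infinite words: as no letter is erased, the image of the prefix
of length `n + 1` has a letter of index `n`. -/
def gamSeq (y : ℕ → Bool) (n : ℕ) : ℤ := (gam (window y 0 n)).getD n 0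

/-- `w` is a factor of the image of a balanced word, or of the negative of such an image. -/
def SignedCodedBalanced (w : List ℤ) : Prop :=
  ∃ x : List Bool, BalancedWord x ∧ (w <:+: gam x ∨ w <:+: (gam x).map fun a => -a)

/-- The weights of the realization map, for a quadratic number `α` with conjugate `α₂`. -/
def tau (α α₂ : ℝ) (i : ℤ) : ℝ :=
  if i ≤ 0 then α₂ ^ (-i) / (α - α₂) else α ^ (-i) / (α - α₂)

/-- The realization map on (bounded) bi-infinite integer words. -/
def realize (α α₂ : ℝ) (s : ℤ → ℤ) : ℝ := ∑' i : ℤ, (s i : ℝ) * tau α α₂ i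

/-- The bi-infinite word `0^∞ . s₀ s₁ s₂ …`: the letter `s₀` has index `1`. -/
def padZero (s : ℕ → ℤ) : ℤ → ℤ := fun i => if i ≤ 0 then 0 else s (i - 1).toNat

/-- The set `(1 / (α - α₂)) ℤ[α]`. -/
def baseSet (α α₂ : ℝ) : Set ℝ :=
  {x : ℝ | ∃ z ∈ Algebra.adjoin ℤ ({α} : Set ℝ), x = z / (α - α₂)}

/-- The set of all `± g(0^∞ . s_k s_{k+1} …) + x` where `s = γ(ν ν ν …)` with a Christoffel word
`ν` such that `γ(ν)` has length `n + 1`, where `0 ≤ k ≤ n`, and `x ∈ (1 / (α - α₂)) ℤ[α]`. -/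
def christoffelSet (α α₂ : ℝ) (n : ℕ) : Set ℝ :=
  {ξ : ℝ | ∃ ν : List Bool, IsChristoffel ν ∧ (gam ν).length = n + 1 ∧
    ∃ k ≤ n, ∃ x ∈ baseSet α α₂,
      ξ = realize α α₂ (padZero fun i => gamSeq (periodicWord ν) (k + i)) + x ∨
      ξ = -realize α α₂ (padZero fun i => gamSeq (periodicWord ν) (k + i)) + x}

/-- The set of all `± g(0^∞ . s_k s_{k+1} …) + x` where `s = γ(y)` with an eventually balanced
word `y` that is not eventually periodic, where `k` is the first or the second index, and
`x ∈ (1 / (α - α₂)) ℤ[α]`. -/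
def eventuallyBalancedSet (α α₂ : ℝ) : Set ℝ :=
  {ξ : ℝ | ∃ y : ℕ → Bool, EventuallyBalanced y ∧ ¬ EventuallyPeriodic y ∧
    ∃ k ≤ 1, ∃ x ∈ baseSet α α₂,
      ξ = realize α α₂ (padZero fun i => gamSeq y (k + i)) + x ∨
      ξ = -realize α α₂ (padZero fun i => gamSeq y (k + i)) + x}

/-- The set of all `g(0^∞ . s₀ s₁ …) + x` where `s` is an integer word that is not eventually
periodic and is eventually locally the image, up to sign, of a balanced word, and
`x ∈ (1 / (α - α₂)) ℤ[α]`. -/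
def signedEventuallyBalancedSet (α α₂ : ℝ) : Set ℝ :=
  {ξ : ℝ | ∃ s : ℕ → ℤ, EventuallyLocally SignedCodedBalanced s ∧ ¬ EventuallyPeriodic s ∧
    ∃ x ∈ baseSet α α₂, ξ = realize α α₂ (padZero s) + x}

end

/-!
Write `β = α₂` and let `u n` be the integer nearest to `ξ α ^ n`. Since `α ^ n` satisfies the
recurrence `x (n + 2) = b x (n + 1) - x n`, the defect `s` of `u` in this recurrence is a bounded
integer word, and up to an error tending to `0` the distance of `ξ α ^ n` to `u n` is
`(α - β)⁻¹ |∑ i, s (n + i) β ^ |i||`. So the limit superior is governed by the two-sided sums over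
the limits `t` of translates of `s`, and the value `1 / (1 + α)` corresponds to the bound `1 - β`
for these sums.

For `β < 1 / 3` this bound forces the letters of `t` to be `0, 1, -1` with alternating signs. Thus
`t` is the first difference of a word `c` over `{0,1}`, and comparing the sums around a factor `01`
or `10` shows that `c` has Markoff's property. A closest pair of shortest windows violating balance
would contradict this property, so `c` is balanced and `t` is the second difference of a primitive
`S` of `c`. Conversely, the sum at `n` of the second difference of `S` is
`(1 - β) ^ 2 ∑ i ≥ 1, (S (n + i) - 2 S n + S (n - i)) β ^ (i - 1)`, and balance of `c` means that
the coefficients lie in `{-1, 0, 1}`, which gives back the bound `1 - β`.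

If the sums stay strictly below `1 - β`, then for each `n` one of the first `K` coefficients is
non-negative, with `K` independent of `n`. This makes the slope of `S` rational and `S` equal to
`n ↦ ⌊(n p + a) / q⌋` up to a constant. The limit superior then depends only on `q` and equals
`p_{q-1} / q_{q-1}`. The critical value is attained by the second differences of `⌊n θ⌋` for
irrational `θ`; the realized numbers are injective in `θ` because `∑ n, ⌊n θ⌋ β ^ n` is strictly
increasing.
-/

/-! ### Geometrically weighted sums -/

section GeometricSums

variable {β : ℝ}

lemma summable_mul_pow_of_abs_le (hβ₀ : 0 ≤ β) (hβ₁ : β < 1) {a : ℕ → ℝ} {B : ℝ}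
    (ha : ∀ i, |a i| ≤ B) : Summable fun i => a i * β ^ i := by
  refine Summable.of_norm_bounded (g := fun i => B * β ^ i)
    ((summable_geometric_of_lt_one hβ₀ hβ₁).mul_left B) fun i => ?_
  rw [Real.norm_eq_abs, abs_mul, abs_of_nonneg (pow_nonneg hβ₀ i)]
  exact mul_le_mul_of_nonneg_right (ha i) (pow_nonneg hβ₀ i)

lemma summable_intCast_mul_pow_of_abs_le (hβ₀ : 0 ≤ β) (hβ₁ : β < 1) {a : ℕ → ℤ} {B : ℤ}
    (ha : ∀ i, |a i| ≤ B) : Summable fun i => (a i : ℝ) * β ^ i :=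
  summable_mul_pow_of_abs_le hβ₀ hβ₁ (B := B) fun i => by exact_mod_cast ha i

lemma abs_tsum_mul_pow_le (hβ₀ : 0 ≤ β) (hβ₁ : β < 1) {a : ℕ → ℝ} {B : ℝ}
    (ha : ∀ i, |a i| ≤ B) : |∑' i, a i * β ^ i| ≤ B / (1 - β) := by
  have h := tsum_of_norm_bounded (f := fun i => a i * β ^ i)
    ((hasSum_geometric_of_lt_one hβ₀ hβ₁).mul_left B) fun i => by
      rw [Real.norm_eq_abs, abs_mul, abs_of_nonneg (pow_nonneg hβ₀ i)]
      exact mul_le_mul_of_nonneg_right (ha i) (pow_nonneg hβ₀ i)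
  simpa [div_eq_mul_inv] using h

lemma tsum_eq_add_mul_tsum_succ {a : ℕ → ℝ} (ha : Summable fun i => a i * β ^ i) :
    ∑' i, a i * β ^ i = a 0 + β * ∑' i, a (i + 1) * β ^ i := by
  rw [ha.tsum_eq_zero_add, pow_zero, mul_one, ← tsum_mul_left]
  exact congrArg (a 0 + ·) (tsum_congr fun i => by ring)

lemma summable_succ_mul_pow {a : ℕ → ℝ} (ha : Summable fun i => a i * β ^ i) :
    Summable fun i => a (i + 1) * β ^ (i + 1) :=
  (summable_nat_add_iff (f := fun i => a i * β ^ i) 1).2 ha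

lemma tsum_diff_mul_pow {a : ℕ → ℝ} (ha : Summable fun i => a i * β ^ i) :
    a 0 + ∑' i, (a (i + 1) - a i) * β ^ (i + 1) = (1 - β) * ∑' i, a i * β ^ i := by
  have hterm : ∀ i, (a (i + 1) - a i) * β ^ (i + 1)
      = a (i + 1) * β ^ (i + 1) - β * (a i * β ^ i) := fun i => by ring
  have hzero := ha.tsum_eq_zero_add
  simp only [pow_zero, mul_one] at hzero
  simp_rw [hterm]
  rw [(summable_succ_mul_pow ha).tsum_sub (ha.mul_left β), tsum_mul_left]
  linarith

lemma tsum_second_diff_mul_pow {a : ℕ → ℝ} (ha : Summable fun i => a (i + 1) * β ^ i)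
    (ha₀ : a 0 = 0) :
    a 1 + ∑' i, (a (i + 2) - 2 * a (i + 1) + a i) * β ^ (i + 1)
      = (1 - β) ^ 2 * ∑' i, a (i + 1) * β ^ i := by
  have hsucc := summable_succ_mul_pow ha
  have hself : Summable fun i => a i * β ^ i :=
    (summable_nat_add_iff 1).1 ((ha.mul_left β).congr fun i => by ring)
  have hterm : ∀ i, (a (i + 2) - 2 * a (i + 1) + a i) * β ^ (i + 1) =
      a (i + 1 + 1) * β ^ (i + 1) - 2 * β * (a (i + 1) * β ^ i) + β * (a i * β ^ i) :=
    fun i => by ring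
  have hzero := ha.tsum_eq_zero_add
  simp only [zero_add, pow_zero, mul_one] at hzero
  simp_rw [hterm]
  rw [(hsucc.sub (ha.mul_left _)).tsum_add (hself.mul_left β), hsucc.tsum_sub (ha.mul_left _),
    tsum_mul_left, tsum_mul_left, tsum_eq_add_mul_tsum_succ hself, ha₀]
  linear_combination -hzero

lemma tsum_mul_pow_pos_of_leading (hβ₀ : 0 < β) (hβ₁ : β < 1) {B : ℝ} (hB : B * β < 1 - β)
    {a : ℕ → ℝ} (d : ℕ) (hz : ∀ i < d, a i = 0) (hd : 1 ≤ a d) (ha : ∀ i, |a (d + 1 + i)| ≤ B) :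
    0 < ∑' i, a i * β ^ i := by
  have htail := summable_mul_pow_of_abs_le hβ₀.le hβ₁ ha
  have hshift : ∀ i, a (i + (d + 1)) * β ^ (i + (d + 1))
      = β ^ (d + 1) * (a (d + 1 + i) * β ^ i) := fun i => by rw [add_comm i, pow_add]; ring
  have hs : Summable fun i => a i * β ^ i :=
    (summable_nat_add_iff (d + 1)).1 <| (htail.mul_left (β ^ (d + 1))).congr
      fun i => (hshift i).symm
  have hsum : ∑' i, a i * β ^ i = β ^ d * (a d + β * ∑' i, a (d + 1 + i) * β ^ i) := by
    rw [← hs.sum_add_tsum_nat_add (d + 1), Finset.sum_range_succ,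
      Finset.sum_eq_zero (fun i hi => by rw [hz i (Finset.mem_range.1 hi), zero_mul]),
      tsum_congr hshift, tsum_mul_left]
    ring
  have hlower := (abs_le.1 (abs_tsum_mul_pow_le hβ₀.le hβ₁ ha)).1
  have hsmall : B / (1 - β) * β < 1 := by
    rwa [div_mul_eq_mul_div, div_lt_one (by linarith)]
  rw [hsum]
  exact mul_pos (pow_pos hβ₀ d) (by nlinarith)

end GeometricSums

/-! ### Green function sums -/

/-- The two-sided sum `∑ t (n + i) β ^ |i|` over all integers `i`. The weights `β ^ |i|` are, up to
a factor, the bounded Green function of the recurrence `u (n + 1) - b u n + u (n - 1) = s n`, so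
these sums are the fractional parts of `ξ α ^ n` up to a factor and an error tending to `0`. -/
noncomputable def greenSum (β : ℝ) (t : ℤ → ℤ) (n : ℤ) : ℝ :=
  ∑' i : ℕ, ((t (n + i) + t (n - i) : ℤ) : ℝ) * β ^ i - t n

/-- Bounded bi-infinite words, the words whose Green function sums converge. -/
def BoundedWord (t : ℤ → ℤ) : Prop := ∃ B : ℤ, ∀ n, |t n| ≤ B

lemma greenSum_neg (β : ℝ) (t : ℤ → ℤ) (n : ℤ) :
    greenSum β (fun n => -t n) n = -greenSum β t n := by
  have hterm : ∀ i : ℕ, ((-t (n + i) + -t (n - i) : ℤ) : ℝ) * β ^ i =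
      -(((t (n + i) + t (n - i) : ℤ) : ℝ) * β ^ i) := fun i => by push_cast; ring
  simp only [greenSum]
  rw [tsum_congr hterm, tsum_neg]
  push_cast
  ring

section GreenSum

variable {β : ℝ} (hβ₀ : 0 ≤ β) (hβ₁ : β < 1) {t : ℤ → ℤ}
include hβ₀ hβ₁

lemma BoundedWord.summable (ht : BoundedWord t) (n : ℤ) :
    Summable fun i : ℕ => ((t (n + i) + t (n - i) : ℤ) : ℝ) * β ^ i := by
  obtain ⟨B, hB⟩ := ht
  exact summable_intCast_mul_pow_of_abs_le hβ₀ hβ₁ (B := B + B) fun i =>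
    (abs_add_le _ _).trans (add_le_add (hB _) (hB _))

lemma greenSum_eq_add_tsum_succ (ht : BoundedWord t) (n : ℤ) : greenSum β t n =
    t n + ∑' i : ℕ, ((t (n + (i + 1)) + t (n - (i + 1)) : ℤ) : ℝ) * β ^ (i + 1) := by
  rw [greenSum, (ht.summable hβ₀ hβ₁ n).tsum_eq_zero_add]
  push_cast
  simp only [add_zero, sub_zero, pow_zero, mul_one]
  ring

lemma greenSum_eq_of_primitive (ht : BoundedWord t) {c : ℤ → ℤ} (hc : BoundedWord c)
    (htc : ∀ n, t n = c n - c (n - 1)) (n : ℤ) :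
    greenSum β t n = (1 - β) * ∑' i : ℕ, ((c (n + i) - c (n - 1 - i) : ℤ) : ℝ) * β ^ i := by
  obtain ⟨B, hB⟩ := hc
  have hs := summable_intCast_mul_pow_of_abs_le hβ₀ hβ₁ (B := B + B)
    (a := fun i => c (n + i) - c (n - 1 - i)) fun i =>
      (abs_sub _ _).trans (add_le_add (hB _) (hB _))
  rw [← tsum_diff_mul_pow hs, greenSum_eq_add_tsum_succ hβ₀ hβ₁ ht]
  congr 1
  · simp [htc]
  · refine tsum_congr fun i => ?_
    rw [htc, htc, show n + ((i : ℤ) + 1) - 1 = n + i by ring,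
      show n - 1 - (i : ℤ) = n - (i + 1) by ring,
      show n - 1 - ((i + 1 : ℕ) : ℤ) = n - (i + 1) - 1 by push_cast; ring]
    push_cast
    ring

lemma greenSum_eq_of_second_primitive (ht : BoundedWord t) {S : ℤ → ℤ}
    (htS : ∀ n, t n = S (n + 1) - 2 * S n + S (n - 1)) (n : ℤ) {B : ℤ}
    (hS : ∀ i : ℕ, |S (n + i) - 2 * S n + S (n - i)| ≤ B) :
    greenSum β t n = (1 - β) ^ 2 *
      ∑' i : ℕ, ((S (n + (i + 1)) - 2 * S n + S (n - (i + 1)) : ℤ) : ℝ) * β ^ i := by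
  set E : ℕ → ℤ := fun i => S (n + i) - 2 * S n + S (n - i) with hE
  have hs := summable_intCast_mul_pow_of_abs_le hβ₀ hβ₁ fun i => hS (i + 1)
  have hE₀ : (E 0 : ℝ) = 0 := by
    simp only [hE, Nat.cast_zero, add_zero, sub_zero]; push_cast; ring
  have hcast : ∀ i : ℕ, S (n + (i + 1)) - 2 * S n + S (n - (i + 1)) = E (i + 1) :=
    fun i => by simp only [hE]; push_cast; rfl
  simp_rw [hcast]
  rw [← tsum_second_diff_mul_pow (a := fun i => (E i : ℝ)) hs hE₀,
    greenSum_eq_add_tsum_succ hβ₀ hβ₁ ht]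
  congr 1
  · simp [hE, htS]
  · refine tsum_congr fun i => ?_
    simp only [hE, htS]
    rw [show n + ((i : ℤ) + 1) - 1 = n + i by ring, show n - ((i : ℤ) + 1) + 1 = n - i by ring]
    push_cast
    rw [show n + ((i : ℤ) + 1) + 1 = n + (i + 2) by ring,
      show n - ((i : ℤ) + 1) - 1 = n - (i + 2) by ring]
    ring

end GreenSum

/-! ### Balanced primitives and Markoff's property -/

/-- `S` is a primitive of a balanced bi-infinite word over `{0,1}`, up to a constant letter: the
numbers of letters `1` in any two windows of equal length differ by at most `1`. Counting functions
make the second differences below easy to write. -/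
def BalancedPrimitive (S : ℤ → ℤ) : Prop :=
  ∀ l i j : ℤ, 0 ≤ l → S (i + l) - S i - (S (j + l) - S j) ≤ 1

/-- One half of Markoff's property of a bi-infinite word over `{0,1}`: around a factor `01`, the
right context does not exceed the reversed left context in the lexicographic order. The other half
is the same property after exchanging `0` and `1`. -/
def MarkoffUp (c : ℤ → ℤ) : Prop :=
  ∀ (m : ℤ) (d : ℕ), 1 ≤ d → c m = 1 → c (m - 1) = 0 →
    (∀ i : ℕ, 1 ≤ i → i < d → c (m + i) = c (m - 1 - i)) → c (m + d) = 1 → c (m - 1 - d) ≠ 0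

lemma exists_primitive (t : ℤ → ℤ) : ∃ C : ℤ → ℤ, ∀ n, C (n + 1) - C n = t n := by
  refine ⟨fun n => ∑ k ∈ Finset.Ico 0 n, t k - ∑ k ∈ Finset.Ico n 0, t k, fun n => ?_⟩
  beta_reduce
  rcases le_or_gt 0 n with h | h
  · have hinsert : Finset.Ico (0 : ℤ) (n + 1) = insert n (Finset.Ico 0 n) := by
      ext; simp only [Finset.mem_insert, Finset.mem_Ico]; omega
    rw [hinsert, Finset.sum_insert (by simp), Finset.Ico_eq_empty (a := n) (by omega),
      Finset.Ico_eq_empty (a := n + 1) (by omega)]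
    simp
  · have hinsert : Finset.Ico (n : ℤ) 0 = insert n (Finset.Ico (n + 1) 0) := by
      ext; simp only [Finset.mem_insert, Finset.mem_Ico]; omega
    rw [hinsert, Finset.sum_insert (by simp), Finset.Ico_eq_empty (b := n) (by omega),
      Finset.Ico_eq_empty (b := n + 1) (by omega)]
    simp

lemma exists_second_primitive (t : ℤ → ℤ) :
    ∃ S : ℤ → ℤ, ∀ n, t n = S (n + 1) - 2 * S n + S (n - 1) := by
  obtain ⟨C, hC⟩ := exists_primitive t
  obtain ⟨S, hS⟩ := exists_primitive fun n => C (n + 1)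
  refine ⟨S, fun n => ?_⟩
  have hprev := hS (n - 1)
  rw [sub_add_cancel] at hprev
  linarith [hC n, hS n]

/-- A pair of windows `[i, i + l)` and `[j, j + l)` with `i < j`, the right one containing at least
two more letters `1`, such that `l` is the least length of windows violating balance and `j - i` is
the least distance of such windows of length `l`. -/
structure ClosestUnbalancedPair (S : ℤ → ℤ) (l i j : ℤ) : Prop where
  lt : i < j
  length_pos : 0 < l
  unbalanced : 2 ≤ S (j + l) - S j - (S (i + l) - S i)
  shorter : ∀ r, 0 ≤ r → r < l → ∀ i j, S (i + r) - S i - (S (j + r) - S j) ≤ 1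
  closer : ∀ i' j', |i' - j'| < j - i → S (i' + l) - S i' - (S (j' + l) - S j') ≤ 1

lemma window_count_succ {S c : ℤ → ℤ} (hc : ∀ n, S (n + 1) = S n + c n) (k l : ℤ) :
    S (k + 1 + l) - S (k + 1) = S (k + l) - S k + c (k + l) - c k := by
  rw [show k + 1 + l = k + l + 1 by ring, hc, hc]; ring

namespace ClosestUnbalancedPair

variable {S c : ℤ → ℤ} {l i j : ℤ} (h : ClosestUnbalancedPair S l i j)
include h

lemma window_eq {k : ℤ} (hik : i < k) (hkj : k < j) :
    S (k + l) - S k = S (i + l) - S i + 1 := by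
  have hlt := h.lt
  have hcount := h.unbalanced
  have hleft := h.closer k i (by rw [abs_lt]; omega)
  have hright := h.closer j k (by rw [abs_lt]; omega)
  omega

lemma length_le : l ≤ j - i := by
  by_contra! hlt
  have := h.lt
  have hcount := h.unbalanced
  have hshort := h.shorter (j - i) (by omega) (by omega) (i + l) i
  rw [show i + l + (j - i) = j + l by ring, show i + (j - i) = j by ring] at hshort
  omega

variable (hc : ∀ n, S (n + 1) = S n + c n)
include hc

lemma letter_add_length {k : ℤ} (hik : i < k) (hkj : k < j - 1) : c (k + l) = c k := by
  have hk := h.window_eq hik (by omega)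
  have hk' := h.window_eq (k := k + 1) (by omega) (by omega)
  have := window_count_succ hc k l
  omega

variable (h01 : ∀ n, c n = 0 ∨ c n = 1)
include h01

lemma add_one_lt : i + 1 < j := by
  by_contra! hle
  have hlt := h.lt
  obtain rfl : j = i + 1 := by omega
  have := window_count_succ hc i l
  have := h01 i
  have := h01 (i + l)
  have := h.unbalanced
  omega

lemma letter_left : c i = 0 ∧ c (i + l) = 1 := by
  have := h.window_eq (k := i + 1) (by omega) (h.add_one_lt hc h01)
  have := window_count_succ hc i l
  have := h01 i
  have := h01 (i + l)
  omega

lemma letter_right :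
    c (j - 1) = 0 ∧ c (j - 1 + l) = 1 ∧ S (j + l) - S j = S (i + l) - S i + 2 := by
  have := h.window_eq (k := j - 1) (by have := h.add_one_lt hc h01; omega) (by omega)
  have hsucc := window_count_succ hc (j - 1) l
  rw [sub_add_cancel] at hsucc
  have := h01 (j - 1)
  have := h01 (j - 1 + l)
  have := h.unbalanced
  omega

lemma two_le_length : 2 ≤ l := by
  have := h.length_pos
  by_contra! hlt
  obtain rfl : l = 1 := by omega
  have := hc i
  have := hc j
  have := h01 i
  have := h01 j
  have := h.unbalanced
  omega

lemma prefix_count {r : ℤ} (hr : 0 < r) (hrl : r < l) :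
    S (j + r) - S j = S (i + r) - S i + 1 := by
  have hprefix := h.shorter r hr.le hrl j i
  have hsuffix := h.shorter (l - r) (by omega) (by omega) (j + r) (i + r)
  rw [show j + r + (l - r) = j + l by ring, show i + r + (l - r) = i + l by ring] at hsuffix
  have := h.letter_right hc h01
  omega

lemma prefix_count_eq_suffix_count {r : ℤ} (hr : 0 < r) (hrl : r < l) :
    S (i + r) - S i = S (i + l) - S (i + (l - r)) := by
  have hupper := h.shorter r hr.le hrl j (i + (l - r))
  have hlower := h.shorter r hr.le hrl (j + (l - r)) i
  rw [show i + (l - r) + r = i + l by ring] at hupper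
  rw [show j + (l - r) + r = j + l by ring] at hlower
  have := h.letter_right hc h01
  have := h.prefix_count hc h01 hr hrl
  have := h.prefix_count hc h01 (r := l - r) (by omega) (by omega)
  omega

lemma letter_end : c (i + l - 1) = 0 := by
  have hl := h.two_le_length hc h01
  have hpal := h.prefix_count_eq_suffix_count hc h01 (r := 1) (by omega) (by omega)
  have hlast := hc (i + l - 1)
  rw [hc i, show i + (l - 1) = i + l - 1 by ring, (h.letter_left hc h01).1] at hpal
  rw [sub_add_cancel] at hlast
  omega

lemma letter_reverse {d : ℤ} (hd : 1 ≤ d) (hdl : d ≤ l - 2) :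
    c (i + l - 1 - d) = c (i + d) := by
  have hpal := h.prefix_count_eq_suffix_count hc h01 (r := d) (by omega) (by omega)
  have hpal' := h.prefix_count_eq_suffix_count hc h01 (r := d + 1) (by omega) (by omega)
  have hleft := hc (i + d)
  have hright := hc (i + l - 1 - d)
  rw [show i + (d + 1) = i + d + 1 by ring,
    show i + (l - (d + 1)) = i + l - 1 - d by ring] at hpal'
  rw [show i + (l - d) = i + l - 1 - d + 1 by ring] at hpal
  omega

lemma exists_first_difference (hM : MarkoffUp c) :
    ∃ d : ℕ, 1 ≤ d ∧ d ≤ j - 1 - i ∧ c (i + l - 1 - d) = 1 ∧ c (i + d) = 0 ∧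
      ∀ e : ℤ, 1 ≤ e → e < d → c (i + l - 1 - e) = c (i + e) := by
  classical
  have hij := h.add_one_lt hc h01
  obtain ⟨-, hil⟩ := h.letter_left hc h01
  obtain ⟨hj, hjl, -⟩ := h.letter_right hc h01
  have hex : ∃ d : ℕ, 1 ≤ d ∧ (c (i + l - 1 - d) ≠ c (i + l + d) ∨ (d : ℤ) = j - 1 - i) :=
    ⟨(j - 1 - i).toNat, by omega, Or.inr (by omega)⟩
  obtain ⟨d, ⟨hd, hdiff⟩, hmin⟩ : ∃ d : ℕ, (1 ≤ d ∧ (c (i + l - 1 - d) ≠ c (i + l + d) ∨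
      (d : ℤ) = j - 1 - i)) ∧ ∀ e : ℕ, e < d → 1 ≤ e →
        c (i + l - 1 - e) = c (i + l + e) ∧ (e : ℤ) ≠ j - 1 - i :=
    ⟨Nat.find hex, Nat.find_spec hex, fun e he he' => by
      have := Nat.find_min hex he
      tauto⟩
  have hdle : (d : ℤ) ≤ j - 1 - i := by
    by_contra! hlt
    exact (hmin (j - 1 - i).toNat (by omega) (by omega)).2 (by omega)
  have hmarkoff : c (i + l + d) = 1 → c (i + l - 1 - d) ≠ 0 :=
    hM (i + l) d hd hil (h.letter_end hc h01) fun e he hed => (hmin e hed he).1.symm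
  have hletters : c (i + l - 1 - d) = 1 ∧ c (i + d) = 0 := by
    have := h01 (i + l - 1 - d)
    rcases eq_or_lt_of_le hdle with hd' | hd'
    · rw [hd'] at hmarkoff this ⊢
      rw [show i + l + (j - 1 - i) = j - 1 + l by ring] at hmarkoff
      rw [show i + (j - 1 - i) = j - 1 by ring]
      have := hmarkoff hjl
      omega
    · have hper := h.letter_add_length hc (k := i + d) (by omega) (by omega)
      rw [show i + d + l = i + l + d by ring] at hper
      have := h01 (i + l + d)
      omega
  refine ⟨d, hd, hdle, hletters.1, hletters.2, fun e he hed => ?_⟩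
  have hagree := (hmin e.toNat (by omega) (by omega)).1
  rw [Int.toNat_of_nonneg (by omega)] at hagree
  rw [hagree, show i + l + e = i + e + l by ring]
  exact h.letter_add_length hc (by omega) (by omega)

/-- The window of length `l` starting at the first difference `i + l - 1 - d` contains two letters
`1` more than the window at `i`, although it is closer to it than the window at `j`. -/
theorem not_markoffUp : ¬ MarkoffUp c := fun hM => by
  obtain ⟨d, hd, hdle, hc1, hc0, hagree⟩ := h.exists_first_difference hc h01 hM
  have hl := h.two_le_length hc h01
  have hlj := h.length_le
  have hld : l ≤ d := by
    by_contra! hdl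
    rcases lt_or_ge (d : ℤ) (l - 1) with hdl' | hdl'
    · have := h.letter_reverse hc h01 (d := d) (by omega) (by omega)
      omega
    · rw [show i + l - 1 - (d : ℤ) = i by omega, (h.letter_left hc h01).1] at hc1
      omega
  have hmirror : ∀ r : ℕ, (r : ℤ) ≤ l - 1 →
      S (i + l - d + r) - S (i + l - d) = S (i + d) - S (i + d - r) := by
    intro r hr
    induction r with
    | zero => simp
    | succ r ih =>
      push_cast at hr ⊢
      have hcount := ih (by omega)
      have hleft := hc (i + l - d + r)
      have hright := hc (i + d - (r + 1))
      have hletter := hagree (d - 1 - r) (by omega) (by omega)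
      rw [show i + l - 1 - ((d : ℤ) - 1 - r) = i + l - d + r by ring,
        show i + ((d : ℤ) - 1 - r) = i + d - (r + 1) by ring] at hletter
      rw [show i + (d : ℤ) - (r + 1) + 1 = i + d - r by ring] at hright
      rw [show i + l - (d : ℤ) + (r + 1) = i + l - d + r + 1 by ring]
      omega
  have hcount := hmirror (l - 1).toNat (by omega)
  rw [Int.toNat_of_nonneg (by omega)] at hcount
  have hwindow := h.window_eq (k := i + d - (l - 1)) (by omega) (by omega)
  have hlast := hc (i + d)
  have hfirst := hc (i + l - 1 - d)
  have hclose := h.closer (i + l - 1 - d) i (by rw [abs_lt]; omega)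
  rw [show i + (d : ℤ) - (l - 1) + l = i + d + 1 by ring] at hwindow
  rw [show i + l - 1 - (d : ℤ) + 1 = i + l - d by ring] at hfirst
  rw [show i + l - 1 - (d : ℤ) + l = i + l - d + (l - 1) by ring] at hclose
  omega

end ClosestUnbalancedPair

lemma exists_closestUnbalancedPair {S : ℤ → ℤ} (hS : ¬ BalancedPrimitive S) :
    ∃ l i j, ClosestUnbalancedPair S l i j ∨ ClosestUnbalancedPair (fun n => n - S n) l i j := by
  classical
  have hviolation : ∃ l : ℕ, ∃ i j : ℤ, 2 ≤ S (j + l) - S j - (S (i + l) - S i) := by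
    simp only [BalancedPrimitive] at hS
    push Not at hS
    obtain ⟨l, j, i, hl, hlt⟩ := hS
    exact ⟨l.toNat, i, j, by rw [Int.toNat_of_nonneg hl]; omega⟩
  obtain ⟨l, hl, hshort⟩ : ∃ l : ℕ, (∃ i j : ℤ, 2 ≤ S (j + l) - S j - (S (i + l) - S i)) ∧
      ∀ r : ℤ, 0 ≤ r → r < l → ∀ i j, S (i + r) - S i - (S (j + r) - S j) ≤ 1 := by
    refine ⟨Nat.find hviolation, Nat.find_spec hviolation, fun r hr hrl i j => ?_⟩
    obtain ⟨r, rfl⟩ := Int.eq_ofNat_of_zero_le hr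
    by_contra! hlt
    exact Nat.find_min hviolation (m := r) (by omega) ⟨j, i, by omega⟩
  have hdist : ∃ k : ℕ, ∃ i j : ℤ, (i - j).natAbs = k ∧
      2 ≤ S (j + l) - S j - (S (i + l) - S i) := by
    obtain ⟨i, j, hij⟩ := hl
    exact ⟨_, i, j, rfl, hij⟩
  obtain ⟨i, j, hk, hij⟩ := Nat.find_spec hdist
  have hclose : ∀ i' j', |i' - j'| < |i - j| → S (i' + l) - S i' - (S (j' + l) - S j') ≤ 1 := by
    intro i' j' hlt
    by_contra! hgt
    refine Nat.find_min hdist (m := (j' - i').natAbs) ?_ ⟨j', i', rfl, by omega⟩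
    rw [← hk]
    zify
    rwa [abs_sub_comm]
  have hl₀ : 0 < (l : ℤ) := by
    rcases Nat.eq_zero_or_pos l with rfl | hl₀
    · simp at hij
    · exact_mod_cast hl₀
  rcases lt_trichotomy i j with hlt | rfl | hlt
  · refine ⟨l, i, j, .inl ⟨hlt, hl₀, hij, hshort, fun i' j' h => hclose i' j' ?_⟩⟩
    rwa [abs_sub_comm i j, abs_of_pos (by omega : 0 < j - i)]
  · omega
  · refine ⟨l, j, i, .inr ⟨hlt, hl₀, by omega, fun r hr hrl i' j' => ?_, fun i' j' h => ?_⟩⟩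
    · have := hshort r hr hrl j' i'
      omega
    · have := hclose j' i' (by rwa [abs_sub_comm j' i', abs_of_pos (by omega : 0 < i - j)])
      omega

theorem balancedPrimitive_of_markoffUp {S c : ℤ → ℤ} (hc : ∀ n, S (n + 1) = S n + c n)
    (h01 : ∀ n, c n = 0 ∨ c n = 1) (hM : MarkoffUp c) (hM' : MarkoffUp fun n => 1 - c n) :
    BalancedPrimitive S := by
  by_contra hS
  obtain ⟨l, i, j, h | h⟩ := exists_closestUnbalancedPair hS
  · exact h.not_markoffUp hc h01 hM
  · exact h.not_markoffUp (fun n => by simp only [hc]; ring)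
      (fun n => by have := h01 n; omega) hM'

/-! ### Words with small sums are second differences of balanced primitives -/

/-- The right half of a Green function sum, which satisfies a first-order recurrence. -/
noncomputable def rightSum (β : ℝ) (t : ℤ → ℤ) (n : ℤ) : ℝ := ∑' i : ℕ, (t (n + i) : ℝ) * β ^ i

/-- The left half of a Green function sum, which satisfies a first-order recurrence. -/
noncomputable def leftSum (β : ℝ) (t : ℤ → ℤ) (n : ℤ) : ℝ := ∑' i : ℕ, (t (n - i) : ℝ) * β ^ i

section HalfSums

variable {β : ℝ} (hβ₀ : 0 ≤ β) (hβ₁ : β < 1) {t : ℤ → ℤ} (ht : BoundedWord t)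
include hβ₀ hβ₁ ht

lemma BoundedWord.summable_comp (f : ℕ → ℤ) : Summable fun i : ℕ => (t (f i) : ℝ) * β ^ i :=
  have ⟨_, hB⟩ := ht
  summable_intCast_mul_pow_of_abs_le hβ₀ hβ₁ fun _ => hB _

lemma rightSum_eq_add_mul (n : ℤ) : rightSum β t n = t n + β * rightSum β t (n + 1) := by
  rw [rightSum, tsum_eq_add_mul_tsum_succ (ht.summable_comp hβ₀ hβ₁ fun i => n + i), rightSum,
    Nat.cast_zero, add_zero]
  push_cast
  simp only [add_assoc, add_comm (1 : ℤ)]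

lemma leftSum_eq_add_mul (n : ℤ) : leftSum β t n = t n + β * leftSum β t (n - 1) := by
  rw [leftSum, tsum_eq_add_mul_tsum_succ (ht.summable_comp hβ₀ hβ₁ fun i => n - i), leftSum,
    Nat.cast_zero, sub_zero]
  push_cast
  simp only [sub_sub, add_comm (1 : ℤ)]

lemma greenSum_eq_rightSum_add_leftSum (n : ℤ) :
    greenSum β t n = t n + β * rightSum β t (n + 1) + β * leftSum β t (n - 1) := by
  have hsplit : greenSum β t n = rightSum β t n + leftSum β t n - t n := by
    rw [greenSum, rightSum, leftSum, ← (ht.summable_comp hβ₀ hβ₁ fun i => n + i).tsum_add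
      (ht.summable_comp hβ₀ hβ₁ fun i => n - i)]
    exact congrArg (· - (t n : ℝ)) (tsum_congr fun i => by push_cast; ring)
  rw [hsplit, rightSum_eq_add_mul hβ₀ hβ₁ ht, leftSum_eq_add_mul hβ₀ hβ₁ ht]
  ring

end HalfSums

section SmallSums

variable {β : ℝ} {t : ℤ → ℤ}

lemma exists_neighbour_eq_neg_one (hβ₀ : 0 < β) (hβ : β < 1 / 3) (ht : ∀ n, |t n| ≤ 1)
    {n : ℤ} (hsum : greenSum β t n ≤ 1 - β) (hn : t n = 1) :
    t (n + 1) = -1 ∨ t (n - 1) = -1 := by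
  by_contra! hne
  have hβ₁ : β < 1 := by linarith
  have hb : BoundedWord t := ⟨1, ht⟩
  have hcast : ∀ m, |(t m : ℝ)| ≤ 1 := fun m => by exact_mod_cast ht m
  have hnext : (0 : ℝ) ≤ t (n + 1) := by
    have := abs_le.1 (ht (n + 1))
    exact_mod_cast (by omega : 0 ≤ t (n + 1))
  have hprev : (0 : ℝ) ≤ t (n - 1) := by
    have := abs_le.1 (ht (n - 1))
    exact_mod_cast (by omega : 0 ≤ t (n - 1))
  have hright : -(1 / (1 - β)) ≤ rightSum β t (n + 1 + 1) :=
    (abs_le.1 (abs_tsum_mul_pow_le hβ₀.le hβ₁ fun i => hcast _)).1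
  have hleft : -(1 / (1 - β)) ≤ leftSum β t (n - 1 - 1) :=
    (abs_le.1 (abs_tsum_mul_pow_le hβ₀.le hβ₁ fun i => hcast _)).1
  have htails : 2 * (1 / (1 - β)) * β < 1 := by
    rw [mul_one_div, div_mul_eq_mul_div, div_lt_one (by linarith)]; linarith
  rw [greenSum_eq_rightSum_add_leftSum hβ₀.le hβ₁ hb, rightSum_eq_add_mul hβ₀.le hβ₁ hb,
    leftSum_eq_add_mul hβ₀.le hβ₁ hb, hn, Int.cast_one] at hsum
  have hright' := mul_le_mul_of_nonneg_left hright (mul_pos hβ₀ hβ₀).le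
  have hleft' := mul_le_mul_of_nonneg_left hleft (mul_pos hβ₀ hβ₀).le
  nlinarith [mul_nonneg hβ₀.le hnext, mul_nonneg hβ₀.le hprev, mul_lt_mul_of_pos_left htails hβ₀]

/-- The letter before `t n = 1` is `-1`; if the next non-zero letter after it were also `1`, then
the sums at `n` and `n - 1` could not both be small. -/
lemma exists_ne_zero_of_eq_one_of_eq_one (hβ₀ : 0 < β) (hβ : β < 1 / 3) (ht : ∀ n, |t n| ≤ 1)
    (hsum : ∀ n, |greenSum β t n| ≤ 1 - β) {n m : ℤ} (hnm : n < m) (hn : t n = 1) (hm : t m = 1) :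
    ∃ k, n < k ∧ k < m ∧ t k ≠ 0 := by
  by_contra! hz
  have hβ₁ : β < 1 := by linarith
  have hb : BoundedWord t := ⟨1, ht⟩
  have hprev : t (n - 1) = -1 := by
    refine (exists_neighbour_eq_neg_one hβ₀ hβ ht (abs_le.1 (hsum n)).2 hn).resolve_left
      fun hnext => ?_
    rcases (show n + 1 ≤ m by omega).eq_or_lt with h | h
    · rw [h] at hnext; omega
    · have := hz (n + 1) (by omega) h; omega
  have hpos : 0 < rightSum β t (n + 1) := by
    refine tsum_mul_pow_pos_of_leading hβ₀ hβ₁ (B := 1) (by linarith) (m - n - 1).toNat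
      (fun i hi => ?_) ?_ fun i => ?_
    · rw [hz _ (by omega) (by omega), Int.cast_zero]
    · rw [show n + 1 + ((m - n - 1).toNat : ℤ) = m by omega, hm, Int.cast_one]
    · exact_mod_cast ht _
  have hupper := (abs_le.1 (hsum n)).2
  have hlower := (abs_le.1 (hsum (n - 1))).1
  rw [greenSum_eq_rightSum_add_leftSum hβ₀.le hβ₁ hb, leftSum_eq_add_mul hβ₀.le hβ₁ hb (n - 1),
    hn, hprev] at hupper
  rw [greenSum_eq_rightSum_add_leftSum hβ₀.le hβ₁ hb, sub_add_cancel,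
    rightSum_eq_add_mul hβ₀.le hβ₁ hb n, hn, hprev] at hlower
  push_cast at hupper hlower
  have hle : rightSum β t (n + 1) + β * leftSum β t (n - 1 - 1) ≤ 0 := by
    by_contra! h
    nlinarith [mul_pos hβ₀ h]
  have hge : 0 ≤ β * rightSum β t (n + 1) + leftSum β t (n - 1 - 1) := by
    by_contra! h
    nlinarith [mul_pos_of_neg_of_neg h (by linarith : -β < 0)]
  nlinarith [mul_nonneg hβ₀.le hge, mul_pos hpos (by nlinarith : 0 < 1 - β * β)]

lemma primitive_sub_le_one_of_shorter (hβ₀ : 0 < β) (hβ : β < 1 / 3) (ht : ∀ n, |t n| ≤ 1)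
    (hsum : ∀ n, |greenSum β t n| ≤ 1 - β) {C : ℤ → ℤ} (hC : ∀ n, C (n + 1) - C n = t n) {k : ℕ}
    (hshort : ∀ l < k, ∀ n : ℤ, |C (n + l) - C n| ≤ 1) (n : ℤ) : C (n + k) - C n ≤ 1 := by
  by_contra! hlt
  have hk : 2 ≤ k := by
    by_contra hk
    rcases (by omega : k = 0 ∨ k = 1) with rfl | rfl
    · simp at hlt
    · have := hC n
      have := abs_le.1 (ht n)
      push_cast at hlt; omega
  have hmid : ∀ m, n < m → m < n + k → C m = C n + 1 ∧ C (n + k) = C n + 2 := fun m hn hm => by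
    have hleft := abs_le.1 (hshort (m - n).toNat (by omega) n)
    have hright := abs_le.1 (hshort (n + k - m).toNat (by omega) m)
    rw [show n + ((m - n).toNat : ℤ) = m by omega] at hleft
    rw [show m + ((n + k - m).toNat : ℤ) = n + k by omega] at hright
    omega
  have hfirst := hC n
  have hlast := hC (n + k - 1)
  rw [sub_add_cancel] at hlast
  have := hmid (n + 1) (by omega) (by omega)
  have := hmid (n + k - 1) (by omega) (by omega)
  obtain ⟨m, hnm, hmk, hm⟩ := exists_ne_zero_of_eq_one_of_eq_one hβ₀ hβ ht hsum (n := n)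
    (m := n + k - 1) (by omega) (by omega) (by omega)
  have := hC m
  have := hmid m hnm (by omega)
  have := hmid (m + 1) (by omega) (by omega)
  omega

lemma abs_primitive_add_sub_le_one (hβ₀ : 0 < β) (hβ : β < 1 / 3) (ht : ∀ n, |t n| ≤ 1)
    (hsum : ∀ n, |greenSum β t n| ≤ 1 - β) {C : ℤ → ℤ} (hC : ∀ n, C (n + 1) - C n = t n)
    (k : ℕ) : ∀ n : ℤ, |C (n + k) - C n| ≤ 1 := by
  induction k using Nat.strong_induction_on with
  | _ k ih =>
  intro n
  have hupper := primitive_sub_le_one_of_shorter hβ₀ hβ ht hsum hC ih n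
  have hlower := primitive_sub_le_one_of_shorter (t := fun n => -t n) (C := fun n => -C n) hβ₀ hβ
    (fun n => by rw [abs_neg]; exact ht n) (fun n => by rw [greenSum_neg, abs_neg]; exact hsum n)
    (fun n => by rw [← hC]; ring)
    (fun l hl n => by rw [neg_sub_neg, abs_sub_comm]; exact ih l hl n) n
  rw [abs_le]
  omega

lemma exists_forall_sub_eq_zero_or_one {ι : Type*} [Nonempty ι] {C : ι → ℤ}
    (hC : ∀ m n, C m - C n ≤ 1) : ∃ a, ∀ n, C n - a = 0 ∨ C n - a = 1 := by
  inhabit ι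
  by_cases h : ∃ k, C k = C default - 1
  · obtain ⟨k, hk⟩ := h
    refine ⟨C k, fun n => ?_⟩
    have := hC n k
    have := hC default n
    omega
  · push Not at h
    refine ⟨C default, fun n => ?_⟩
    have := h n
    have := hC n default
    have := hC default n
    omega

lemma exists_binary_primitive (hβ₀ : 0 < β) (hβ : β < 1 / 3) (ht : ∀ n, |t n| ≤ 1)
    (hsum : ∀ n, |greenSum β t n| ≤ 1 - β) :
    ∃ c : ℤ → ℤ, (∀ n, c n = 0 ∨ c n = 1) ∧ ∀ n, t n = c n - c (n - 1) := by
  obtain ⟨C, hC⟩ := exists_primitive t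
  have hdiff : ∀ m n, C m - C n ≤ 1 := fun m n => by
    rcases le_total m n with h | h
    · have := abs_le.1 (abs_primitive_add_sub_le_one hβ₀ hβ ht hsum hC (n - m).toNat m)
      rw [show m + ((n - m).toNat : ℤ) = n by omega] at this
      omega
    · have := abs_le.1 (abs_primitive_add_sub_le_one hβ₀ hβ ht hsum hC (m - n).toNat n)
      rw [show n + ((m - n).toNat : ℤ) = m by omega] at this
      omega
  obtain ⟨a, ha⟩ := exists_forall_sub_eq_zero_or_one hdiff
  refine ⟨fun n => C (n + 1) - a, fun n => ha _, fun n => ?_⟩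
  simp only [sub_add_cancel, ← hC n]
  ring

lemma markoffUp_of_greenSum_le (hβ₀ : 0 < β) (hβ : β < 1 / 2) {c : ℤ → ℤ}
    (h01 : ∀ n, c n = 0 ∨ c n = 1)
    (hsum : ∀ n, greenSum β (fun n => c n - c (n - 1)) n ≤ 1 - β) : MarkoffUp c := by
  intro m d hd hm hm' hagree hmd hmd'
  have hβ₁ : β < 1 := by linarith
  have hdiff : ∀ n k, |c n - c k| ≤ 1 := fun n k => by
    have := h01 n
    have := h01 k
    rw [abs_le]
    omega
  have hc : BoundedWord c := ⟨1, fun n => by rcases h01 n with h | h <;> simp [h]⟩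
  have hpos : 0 < ∑' i : ℕ, ((c (m + ((i + 1 : ℕ) : ℤ)) - c (m - 1 - ((i + 1 : ℕ) : ℤ)) : ℤ) : ℝ)
      * β ^ i := by
    refine tsum_mul_pow_pos_of_leading hβ₀ hβ₁ (B := 1) (by linarith) (d - 1) (fun i hi => ?_) ?_
      fun i => by exact_mod_cast hdiff _ _
    · rw [hagree (i + 1) (by omega) (by omega)]; simp
    · rw [Nat.sub_add_cancel hd, hmd, hmd']; simp
  have hle := hsum m
  rw [greenSum_eq_of_primitive hβ₀.le hβ₁ ⟨1, fun n => hdiff _ _⟩ hc (fun _ => rfl),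
    tsum_eq_add_mul_tsum_succ
      (a := fun i : ℕ => ((c (m + i) - c (m - 1 - i) : ℤ) : ℝ))
      (summable_intCast_mul_pow_of_abs_le hβ₀.le hβ₁ fun i => hdiff _ _)] at hle
  simp only [Nat.cast_zero, add_zero, sub_zero, hm, hm', Int.cast_one] at hle
  nlinarith [mul_pos (mul_pos hβ₀ hpos) (by linarith : 0 < 1 - β)]

theorem exists_balancedPrimitive_of_abs_greenSum_le (hβ₀ : 0 < β) (hβ : β < 1 / 3)
    (ht : ∀ n, |t n| ≤ 1) (hsum : ∀ n, |greenSum β t n| ≤ 1 - β) :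
    ∃ S : ℤ → ℤ, BalancedPrimitive S ∧ (∀ n, S (n + 1) - S n = 0 ∨ S (n + 1) - S n = 1) ∧
      ∀ n, t n = S (n + 1) - 2 * S n + S (n - 1) := by
  obtain ⟨c, h01, hc⟩ := exists_binary_primitive hβ₀ hβ ht hsum
  obtain ⟨S, hS⟩ := exists_primitive c
  have hcomplement : (fun n => 1 - c n - (1 - c (n - 1))) = fun n => -t n := by
    funext n; rw [hc]; ring
  have hM : MarkoffUp c := markoffUp_of_greenSum_le hβ₀ (by linarith) h01 fun n => by
    rw [← funext hc]
    exact (abs_le.1 (hsum n)).2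
  have hM' : MarkoffUp fun n => 1 - c n :=
    markoffUp_of_greenSum_le hβ₀ (by linarith) (fun n => by have := h01 n; omega) fun n => by
      rw [hcomplement, greenSum_neg]
      linarith [(abs_le.1 (hsum n)).1]
  refine ⟨S, balancedPrimitive_of_markoffUp (fun n => by rw [← hS]; ring) h01 hM hM',
    fun n => by rw [hS]; exact h01 n, fun n => ?_⟩
  rw [hc, ← hS, ← hS (n - 1), sub_add_cancel]
  ring

end SmallSums

lemma BalancedPrimitive.abs_second_diff_le {S : ℤ → ℤ} (hS : BalancedPrimitive S) (n : ℤ) (i : ℕ) :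
    |S (n + i) - 2 * S n + S (n - i)| ≤ 1 := by
  have hupper := hS i n (n - i) (by omega)
  have hlower := hS i (n - i) n (by omega)
  rw [sub_add_cancel] at hupper hlower
  rw [abs_le]
  omega

/-! ### Sums of second differences of balanced words -/

/-- The largest absolute value of the sums of the second difference of `n ↦ ⌊n p / q⌋`, for `p`
coprime to `q ≥ 1`. -/
noncomputable def christoffelValue (β : ℝ) (q : ℕ) : ℝ :=
  (1 - β) * (1 - (1 - β) * β ^ (q - 1) / (1 - β ^ q))

section SecondDifferences

variable {β : ℝ}

lemma tsum_dvd_succ_mul_pow (hβ₀ : 0 ≤ β) (hβ₁ : β < 1) {q : ℕ} (hq : 1 ≤ q) :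
    ∑' i : ℕ, (if q ∣ i + 1 then (1 : ℝ) else 0) * β ^ i = β ^ (q - 1) / (1 - β ^ q) := by
  have hlt : β ^ q < 1 := pow_lt_one₀ hβ₀ hβ₁ (by omega)
  have hs : Summable fun i : ℕ => (if q ∣ i + 1 then (1 : ℝ) else 0) * β ^ i :=
    summable_mul_pow_of_abs_le hβ₀ hβ₁ (B := 1) fun i => by split_ifs <;> simp
  have hperiod : ∀ i : ℕ, (if q ∣ i + q + 1 then (1 : ℝ) else 0) * β ^ (i + q) =
      β ^ q * ((if q ∣ i + 1 then 1 else 0) * β ^ i) := fun i => by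
    simp only [show i + q + 1 = i + 1 + q by ring, Nat.dvd_add_self_right, pow_add]
    ring
  have hfirst : ∑ i ∈ Finset.range q, (if q ∣ i + 1 then (1 : ℝ) else 0) * β ^ i =
      β ^ (q - 1) := by
    rw [Finset.sum_eq_single (q - 1)]
    · simp [Nat.sub_add_cancel hq]
    · intro i hi hne
      have := Finset.mem_range.1 hi
      rw [if_neg fun hdvd => by have := Nat.le_of_dvd (by omega) hdvd; omega, zero_mul]
    · exact fun h => absurd (Finset.mem_range.2 (by omega)) h
  have hsplit := hs.sum_add_tsum_nat_add q
  rw [hfirst, tsum_congr hperiod, tsum_mul_left] at hsplit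
  rw [eq_div_iff (by linarith)]
  linarith

lemma one_sub_sq_mul_tsum_not_dvd (hβ₀ : 0 ≤ β) (hβ₁ : β < 1) {q : ℕ} (hq : 1 ≤ q) :
    (1 - β) ^ 2 * ∑' i : ℕ, (if q ∣ i + 1 then (0 : ℝ) else 1) * β ^ i = christoffelValue β q := by
  have hs : Summable fun i : ℕ => (if q ∣ i + 1 then (1 : ℝ) else 0) * β ^ i :=
    summable_mul_pow_of_abs_le hβ₀ hβ₁ (B := 1) fun i => by split_ifs <;> simp
  have hterm : ∀ i : ℕ, (if q ∣ i + 1 then (0 : ℝ) else 1) * β ^ i =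
      β ^ i - (if q ∣ i + 1 then 1 else 0) * β ^ i := fun i => by split_ifs <;> simp
  rw [tsum_congr hterm, (summable_geometric_of_lt_one hβ₀ hβ₁).tsum_sub hs,
    tsum_dvd_succ_mul_pow hβ₀ hβ₁ hq, tsum_geometric_of_lt_one hβ₀ hβ₁, christoffelValue]
  have : 1 - β ≠ 0 := by linarith
  field_simp

lemma christoffelValue_lt (hβ₀ : 0 < β) (hβ₁ : β < 1) {q : ℕ} (hq : 1 ≤ q) :
    christoffelValue β q < 1 - β := by
  have hlt : β ^ q < 1 := pow_lt_one₀ hβ₀.le hβ₁ (by omega)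
  have : 0 < (1 - β) * β ^ (q - 1) / (1 - β ^ q) :=
    div_pos (mul_pos (by linarith) (pow_pos hβ₀ _)) (by linarith)
  rw [christoffelValue]
  nlinarith

lemma le_pow_of_christoffelValue_le (hβ₀ : 0 ≤ β) (hβ₁ : β < 1) {q : ℕ} (hq : 1 ≤ q) {δ : ℝ}
    (h : christoffelValue β q ≤ 1 - β - δ) : δ ≤ β ^ (q - 1) := by
  have hle : β ^ q ≤ β := by simpa using pow_le_pow_of_le_one hβ₀ hβ₁.le hq
  have hdefect : (1 - β) * ((1 - β) * β ^ (q - 1) / (1 - β ^ q)) ≤ β ^ (q - 1) := by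
    rw [← mul_div_assoc, div_le_iff₀ (by linarith)]
    nlinarith [mul_nonneg (pow_nonneg hβ₀ (q - 1)) (by nlinarith :
      0 ≤ 1 - β ^ q - (1 - β) * (1 - β))]
  rw [christoffelValue] at h
  linarith

lemma tsum_mul_pow_le_of_forall_lt_le_neg_one (hβ₀ : 0 ≤ β) (hβ₁ : β < 1) (K : ℕ) :
    ∀ {a : ℕ → ℝ}, (∀ i, |a i| ≤ 1) → (∀ i < K, a i ≤ -1) →
      ∑' i, a i * β ^ i ≤ -((1 - 2 * β ^ K) / (1 - β)) := by
  induction K with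
  | zero =>
    intro a ha _
    refine (abs_le.1 (abs_tsum_mul_pow_le hβ₀ hβ₁ ha)).2.trans_eq ?_
    ring
  | succ K ih =>
    intro a ha hlt
    have htail := ih (a := fun i => a (i + 1)) (fun i => ha _) fun i hi => hlt _ (by omega)
    rw [tsum_eq_add_mul_tsum_succ (summable_mul_pow_of_abs_le hβ₀ hβ₁ ha)]
    refine (add_le_add (hlt 0 (by omega)) (mul_le_mul_of_nonneg_left htail hβ₀)).trans_eq ?_
    have : 1 - β ≠ 0 := by linarith
    field_simp
    ring

variable {S t : ℤ → ℤ}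

lemma BalancedPrimitive.boundedWord (hS : BalancedPrimitive S)
    (htS : ∀ n, t n = S (n + 1) - 2 * S n + S (n - 1)) : BoundedWord t := ⟨1, fun n => by
  have := hS.abs_second_diff_le n 1
  rwa [Nat.cast_one, ← htS] at this⟩

lemma BalancedPrimitive.abs_cast_second_diff_succ_le (hS : BalancedPrimitive S) (n : ℤ) (i : ℕ) :
    |((S (n + (i + 1)) - 2 * S n + S (n - (i + 1)) : ℤ) : ℝ)| ≤ 1 := by
  have := hS.abs_second_diff_le n (i + 1)
  push_cast at this
  exact_mod_cast this

variable (hβ₀ : 0 ≤ β) (hβ₁ : β < 1) (hS : BalancedPrimitive S)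
  (htS : ∀ n, t n = S (n + 1) - 2 * S n + S (n - 1))
include hβ₀ hβ₁ hS htS

lemma BalancedPrimitive.greenSum_eq (n : ℤ) : greenSum β t n = (1 - β) ^ 2 *
      ∑' i : ℕ, ((S (n + (i + 1)) - 2 * S n + S (n - (i + 1)) : ℤ) : ℝ) * β ^ i :=
  greenSum_eq_of_second_primitive hβ₀ hβ₁ (hS.boundedWord htS) htS n (hS.abs_second_diff_le n)

lemma BalancedPrimitive.abs_greenSum_le (n : ℤ) : |greenSum β t n| ≤ 1 - β := by
  rw [hS.greenSum_eq hβ₀ hβ₁ htS, abs_mul, abs_of_nonneg (sq_nonneg _)]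
  refine (mul_le_mul_of_nonneg_left (abs_tsum_mul_pow_le hβ₀ hβ₁
    (hS.abs_cast_second_diff_succ_le n)) (sq_nonneg _)).trans_eq ?_
  have : 1 - β ≠ 0 := by linarith
  field_simp

lemma BalancedPrimitive.abs_greenSum_le_christoffelValue {q : ℕ} (hq : 1 ≤ q) (n : ℤ)
    (hdvd : ∀ i : ℕ, q ∣ i → S (n + i) - 2 * S n + S (n - i) = 0) :
    |greenSum β t n| ≤ christoffelValue β q := by
  rw [hS.greenSum_eq hβ₀ hβ₁ htS, abs_mul, abs_of_nonneg (sq_nonneg _),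
    ← one_sub_sq_mul_tsum_not_dvd hβ₀ hβ₁ hq, ← Real.norm_eq_abs (∑' _, _)]
  have hs : Summable fun i : ℕ => (if q ∣ i + 1 then (0 : ℝ) else 1) * β ^ i :=
    summable_mul_pow_of_abs_le hβ₀ hβ₁ (B := 1) fun i => by split_ifs <;> simp
  refine mul_le_mul_of_nonneg_left (tsum_of_norm_bounded hs.hasSum fun i => ?_) (sq_nonneg _)
  rw [Real.norm_eq_abs, abs_mul, abs_of_nonneg (pow_nonneg hβ₀ i)]
  refine mul_le_mul_of_nonneg_right ?_ (pow_nonneg hβ₀ i)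
  split_ifs with h
  · have hzero := hdvd (i + 1) h
    push_cast at hzero
    rw [hzero, Int.cast_zero, abs_zero]
  · exact hS.abs_cast_second_diff_succ_le n i

lemma BalancedPrimitive.exists_second_diff_nonneg {δ : ℝ} (hδ : 0 < δ)
    (hsum : ∀ n, |greenSum β t n| ≤ 1 - β - δ) :
    ∃ K : ℕ, ∀ n, ∃ i : ℕ, 1 ≤ i ∧ i ≤ K ∧ 0 ≤ S (n + i) - 2 * S n + S (n - i) := by
  obtain ⟨K, hK⟩ := exists_pow_lt_of_lt_one (half_pos hδ) hβ₁
  refine ⟨K, fun n => ?_⟩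
  by_contra! hneg
  have hlower := (abs_le.1 (hsum n)).1
  rw [hS.greenSum_eq hβ₀ hβ₁ htS] at hlower
  have hupper := mul_le_mul_of_nonneg_left (tsum_mul_pow_le_of_forall_lt_le_neg_one hβ₀ hβ₁ K
    (hS.abs_cast_second_diff_succ_le n) fun i hi => by
      have := hneg (i + 1) (by omega) hi
      push_cast at this
      exact_mod_cast (by omega : S (n + (i + 1)) - 2 * S n + S (n - (i + 1)) ≤ -1))
    (sq_nonneg (1 - β))
  have hvalue : (1 - β) ^ 2 * -((1 - 2 * β ^ K) / (1 - β)) = -((1 - β) * (1 - 2 * β ^ K)) := by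
    have : 1 - β ≠ 0 := by linarith
    field_simp
  nlinarith [pow_nonneg hβ₀ K]

end SecondDifferences

/-! ### Slopes of balanced words -/

lemma BalancedPrimitive.mul_window_count_le {S : ℤ → ℤ} (hS : BalancedPrimitive S) (l m : ℕ)
    (i j : ℤ) : m * (S (i + l) - S i - 1) ≤ l * (S (j + m) - S j + 1) := by
  have hlower : ∀ k : ℕ, k * (S (i + l) - S i - 1) ≤ S (k * l) - S 0 := fun k => by
    induction k with
    | zero => simp
    | succ k ih =>
      have := hS l i (k * l) (by omega)
      push_cast
      rw [show ((k : ℤ) + 1) * l = k * l + l by ring]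
      linarith
  have hupper : ∀ k : ℕ, S (k * m) - S 0 ≤ k * (S (j + m) - S j + 1) := fun k => by
    induction k with
    | zero => simp
    | succ k ih =>
      have := hS m (k * m) j (by omega)
      push_cast
      rw [show ((k : ℤ) + 1) * m = k * m + m by ring]
      linarith
  calc m * (S (i + l) - S i - 1) ≤ S (m * l) - S 0 := hlower m
    _ = S (l * m) - S 0 := by rw [mul_comm]
    _ ≤ l * (S (j + m) - S j + 1) := hupper l

/-- The slope is the supremum of `(S (i + l) - S i - 1) / l`, as each of these quotients is at most
each of the quotients `(S (j + m) - S j + 1) / m`. -/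
lemma BalancedPrimitive.exists_slope {S : ℤ → ℤ} (hS : BalancedPrimitive S) :
    ∃ θ : ℝ, ∀ m n : ℤ, |(S m - m * θ : ℝ) - (S n - n * θ)| ≤ 1 := by
  set A : Set ℝ := {x | ∃ (l : ℕ) (i : ℤ), 1 ≤ l ∧ x = ((S (i + l) - S i - 1 : ℤ) : ℝ) / l}
  have hub : ∀ (m : ℕ) (j : ℤ), 1 ≤ m → ((S (j + m) - S j + 1 : ℤ) : ℝ) / m ∈ upperBounds A := by
    rintro m j hm _ ⟨l, i, hl, rfl⟩
    rw [div_le_div_iff₀ (by exact_mod_cast hl) (by exact_mod_cast hm), mul_comm, mul_comm _ (l : ℝ)]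
    exact_mod_cast hS.mul_window_count_le l m i j
  have hne : A.Nonempty := ⟨_, 1, 0, le_rfl, rfl⟩
  have hbdd : BddAbove A := ⟨_, hub 1 0 le_rfl⟩
  have hforward : ∀ (l : ℕ) (n : ℤ),
      |(S (n + l) - (n + l : ℤ) * sSup A : ℝ) - (S n - n * sSup A)| ≤ 1 := by
    intro l n
    rcases Nat.eq_zero_or_pos l with rfl | hl
    · simp
    · have hl' : (0 : ℝ) < l := by exact_mod_cast hl
      have hle : ((S (n + l) - S n - 1 : ℤ) : ℝ) / l ≤ sSup A := le_csSup hbdd ⟨l, n, hl, rfl⟩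
      have hge : sSup A ≤ ((S (n + l) - S n + 1 : ℤ) : ℝ) / l := csSup_le hne (hub l n hl)
      rw [div_le_iff₀ hl'] at hle
      rw [le_div_iff₀ hl'] at hge
      push_cast at hle hge ⊢
      rw [abs_le]
      constructor <;> linarith
  refine ⟨sSup A, fun m n => ?_⟩
  rcases le_total n m with h | h
  · simpa [Int.toNat_of_nonneg (sub_nonneg.2 h)] using hforward (m - n).toNat n
  · rw [abs_sub_comm]
    simpa [Int.toNat_of_nonneg (sub_nonneg.2 h)] using hforward (n - m).toNat m

lemma slope_mem_Icc {S : ℤ → ℤ} (hstep : ∀ n, S (n + 1) - S n = 0 ∨ S (n + 1) - S n = 1) {θ : ℝ}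
    (hθ : ∀ m n : ℤ, |(S m - m * θ : ℝ) - (S n - n * θ)| ≤ 1) : θ ∈ Set.Icc (0 : ℝ) 1 := by
  have hgrow : ∀ l : ℕ, 0 ≤ S l - S 0 ∧ S l - S 0 ≤ l := fun l => by
    induction l with
    | zero => simp
    | succ l ih => have := hstep l; push_cast; omega
  have hlower : ∀ l : ℕ, (0 : ℝ) ≤ S l - S 0 := fun l => by exact_mod_cast (hgrow l).1
  have hupper : ∀ l : ℕ, (S l - S 0 : ℝ) ≤ l := fun l => by exact_mod_cast (hgrow l).2
  have hdev : ∀ l : ℕ, |(S l - S 0 : ℝ) - l * θ| ≤ 1 := fun l => by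
    have := hθ l 0
    push_cast at this
    rwa [zero_mul, sub_zero, sub_right_comm] at this
  constructor <;> by_contra! hlt
  · obtain ⟨l, hl⟩ := exists_nat_gt (1 / -θ)
    rw [div_lt_iff₀ (by linarith)] at hl
    linarith [(abs_le.1 (hdev l)).2, hlower l]
  · obtain ⟨l, hl⟩ := exists_nat_gt (1 / (θ - 1))
    rw [div_lt_iff₀ (by linarith)] at hl
    linarith [(abs_le.1 (hdev l)).1, hupper l]

lemma exists_le_abs_mul_sub {θ : ℝ} (hθ : ∀ i : ℕ, 1 ≤ i → ∀ z : ℤ, (i : ℝ) * θ ≠ z) (K : ℕ) :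
    ∃ ε > 0, ∀ i : ℕ, 1 ≤ i → i ≤ K → ∀ z : ℤ, ε ≤ |(i : ℝ) * θ - z| := by
  induction K with
  | zero => exact ⟨1, one_pos, fun i hi hi' => by omega⟩
  | succ K ih =>
    obtain ⟨ε, hε, hle⟩ := ih
    refine ⟨min ε |((K + 1 : ℕ) : ℝ) * θ - round (((K + 1 : ℕ) : ℝ) * θ)|,
      lt_min hε (abs_pos.2 (sub_ne_zero.2 (hθ _ (by omega) _))), fun i hi hiK z => ?_⟩
    rcases hiK.lt_or_eq with hlt | rfl
    · exact (min_le_left _ _).trans (hle i hi (by omega) z)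
    · exact (min_le_right _ _).trans (round_le _ z)

/-- Otherwise, at a position where the deviation `S n - n θ` almost attains its supremum, all second
differences of bounded length are negative. -/
lemma exists_mul_slope_eq_intCast {S : ℤ → ℤ} {K : ℕ}
    (hK : ∀ n, ∃ i : ℕ, 1 ≤ i ∧ i ≤ K ∧ 0 ≤ S (n + i) - 2 * S n + S (n - i)) {θ : ℝ}
    (hθ : ∀ m n : ℤ, |(S m - m * θ : ℝ) - (S n - n * θ)| ≤ 1) :
    ∃ i : ℕ, 1 ≤ i ∧ ∃ z : ℤ, (i : ℝ) * θ = z := by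
  by_contra! hirr
  obtain ⟨ε, hε, hgap⟩ := exists_le_abs_mul_sub hirr K
  set f : ℤ → ℝ := fun n => S n - n * θ with hf
  have hbdd : BddAbove (Set.range f) := ⟨f 0 + 1, by
    rintro _ ⟨n, rfl⟩; linarith [(abs_le.1 (hθ n 0)).2]⟩
  have hle : ∀ m, f m ≤ sSup (Set.range f) := fun m => le_csSup hbdd ⟨m, rfl⟩
  obtain ⟨_, ⟨n, rfl⟩, hn⟩ := exists_lt_of_lt_csSup (Set.range_nonempty f)
    (sub_lt_self (sSup (Set.range f)) hε)
  obtain ⟨i, hi, hiK, hdiff⟩ := hK n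
  have hdiff' : 0 ≤ f (n + i) + f (n - i) - 2 * f n := by
    have : (0 : ℝ) ≤ S (n + i) - 2 * S n + S (n - i) := by exact_mod_cast hdiff
    simp only [hf]
    push_cast
    linarith
  have hfar := hgap i hi hiK (S (n + i) - S n)
  rw [show (i : ℝ) * θ - ((S (n + i) - S n : ℤ) : ℝ) = f n - f (n + i) by
    simp only [hf]; push_cast; ring] at hfar
  have hnear : |f n - f (n + i)| < ε := by
    rw [abs_lt]
    constructor <;> linarith [hle (n + i), hle (n - i)]
  linarith

/-! ### Balanced words whose second differences are recurrently non-negative -/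

/-- The deviation of `S` from the slope `p / q`, multiplied by `q`. -/
def slopeDeviation (p q : ℕ) (S : ℤ → ℤ) (n : ℤ) : ℤ := q * S n - p * n

lemma BalancedPrimitive.exists_coprime_slope {S : ℤ → ℤ} (hS : BalancedPrimitive S)
    (hstep : ∀ n, S (n + 1) - S n = 0 ∨ S (n + 1) - S n = 1) {K : ℕ}
    (hK : ∀ n, ∃ i : ℕ, 1 ≤ i ∧ i ≤ K ∧ 0 ≤ S (n + i) - 2 * S n + S (n - i)) :
    ∃ p q : ℕ, 1 ≤ q ∧ p ≤ q ∧ p.Coprime q ∧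
      ∀ m n, slopeDeviation p q S m - slopeDeviation p q S n ≤ q := by
  obtain ⟨θ, hθ⟩ := hS.exists_slope
  obtain ⟨i, hi, z, hz⟩ := exists_mul_slope_eq_intCast hK hθ
  obtain ⟨hθ₀, hθ₁⟩ := slope_mem_Icc hstep hθ
  have hi₀ : (0 : ℝ) < i := by exact_mod_cast hi
  have hz₀ : 0 ≤ z := by
    have : (0 : ℝ) ≤ z := hz ▸ mul_nonneg hi₀.le hθ₀
    exact_mod_cast this
  have hzi : z ≤ i := by
    have : (z : ℝ) ≤ i := hz ▸ mul_le_of_le_one_right hi₀.le hθ₁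
    exact_mod_cast this
  obtain ⟨p, rfl⟩ := Int.eq_ofNat_of_zero_le hz₀
  obtain ⟨d, p, q, hd, hcop, rfl, rfl⟩ := Nat.exists_coprime' (m := p) (n := i)
    (Nat.gcd_pos_of_pos_right _ hi)
  have hd₀ : (d : ℝ) ≠ 0 := by positivity
  have hpq : p ≤ q := Nat.le_of_mul_le_mul_right (by exact_mod_cast hzi) hd
  have hslope : q * θ = p := by
    push_cast at hz
    exact mul_left_cancel₀ hd₀ (by linarith)
  refine ⟨p, q, Nat.pos_of_mul_pos_right hi, hpq, hcop, fun m n => ?_⟩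
  have : ((slopeDeviation p q S m - slopeDeviation p q S n : ℤ) : ℝ) ≤ q := by
    have := mul_le_mul_of_nonneg_left (abs_le.1 (hθ m n)).2 (Nat.cast_nonneg (α := ℝ) q)
    simp only [slopeDeviation]
    push_cast
    rw [← hslope]
    linarith
  exact_mod_cast this

lemma exists_forall_le_of_forall_sub_le {F : ℤ → ℤ} {B : ℤ} (hF : ∀ m n, F m - F n ≤ B) :
    ∃ n₀, ∀ n, F n ≤ F n₀ := by
  obtain ⟨_, ⟨n₀, rfl⟩, hmax⟩ := Int.exists_greatest_of_bdd (P := fun z => ∃ n, F n = z)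
    ⟨F 0 + B, by rintro _ ⟨n, rfl⟩; linarith [hF n 0]⟩ ⟨_, 0, rfl⟩
  exact ⟨n₀, fun n => hmax _ ⟨n, rfl⟩⟩

lemma forall_nat_of_recurrent {A : ℤ → Prop} (hA₀ : A 0)
    (hmono : ∀ k k', A k → ¬ A (k + 1) → ¬ A k' → A (k' + 1) → False)
    (hrec : ∀ k, A k → ∃ i : ℕ, 1 ≤ i ∧ A (k + i)) (k : ℕ) : A k := by
  by_contra hk
  obtain ⟨m, hm, hm'⟩ : ∃ m : ℤ, A m ∧ ¬ A (m + 1) := by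
    by_contra! hsucc
    refine hk ?_
    clear hk
    induction k with
    | zero => exact hA₀
    | succ k ih => push_cast; exact hsucc _ ih
  obtain ⟨i, hi, hAi⟩ := hrec m hm
  have hnever : ∀ j : ℕ, ¬ A (m + 1 + j) := fun j => by
    induction j with
    | zero => simpa using hm'
    | succ j ih =>
      intro h
      exact hmono m (m + 1 + j) hm hm' ih (by push_cast at h; rwa [← add_assoc] at h)
  refine hnever (i - 1) ?_
  rwa [show m + 1 + ((i - 1 : ℕ) : ℤ) = m + i by omega]

lemma forall_int_of_recurrent {A : ℤ → Prop} (hA₀ : A 0)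
    (hmono : ∀ k k', A k → ¬ A (k + 1) → ¬ A k' → A (k' + 1) → False)
    (hrec : ∀ k, A k → ∃ i : ℕ, 1 ≤ i ∧ A (k + i) ∧ A (k - i)) (k : ℤ) : A k := by
  obtain ⟨k, rfl | rfl⟩ := Int.eq_nat_or_neg k
  · exact forall_nat_of_recurrent hA₀ hmono
      (fun k hk => (hrec k hk).imp fun i hi => ⟨hi.1, hi.2.1⟩) k
  · refine forall_nat_of_recurrent (A := fun k => A (-k)) (by simpa using hA₀)
      (fun k k' hk hk₁ hk' hk'₁ => ?_) (fun k hk => (hrec _ hk).imp fun i hi => ⟨hi.1, ?_⟩) k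
    · refine hmono (-(k' + 1)) (-(k + 1)) hk'₁ ?_ hk₁ ?_ <;> simpa
    · have := hi.2.2
      rwa [neg_add]

section SlopeDeviation

variable {p q : ℕ} {S : ℤ → ℤ}

lemma slopeDeviation_add_mul_sub (k n : ℤ) :
    slopeDeviation p q S (n + k * q) - slopeDeviation p q S n =
      q * (S (n + k * q) - S n - p * k) := by
  simp only [slopeDeviation]; ring

lemma dvd_of_slopeDeviation_add_sub (hcop : p.Coprime q) {n m : ℤ}
    (h : (q : ℤ) ∣ slopeDeviation p q S (n + m) - slopeDeviation p q S n) : (q : ℤ) ∣ m := by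
  have hdvd : (q : ℤ) ∣ p * m := by
    rw [show (p : ℤ) * m = q * (S (n + m) - S n) -
      (slopeDeviation p q S (n + m) - slopeDeviation p q S n) by simp only [slopeDeviation]; ring]
    exact dvd_sub (dvd_mul_right _ _) h
  exact (Nat.isCoprime_iff_coprime.2 hcop.symm).dvd_of_dvd_mul_left hdvd

variable {n₀ : ℤ} (hmax : ∀ n, slopeDeviation p q S n ≤ slopeDeviation p q S n₀)
include hmax

lemma slopeDeviation_max_recurrent
    (hrec : ∀ n, ∃ i : ℕ, 1 ≤ i ∧ 0 ≤ S (n + i) - 2 * S n + S (n - i)) {n : ℤ}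
    (hn : slopeDeviation p q S n = slopeDeviation p q S n₀) :
    ∃ i : ℕ, 1 ≤ i ∧ slopeDeviation p q S (n + i) = slopeDeviation p q S n₀ ∧
      slopeDeviation p q S (n - i) = slopeDeviation p q S n₀ := by
  obtain ⟨i, hi, hdiff⟩ := hrec n
  have hsum : slopeDeviation p q S (n + i) + slopeDeviation p q S (n - i) -
      2 * slopeDeviation p q S n = q * (S (n + i) - 2 * S n + S (n - i)) := by
    simp only [slopeDeviation]; ring
  have := mul_nonneg (Int.natCast_nonneg q) hdiff
  have := hmax (n + i)
  have := hmax (n - i)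
  exact ⟨i, hi, by omega, by omega⟩

lemma slopeDeviation_add_mul_eq_or (hq : 1 ≤ q)
    (hF : ∀ m n, slopeDeviation p q S m - slopeDeviation p q S n ≤ q) (k : ℤ) :
    slopeDeviation p q S (n₀ + k * q) = slopeDeviation p q S n₀ ∨
      slopeDeviation p q S (n₀ + k * q) = slopeDeviation p q S n₀ - q := by
  have hle := hF n₀ (n₀ + k * q)
  have hge := hmax (n₀ + k * q)
  have hmul := slopeDeviation_add_mul_sub (p := p) (q := q) (S := S) k n₀
  set z := S (n₀ + k * q) - S n₀ - p * k
  have hz₀ : z ≤ 0 := by by_contra! h; nlinarith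
  have hz₁ : -1 ≤ z := by by_contra! h; nlinarith
  rcases (by omega : z = 0 ∨ z = -1) with hz | hz <;> rw [hz] at hmul <;> omega

/-- If the maximum were not attained on all of `n₀ + q ℤ`, then it would be left and reached again
along this progression, and the two steps of length `q` would violate balance. -/
lemma slopeDeviation_add_mul_eq (hS : BalancedPrimitive S) (hq : 1 ≤ q) (hcop : p.Coprime q)
    (hF : ∀ m n, slopeDeviation p q S m - slopeDeviation p q S n ≤ q)
    (hrec : ∀ n, ∃ i : ℕ, 1 ≤ i ∧ 0 ≤ S (n + i) - 2 * S n + S (n - i)) (k : ℤ) :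
    slopeDeviation p q S (n₀ + k * q) = slopeDeviation p q S n₀ := by
  have hval := slopeDeviation_add_mul_eq_or hmax hq hF
  have hstep : ∀ k : ℤ, slopeDeviation p q S (n₀ + (k + 1) * q) -
      slopeDeviation p q S (n₀ + k * q) = q * (S (n₀ + k * q + q) - S (n₀ + k * q) - p) := by
    intro k
    rw [add_one_mul, ← add_assoc]
    simp only [slopeDeviation]
    ring
  refine forall_int_of_recurrent
    (A := fun k => slopeDeviation p q S (n₀ + k * q) = slopeDeviation p q S n₀) (by simp)
    (fun k k' hk hk₁ hk' hk'₁ => ?_) (fun k hk => ?_) k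
  · have hleave := hstep k
    have hreach := hstep k'
    rw [hk, (hval _).resolve_left hk₁] at hleave
    rw [hk'₁, (hval _).resolve_left hk'] at hreach
    have := hS q (n₀ + k' * q) (n₀ + k * q) (by omega)
    nlinarith
  · obtain ⟨i, hi, hnext, hprev⟩ := slopeDeviation_max_recurrent hmax hrec hk
    obtain ⟨z, hz⟩ := dvd_of_slopeDeviation_add_sub (S := S) (n := n₀ + k * q) (m := i) hcop
      (by rw [hnext, hk, sub_self]; exact dvd_zero _)
    have hz₀ : 0 < z := pos_of_mul_pos_right (by omega : 0 < (q : ℤ) * z) (by omega)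
    rw [hz] at hnext hprev
    refine ⟨z.toNat, by omega, ?_, ?_⟩
    · rw [Int.toNat_of_nonneg hz₀.le, ← hnext]; congr 1; ring
    · rw [Int.toNat_of_nonneg hz₀.le, ← hprev]; congr 1; ring

end SlopeDeviation

theorem BalancedPrimitive.exists_eq_add_ediv {S : ℤ → ℤ} (hS : BalancedPrimitive S)
    (hstep : ∀ n, S (n + 1) - S n = 0 ∨ S (n + 1) - S n = 1) {K : ℕ}
    (hK : ∀ n, ∃ i : ℕ, 1 ≤ i ∧ i ≤ K ∧ 0 ≤ S (n + i) - 2 * S n + S (n - i)) :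
    ∃ p q : ℕ, 1 ≤ q ∧ p ≤ q ∧ p.Coprime q ∧ ∃ n₀ : ℤ, ∀ m : ℤ, S (n₀ + m) = S n₀ + m * p / q := by
  obtain ⟨p, q, hq, hpq, hcop, hF⟩ := hS.exists_coprime_slope hstep hK
  obtain ⟨n₀, hmax⟩ := exists_forall_le_of_forall_sub_le hF
  have hrec : ∀ n, ∃ i : ℕ, 1 ≤ i ∧ 0 ≤ S (n + i) - 2 * S n + S (n - i) := fun n =>
    (hK n).imp fun i hi => ⟨hi.1, hi.2.2⟩
  refine ⟨p, q, hq, hpq, hcop, n₀, fun m => ?_⟩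
  have hle := hmax (n₀ + m)
  have hlt : slopeDeviation p q S n₀ - slopeDeviation p q S (n₀ + m) < q := by
    refine (hF _ _).lt_of_ne fun h => ?_
    obtain ⟨z, rfl⟩ := dvd_of_slopeDeviation_add_sub (S := S) (n := n₀) (m := m) hcop
      ⟨-1, by linarith⟩
    have := slopeDeviation_add_mul_eq hmax hS hq hcop hF hrec z
    rw [mul_comm] at h
    omega
  have hfloor : m * p / q = S (n₀ + m) - S n₀ := by
    rw [Int.ediv_eq_iff_of_pos (by omega)]
    simp only [slopeDeviation] at hle hlt
    constructor <;> linarith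
  rw [hfloor]
  ring

/-! ### Mechanical words -/

/-- The second difference of `n ↦ ⌊(n p + a) / q⌋`. -/
def mechWord (p q : ℕ) (a : ℤ) (n : ℤ) : ℤ :=
  ((n + 1) * p + a) / q - 2 * ((n * p + a) / q) + ((n - 1) * p + a) / q

lemma add_ediv_mem_Icc {q : ℤ} (hq : 0 < q) (x y : ℤ) :
    (x + y) / q ∈ Set.Icc (x / q + y / q) (x / q + y / q + 1) := by
  have hx := Int.mul_ediv_add_emod x q
  have hy := Int.mul_ediv_add_emod y q
  have := Int.emod_nonneg x hq.ne'
  have := Int.emod_nonneg y hq.ne'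
  have := Int.emod_lt_of_pos x hq
  have := Int.emod_lt_of_pos y hq
  constructor
  · rw [Int.le_ediv_iff_mul_le hq]; nlinarith
  · rw [← Int.lt_add_one_iff, Int.ediv_lt_iff_lt_mul hq]; nlinarith

lemma balancedPrimitive_ediv (p a : ℤ) {q : ℤ} (hq : 0 < q) :
    BalancedPrimitive fun m => (m * p + a) / q := by
  intro l i j _
  have hi := (add_ediv_mem_Icc hq (i * p + a) (l * p)).2
  have hj := (add_ediv_mem_Icc hq (j * p + a) (l * p)).1
  beta_reduce
  rw [show (i + l) * p + a = i * p + a + l * p by ring,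
    show (j + l) * p + a = j * p + a + l * p by ring]
  omega

lemma exists_dvd_mul_add {p q : ℕ} (hpq : p.Coprime q) (a : ℤ) : ∃ n : ℤ, (q : ℤ) ∣ n * p + a := by
  obtain ⟨u, v, huv⟩ := Nat.isCoprime_iff_coprime.2 hpq
  exact ⟨-(a * u), a * v, by linear_combination (-a) * huv⟩

section MechanicalWords

variable {p q : ℕ} (hq : 1 ≤ q) (a : ℤ)
include hq

lemma mechWord_add_period (n k : ℤ) : mechWord p q a (n + k * q) = mechWord p q a n := by
  have hq₀ : (q : ℤ) ≠ 0 := by omega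
  simp only [mechWord]
  rw [show (n + k * q + 1) * (p : ℤ) + a = (n + 1) * p + a + k * p * q by ring,
    show (n + k * q) * (p : ℤ) + a = n * p + a + k * p * q by ring,
    show (n + k * q - 1) * (p : ℤ) + a = (n - 1) * p + a + k * p * q by ring]
  simp only [Int.add_mul_ediv_right _ _ hq₀]
  ring

lemma boundedWord_mechWord : BoundedWord (mechWord p q a) :=
  (balancedPrimitive_ediv p a (by omega : (0 : ℤ) < q)).boundedWord fun _ => rfl

lemma ediv_second_diff_eq_zero (n : ℤ) {i : ℤ} (hi : (q : ℤ) ∣ i) :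
    ((n + i) * p + a) / q - 2 * ((n * p + a) / q) + ((n - i) * p + a) / q = 0 := by
  obtain ⟨k, rfl⟩ := hi
  have hq₀ : (q : ℤ) ≠ 0 := by omega
  rw [show (n + q * k) * (p : ℤ) + a = n * p + a + k * p * q by ring,
    show (n - q * k) * (p : ℤ) + a = n * p + a + -(k * p) * q by ring]
  simp only [Int.add_mul_ediv_right _ _ hq₀]
  ring

lemma ediv_second_diff_eq_neg_one (hpq : p.Coprime q) {n : ℤ} (hn : (q : ℤ) ∣ n * p + a) {i : ℤ}
    (hi : ¬ (q : ℤ) ∣ i) :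
    ((n + i) * p + a) / q - 2 * ((n * p + a) / q) + ((n - i) * p + a) / q = -1 := by
  have hq₀ : (q : ℤ) ≠ 0 := by omega
  obtain ⟨z, hz⟩ := hn
  have hndvd : ¬ (q : ℤ) ∣ i * p := fun h =>
    hi ((Nat.isCoprime_iff_coprime.2 hpq.symm).dvd_of_dvd_mul_right h)
  rw [show (n + i) * (p : ℤ) + a = i * p + z * q by linarith,
    show (n - i) * (p : ℤ) + a = -(i * p) + z * q by linarith, hz,
    Int.add_mul_ediv_right _ _ hq₀, Int.add_mul_ediv_right _ _ hq₀, Int.mul_ediv_cancel_left _ hq₀,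
    Int.neg_ediv, if_neg hndvd, Int.sign_eq_one_of_pos (by omega)]
  ring

variable {β : ℝ} (hβ₀ : 0 ≤ β) (hβ₁ : β < 1)
include hβ₀ hβ₁

lemma abs_greenSum_mechWord_le (n : ℤ) : |greenSum β (mechWord p q a) n| ≤ christoffelValue β q :=
  (balancedPrimitive_ediv p a (by omega : (0 : ℤ) < q)).abs_greenSum_le_christoffelValue hβ₀ hβ₁
    (fun _ => rfl) hq n fun _ hi => ediv_second_diff_eq_zero hq a n (Int.natCast_dvd_natCast.2 hi)

lemma greenSum_mechWord_eq (hpq : p.Coprime q) {n : ℤ} (hn : (q : ℤ) ∣ n * p + a) :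
    greenSum β (mechWord p q a) n = -christoffelValue β q := by
  rw [(balancedPrimitive_ediv p a (by omega : (0 : ℤ) < q)).greenSum_eq hβ₀ hβ₁
    (t := mechWord p q a) (fun _ => rfl), ← one_sub_sq_mul_tsum_not_dvd hβ₀ hβ₁ hq, ← mul_neg,
    ← tsum_neg]
  congr 2
  funext i
  rw [← neg_mul]
  congr 1
  split_ifs with h
  · rw [ediv_second_diff_eq_zero hq a n (by exact_mod_cast h), Int.cast_zero, neg_zero]
  · rw [ediv_second_diff_eq_neg_one hq a hpq hn (by exact_mod_cast h), Int.cast_neg, Int.cast_one]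

end MechanicalWords

/-! ### Limit words -/

/-- `t` is a limit of the translates `w (n + ·)` along an ultrafilter of positions tending to
infinity. Ultrafilters replace the extraction of convergent subsequences. -/
def IsLimitAlong (U : Ultrafilter ℤ) (w t : ℤ → ℤ) : Prop :=
  (U : Filter ℤ) ≤ atTop ∧ ∀ i, ∀ᶠ n in (U : Filter ℤ), w (n + i) = t i

/-- Limit words of `w` at `+∞`. -/
def IsLimitWord (w t : ℤ → ℤ) : Prop := ∃ U, IsLimitAlong U w t

lemma exists_isLimitAlong {w : ℤ → ℤ} (hw : BoundedWord w) (f : Filter ℤ) [NeBot f]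
    (hf : f ≤ atTop) :
    ∃ (U : Ultrafilter ℤ) (t : ℤ → ℤ), (U : Filter ℤ) ≤ f ∧ IsLimitAlong U w t := by
  obtain ⟨B, hB⟩ := hw
  have hU : (Ultrafilter.of f : Filter ℤ) ≤ f := Ultrafilter.of_le f
  have hletter : ∀ i, ∃ z, ∀ᶠ n in (Ultrafilter.of f : Filter ℤ), w (n + i) = z := fun i => by
    have hcover : (⋃ z ∈ Set.Icc (-B) B, {n | w (n + i) = z}) ∈ Ultrafilter.of f :=
      mem_of_superset univ_mem fun n _ => by simp [abs_le.1 (hB (n + i))]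
    rw [Ultrafilter.finite_biUnion_mem_iff (Set.finite_Icc _ _)] at hcover
    obtain ⟨z, _, hz⟩ := hcover
    exact ⟨z, hz⟩
  choose t ht using hletter
  exact ⟨Ultrafilter.of f, t, hU, hU.trans hf, ht⟩

lemma exists_isLimitAlong_of_frequently {w : ℤ → ℤ} (hw : BoundedWord w) {P : ℤ → Prop}
    (hP : ∃ᶠ n in atTop, P n) :
    ∃ (U : Ultrafilter ℤ) (t : ℤ → ℤ), IsLimitAlong U w t ∧ ∀ᶠ n in (U : Filter ℤ), P n := by
  have : NeBot (atTop ⊓ 𝓟 {n | P n}) := frequently_mem_iff_neBot.1 hP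
  obtain ⟨U, t, hU, ht⟩ := exists_isLimitAlong hw (atTop ⊓ 𝓟 {n | P n}) inf_le_left
  exact ⟨U, t, ht, hU (mem_inf_of_right (mem_principal_self _))⟩

lemma eventually_add_of_le_atTop {f : Filter ℤ} (hf : f ≤ atTop) {P : ℤ → Prop}
    (hP : ∀ᶠ n in atTop, P n) (i : ℤ) : ∀ᶠ n in f, P (n + i) :=
  hf ((tendsto_atTop_add_const_right atTop i tendsto_id).eventually hP)

lemma IsLimitAlong.abs_le {U : Ultrafilter ℤ} {w t : ℤ → ℤ} (ht : IsLimitAlong U w t) {B : ℤ}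
    (hB : ∀ᶠ n in atTop, |w n| ≤ B) (i : ℤ) : |t i| ≤ B := by
  obtain ⟨n, hle, heq⟩ := ((eventually_add_of_le_atTop ht.1 hB i).and (ht.2 i)).exists
  rwa [← heq]

lemma IsLimitAlong.tendsto_greenSum {β : ℝ} (hβ₀ : 0 ≤ β) (hβ₁ : β < 1) {U : Ultrafilter ℤ}
    {w t : ℤ → ℤ} (ht : IsLimitAlong U w t) (hw : BoundedWord w) (j : ℤ) :
    Tendsto (fun n => greenSum β w (n + j)) U (𝓝 (greenSum β t j)) := by
  obtain ⟨B, hB⟩ := hw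
  refine Tendsto.sub (tendsto_tsum_of_dominated_convergence
    (bound := fun i => ((B + B : ℤ) : ℝ) * β ^ i)
    ((summable_geometric_of_lt_one hβ₀ hβ₁).mul_left _) (fun i => ?_)
    (Eventually.of_forall fun n i => ?_)) ?_
  · refine tendsto_const_nhds.congr' ?_
    filter_upwards [ht.2 (j + i), ht.2 (j - i)] with n hright hleft
    rw [← hright, ← hleft, add_assoc, add_sub_assoc]
  · rw [Real.norm_eq_abs, abs_mul, abs_of_nonneg (pow_nonneg hβ₀ i)]
    refine mul_le_mul_of_nonneg_right ?_ (pow_nonneg hβ₀ i)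
    exact_mod_cast (abs_add_le (w (n + j + i)) (w (n + j - i))).trans (add_le_add (hB _) (hB _))
  · refine tendsto_const_nhds.congr' ?_
    filter_upwards [ht.2 j] with n hn
    rw [hn]

lemma isLimitWord_congr {w w' : ℤ → ℤ} (h : ∀ᶠ n in atTop, w n = w' n) (t : ℤ → ℤ) :
    IsLimitWord w t ↔ IsLimitWord w' t := by
  refine exists_congr fun U => and_congr_right fun hU => forall_congr' fun i => ?_
  exact eventually_congr ((eventually_add_of_le_atTop hU h i).mono fun n hn => by rw [hn])

lemma eventually_periodic_of_isLimitWord {w : ℤ → ℤ} (hw : BoundedWord w) {T : ℤ}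
    (h : ∀ t, IsLimitWord w t → t T = t 0) : ∀ᶠ n in atTop, w (n + T) = w n := by
  by_contra hper
  obtain ⟨U, t, hU, hne⟩ := exists_isLimitAlong_of_frequently hw (not_eventually.1 hper)
  obtain ⟨n, hn, hT, h₀⟩ := (hne.and ((hU.2 T).and (hU.2 0))).exists
  rw [add_zero] at h₀
  exact hn (by rw [hT, h₀, h t ⟨U, hU⟩])

lemma exists_isLimitWord_of_periodic {w : ℤ → ℤ} (hw : BoundedWord w) {T : ℕ} (hT : 0 < T)
    (hper : ∀ᶠ n in atTop, w (n + T) = w n) : ∃ t, IsLimitWord w t ∧ ∀ᶠ n in atTop, w n = t n := by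
  have hmultiples : Tendsto (fun k : ℕ => (k : ℤ) * T) atTop atTop :=
    tendsto_natCast_atTop_atTop.atTop_mul_const' (by exact_mod_cast hT)
  obtain ⟨U, t, hU, ht⟩ :=
    exists_isLimitAlong hw (map (fun k : ℕ => (k : ℤ) * T) atTop) hmultiples
  refine ⟨t, ⟨U, ht⟩, ?_⟩
  obtain ⟨N, hN⟩ := eventually_atTop.1 hper
  filter_upwards [eventually_ge_atTop N] with i hi
  have hshift : ∀ k : ℕ, w (k * T + i) = w i := fun k => by
    induction k with
    | zero => simp
    | succ k ih =>
      rw [← ih, ← hN (k * T + i) (by nlinarith)]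
      congr 1; push_cast; ring
  have hU' : ∀ᶠ n in (U : Filter ℤ), w (n + i) = w i :=
    hU (eventually_map.2 (Eventually.of_forall hshift))
  obtain ⟨n, hn, hn'⟩ := (hU'.and (ht.2 i)).exists
  rw [← hn, hn']

/-- The limit superior of `|greenSum β w n|` at `+∞`. -/
noncomputable def limsupGreenSum (β : ℝ) (w : ℤ → ℤ) : ℝ :=
  limsup (fun n : ℕ => |greenSum β w n|) atTop

lemma isCobounded_abs_greenSum (β : ℝ) (w : ℤ → ℤ) :
    IsCoboundedUnder (· ≤ ·) atTop fun n : ℕ => |greenSum β w n| :=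
  isCoboundedUnder_le_of_le atTop (x := 0) fun _ => abs_nonneg _

section LimsupGreenSum

variable {β : ℝ} (hβ₀ : 0 ≤ β) (hβ₁ : β < 1) {w : ℤ → ℤ} (hw : BoundedWord w)
include hβ₀ hβ₁

include hw in
lemma isBounded_abs_greenSum : IsBoundedUnder (· ≤ ·) atTop fun n : ℕ => |greenSum β w n| := by
  obtain ⟨B, hB⟩ := hw
  refine isBoundedUnder_of ⟨((B + B : ℤ) : ℝ) / (1 - β) + B, fun n =>
    (abs_sub _ _).trans (add_le_add (abs_tsum_mul_pow_le hβ₀ hβ₁ fun i => ?_) ?_)⟩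
  · exact_mod_cast (abs_add_le (w (n + i)) (w (n - i))).trans (add_le_add (hB _) (hB _))
  · exact_mod_cast hB n

include hw in
lemma eventually_abs_greenSum_lt {c : ℝ} (hc : limsupGreenSum β w < c) :
    ∀ᶠ n : ℤ in atTop, |greenSum β w n| < c := by
  rw [← Nat.map_cast_int_atTop, eventually_map]
  exact eventually_lt_of_limsup_lt hc (isBounded_abs_greenSum hβ₀ hβ₁ hw)

include hw in
lemma limsupGreenSum_le_iff {c : ℝ} :
    limsupGreenSum β w ≤ c ↔ ∀ t, IsLimitWord w t → ∀ j, |greenSum β t j| ≤ c := by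
  constructor
  · rintro hle t ⟨U, hU⟩ j
    refine le_of_forall_gt_imp_ge_of_dense fun c' hc' => ?_
    have hlt := eventually_abs_greenSum_lt hβ₀ hβ₁ hw (hle.trans_lt hc')
    exact le_of_tendsto (hU.tendsto_greenSum hβ₀ hβ₁ hw j).abs
      ((eventually_add_of_le_atTop hU.1 hlt j).mono fun n hn => hn.le)
  · intro hle
    by_contra! hlt
    obtain ⟨c', hcc', hc'⟩ := exists_between hlt
    have hfreq : ∃ᶠ n : ℤ in atTop, c' < |greenSum β w n| := by
      rw [← Nat.map_cast_int_atTop, frequently_map]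
      exact frequently_lt_of_lt_limsup (isCobounded_abs_greenSum β w) hc'
    obtain ⟨U, t, hU, hP⟩ := exists_isLimitAlong_of_frequently hw hfreq
    have := ge_of_tendsto (hU.tendsto_greenSum hβ₀ hβ₁ hw 0).abs
      (hP.mono fun n hn => by rw [add_zero]; exact hn.le)
    linarith [hle t ⟨U, hU⟩ 0]

include hw in
lemma limsupGreenSum_congr {w' : ℤ → ℤ} (hw' : BoundedWord w') (h : ∀ᶠ n in atTop, w n = w' n) :
    limsupGreenSum β w = limsupGreenSum β w' :=
  eq_of_forall_ge_iff fun c => by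
    rw [limsupGreenSum_le_iff hβ₀ hβ₁ hw, limsupGreenSum_le_iff hβ₀ hβ₁ hw']
    simp only [isLimitWord_congr h]

lemma limsupGreenSum_mechWord {p q : ℕ} (hq : 1 ≤ q) (hpq : p.Coprime q) (a : ℤ) :
    limsupGreenSum β (mechWord p q a) = christoffelValue β q := by
  refine le_antisymm (limsup_le_of_le (isCobounded_abs_greenSum β _)
    (Eventually.of_forall fun n => abs_greenSum_mechWord_le hq a hβ₀ hβ₁ n)) ?_
  refine le_limsup_of_frequently_le ?_
    (isBounded_abs_greenSum hβ₀ hβ₁ (boundedWord_mechWord hq a))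
  obtain ⟨n, hn⟩ := exists_dvd_mul_add hpq a
  have hfreq : ∃ᶠ m : ℤ in atTop, christoffelValue β q ≤ |greenSum β (mechWord p q a) m| := by
    refine frequently_atTop.2 fun N => ⟨n + |N - n| * q, ?_, ?_⟩
    · have := le_abs_self (N - n)
      nlinarith [abs_nonneg (N - n)]
    · rw [greenSum_mechWord_eq hq a hβ₀ hβ₁ hpq, abs_neg]
      · exact le_abs_self _
      · rw [show (n + |N - n| * q) * (p : ℤ) + a = n * p + a + |N - n| * p * q by ring]
        exact dvd_add hn (dvd_mul_left _ _)
  rw [← Nat.map_cast_int_atTop, frequently_map] at hfreq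
  exact hfreq

end LimsupGreenSum

/-! ### Classification of words with small limit superior -/

section Classification

variable {β : ℝ} (hβ₀ : 0 < β) (hβ : β < 1 / 3) {w : ℤ → ℤ} (hw : BoundedWord w)
  (hw₁ : ∀ᶠ n in atTop, |w n| ≤ 1)
include hβ₀ hβ hw hw₁

lemma exists_balancedPrimitive_of_isLimitWord (hlim : limsupGreenSum β w ≤ 1 - β) {t : ℤ → ℤ}
    (ht : IsLimitWord w t) :
    ∃ S : ℤ → ℤ, BalancedPrimitive S ∧ (∀ n, S (n + 1) - S n = 0 ∨ S (n + 1) - S n = 1) ∧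
      ∀ n, t n = S (n + 1) - 2 * S n + S (n - 1) :=
  have ⟨_, hU⟩ := ht
  exists_balancedPrimitive_of_abs_greenSum_le hβ₀ hβ (hU.abs_le hw₁)
    ((limsupGreenSum_le_iff hβ₀.le (by linarith) hw).1 hlim t ht)

lemma exists_eq_mechWord_of_isLimitWord {δ : ℝ} (hδ : 0 < δ)
    (hlim : limsupGreenSum β w ≤ 1 - β - δ) {t : ℤ → ℤ} (ht : IsLimitWord w t) :
    ∃ (p q : ℕ) (a : ℤ), 1 ≤ q ∧ p ≤ q ∧ p.Coprime q ∧ δ ≤ β ^ (q - 1) ∧ t = mechWord p q a := by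
  have hβ₁ : β < 1 := by linarith
  obtain ⟨S, hS, hstep, htS⟩ :=
    exists_balancedPrimitive_of_isLimitWord hβ₀ hβ hw hw₁ (by linarith) ht
  have hsum := (limsupGreenSum_le_iff hβ₀.le hβ₁ hw).1 hlim t ht
  obtain ⟨K, hK⟩ := hS.exists_second_diff_nonneg hβ₀.le hβ₁ htS hδ hsum
  obtain ⟨p, q, hq, hpq, hcop, n₀, hn₀⟩ := hS.exists_eq_add_ediv hstep hK
  have hfloor : ∀ m : ℤ, S m = S n₀ + (m * p + -(n₀ * p)) / q := fun m => by
    have := hn₀ (m - n₀)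
    rwa [add_sub_cancel, show (m - n₀) * (p : ℤ) = m * p + -(n₀ * p) by ring] at this
  have heq : t = mechWord p q (-(n₀ * p)) := funext fun n => by
    rw [htS, hfloor (n + 1), hfloor n, hfloor (n - 1), mechWord]; ring
  refine ⟨p, q, _, hq, hpq, hcop, ?_, heq⟩
  obtain ⟨n, hn⟩ := exists_dvd_mul_add hcop (-(n₀ * p))
  have hmax := hsum n
  rw [heq, greenSum_mechWord_eq hq _ hβ₀.le hβ₁ hcop hn, abs_neg] at hmax
  exact le_pow_of_christoffelValue_le hβ₀.le hβ₁ hq ((le_abs_self _).trans hmax)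

/-- The periods of the limit words are bounded, so they have a common multiple. -/
lemma exists_period_of_limsupGreenSum_lt (hlim : limsupGreenSum β w < 1 - β) :
    ∃ T : ℕ, 0 < T ∧ ∀ᶠ n in atTop, w (n + T) = w n := by
  have hδ : 0 < 1 - β - limsupGreenSum β w := by linarith
  obtain ⟨Q, hQ⟩ := exists_pow_lt_of_lt_one hδ (by linarith : β < 1)
  refine ⟨Q.factorial, Q.factorial_pos, eventually_periodic_of_isLimitWord hw fun t ht => ?_⟩
  obtain ⟨p, q, a, hq, -, -, hle, rfl⟩ :=
    exists_eq_mechWord_of_isLimitWord hβ₀ hβ hw hw₁ hδ (by linarith) ht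
  have hqQ : q ≤ Q := by
    by_contra! hlt
    linarith [pow_le_pow_of_le_one hβ₀.le (by linarith) (by omega : Q ≤ q - 1)]
  obtain ⟨k, hk⟩ := Nat.dvd_factorial hq hqQ
  rw [hk, ← mechWord_add_period hq a 0 k]
  congr 1
  push_cast
  ring

theorem eventually_eq_mechWord_of_limsupGreenSum_lt (hlim : limsupGreenSum β w < 1 - β) :
    ∃ (p q : ℕ) (a : ℤ), 1 ≤ q ∧ p ≤ q ∧ p.Coprime q ∧ ∀ᶠ n in atTop, w n = mechWord p q a n := by
  obtain ⟨T, hT, hper⟩ := exists_period_of_limsupGreenSum_lt hβ₀ hβ hw hw₁ hlim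
  obtain ⟨t, ht, hwt⟩ := exists_isLimitWord_of_periodic hw hT hper
  obtain ⟨p, q, a, hq, hpq, hcop, -, rfl⟩ := exists_eq_mechWord_of_isLimitWord hβ₀ hβ hw hw₁
    (δ := 1 - β - limsupGreenSum β w) (by linarith) (by linarith) ht
  exact ⟨p, q, a, hq, hpq, hcop, hwt⟩

end Classification

/-! ### Factors of infinite words -/

/-- The factor of length `n` of a right infinite word at the positions `a, …, a + n - 1`. Unlike
`window`, it is indexed by its length, so that concatenation needs no subtraction. -/
def factor {A : Type} (y : ℕ → A) (a n : ℕ) : List A := (List.range' a n).map y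

section Factor

variable {A : Type} (y : ℕ → A)

lemma window_eq_factor (i j : ℕ) : window y i j = factor y i (j + 1 - i) := rfl

@[simp]
lemma length_factor (a n : ℕ) : (factor y a n).length = n := by simp [factor]

lemma factor_add (a m n : ℕ) : factor y a (m + n) = factor y a m ++ factor y (a + m) n := by
  rw [factor, ← List.range'_append_1, List.map_append, factor, factor]

lemma factor_succ (a n : ℕ) : factor y a (n + 1) = factor y a n ++ [y (a + n)] := by
  rw [factor_add]; rfl

lemma factor_infix_factor {a n i l : ℕ} (hai : a ≤ i) (hil : i + l ≤ a + n) :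
    factor y i l <:+: factor y a n := by
  obtain ⟨d, rfl⟩ := Nat.exists_eq_add_of_le hai
  obtain ⟨r, rfl⟩ : ∃ r, n = d + l + r := Nat.exists_eq_add_of_le (by omega)
  rw [factor_add, factor_add]
  exact List.infix_append _ _ _

lemma exists_eq_factor_of_isInfix {a n : ℕ} {u : List A} (h : u <:+: factor y a n) :
    ∃ i, i + u.length ≤ n ∧ u = factor y (a + i) u.length := by
  obtain ⟨s, t, hst⟩ := h
  have hn : n = s.length + u.length + t.length := by
    rw [← length_factor y a n, ← hst]; simp only [List.length_append]
  refine ⟨s.length, by omega, ?_⟩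
  rw [hn, factor_add, factor_add] at hst
  exact (List.append_inj (List.append_inj hst (by simp)).1 (by simp)).2

end Factor

lemma eventuallyLocally_iff {A : Type} {P : List A → Prop} (hP : ∀ u v, u <:+: v → P v → P u)
    (y : ℕ → A) :
    EventuallyLocally P y ↔ ∀ K : ℕ, ∀ᶠ m in atTop, P (window y (m - K) (m + K)) := by
  constructor
  · rintro ⟨m₀, q, hq, h⟩ K
    filter_upwards [hq.eventually_ge_atTop K, eventually_ge_atTop m₀] with m hm hm0
    exact hP _ _ (factor_infix_factor y (by omega) (by omega)) (h m hm0)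
  · intro h
    classical
    set Q : ℕ → ℕ → Prop := fun m K => ∀ m' ≥ m, P (window y (m' - K) (m' + K))
    have hQ : ∀ K, ∃ M, ∀ m ≥ M, Q m K := fun K => by
      obtain ⟨M, hM⟩ := eventually_atTop.1 (h K)
      exact ⟨M, fun m hm m' hm' => hM m' (hm.trans hm')⟩
    obtain ⟨M₀, hM₀⟩ := hQ 0
    -- The radius at `m` is the largest `K ≤ m` that works at every position beyond `m`.
    refine ⟨M₀, fun m => Nat.findGreatest (Q m) m, tendsto_atTop.2 fun K => ?_, fun m hm =>
      Nat.findGreatest_spec (P := Q m) (Nat.zero_le m) (hM₀ m hm) m le_rfl⟩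
    obtain ⟨M, hM⟩ := hQ K
    filter_upwards [eventually_ge_atTop (max M K)] with m hm
    exact Nat.le_findGreatest (le_of_max_le_right hm) (hM m (le_of_max_le_left hm))

lemma BalancedWord.of_isInfix {u v : List Bool} (h : u <:+: v) (hv : BalancedWord v) :
    BalancedWord u :=
  fun a b ha hb hl => hv a b (ha.trans h) (hb.trans h) hl

lemma SignedCodedBalanced.of_isInfix {u v : List ℤ} (h : u <:+: v) (hv : SignedCodedBalanced v) :
    SignedCodedBalanced u := by
  obtain ⟨x, hx, hvx⟩ := hv
  exact ⟨x, hx, hvx.imp h.trans h.trans⟩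

/-! ### The coding -/

/-- The number of letters `1` among the first `i` letters. -/
def onesCount (y : ℕ → Bool) : ℕ → ℕ
  | 0 => 0
  | i + 1 => onesCount y i + (y i).toNat

/-- The position at which the image under `γ` of the `i`-th letter starts. -/
def blockPos (y : ℕ → Bool) (i : ℕ) : ℕ := i + onesCount y i

section Coding

variable (y : ℕ → Bool)

lemma blockPos_zero : blockPos y 0 = 0 := rfl

lemma blockPos_succ (i : ℕ) : blockPos y (i + 1) = blockPos y i + 1 + (y i).toNat := by
  simp only [blockPos, onesCount]; ring

lemma onesCount_mono : Monotone (onesCount y) :=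
  monotone_nat_of_le_succ fun _ => Nat.le_add_right _ _

lemma blockPos_strictMono : StrictMono (blockPos y) :=
  strictMono_nat_of_lt_succ fun i => by rw [blockPos_succ]; omega

lemma onesCount_add_count_factor (i l : ℕ) :
    onesCount y i + (factor y i l).count true = onesCount y (i + l) := by
  induction l with
  | zero => rfl
  | succ l ih =>
    rw [factor_succ, List.count_append, ← add_assoc, ih, ← add_assoc, onesCount]
    cases h : y (i + l) <;> simp

lemma balancedWord_factor_iff (a n : ℕ) :
    BalancedWord (factor y a n) ↔
      ∀ i j l, a ≤ i → a ≤ j → i + l ≤ a + n → j + l ≤ a + n →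
        onesCount y (i + l) + onesCount y j ≤ onesCount y (j + l) + onesCount y i + 1 := by
  constructor
  · intro h i j l hi hj hil hjl
    have hbal := h _ _ (factor_infix_factor y hi hil) (factor_infix_factor y hj hjl) (by simp)
    have hcount_i := onesCount_add_count_factor y i l
    have hcount_j := onesCount_add_count_factor y j l
    omega
  · intro h u v hu hv hl
    obtain ⟨i, hi, hu⟩ := exists_eq_factor_of_isInfix y hu
    obtain ⟨j, hj, hv⟩ := exists_eq_factor_of_isInfix y hv
    have hbal := h (a + i) (a + j) u.length (by omega) (by omega) (by omega) (by omega)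
    have hcount_i := onesCount_add_count_factor y (a + i) u.length
    have hcount_j := onesCount_add_count_factor y (a + j) u.length
    rw [← hu] at hcount_i
    rw [hl, ← hv, ← hl] at hcount_j
    omega

lemma gam_append (u v : List Bool) : gam (u ++ v) = gam u ++ gam v := by simp [gam]

lemma gam_factor_succ (a n : ℕ) :
    gam (factor y a (n + 1)) = gam (factor y a n) ++ (if y (a + n) then [1, -1] else [0]) := by
  simp [factor_succ, gam]

lemma length_gam_factor_add_blockPos (a n : ℕ) :
    (gam (factor y a n)).length + blockPos y a = blockPos y (a + n) := by
  induction n with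
  | zero => simp [gam, factor]
  | succ n ih =>
    rw [gam_factor_succ, List.length_append, ← add_assoc, blockPos_succ]
    cases h : y (a + n) <;> simp <;> omega

lemma length_gam_factor_zero (n : ℕ) : (gam (factor y 0 n)).length = blockPos y n := by
  simpa [blockPos_zero] using length_gam_factor_add_blockPos y 0 n

lemma gamSeq_eq_getD {n i : ℕ} (h : n < blockPos y i) :
    gamSeq y n = (gam (factor y 0 i)).getD n 0 := by
  have hstable : ∀ i d, n < blockPos y i →
      (gam (factor y 0 (i + d))).getD n 0 = (gam (factor y 0 i)).getD n 0 := fun i d hi => by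
    rw [factor_add, gam_append, List.getD_append _ _ _ _ (by rwa [length_gam_factor_zero])]
  change (gam (factor y 0 (n + 1))).getD n 0 = _
  rw [← hstable (n + 1) i (by rw [blockPos]; omega), ← hstable i (n + 1) h, add_comm]

lemma gamSeq_blockPos_add {i d : ℕ} (h : blockPos y i + d < blockPos y (i + 1)) :
    gamSeq y (blockPos y i + d) = (if y i then [1, -1] else [0]).getD d 0 := by
  have hlen := length_gam_factor_zero y i
  rw [gamSeq_eq_getD y h, gam_factor_succ, List.getD_append_right _ _ _ _ (by omega), hlen,
    Nat.add_sub_cancel_left, zero_add]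

lemma gamSeq_blockPos (i : ℕ) : gamSeq y (blockPos y i) = if y i then 1 else 0 := by
  have h := gamSeq_blockPos_add y (d := 0) (blockPos_strictMono y i.lt_succ_self)
  rw [add_zero] at h
  rw [h]
  split_ifs <;> rfl

lemma gamSeq_blockPos_succ {i : ℕ} (hi : y i = true) : gamSeq y (blockPos y i + 1) = -1 := by
  rw [gamSeq_blockPos_add y (by rw [blockPos_succ, hi]; simp), hi]
  rfl

lemma exists_blockPos (n : ℕ) :
    ∃ i, n = blockPos y i ∨ (y i = true ∧ n = blockPos y i + 1) := by
  induction n with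
  | zero => exact ⟨0, Or.inl rfl⟩
  | succ n ih =>
    obtain ⟨i, rfl | ⟨hi, rfl⟩⟩ := ih
    · by_cases h : y i = true
      · exact ⟨i, Or.inr ⟨h, rfl⟩⟩
      · exact ⟨i + 1, Or.inl (by rw [blockPos_succ]; simp [h])⟩
    · exact ⟨i + 1, Or.inl (by rw [blockPos_succ, hi]; simp)⟩

lemma gam_factor (a n : ℕ) : gam (factor y a n) =
    factor (gamSeq y) (blockPos y a) (blockPos y (a + n) - blockPos y a) := by
  induction n with
  | zero => simp [gam, factor]
  | succ n ih =>
    obtain ⟨d, hd⟩ :=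
      Nat.exists_eq_add_of_le ((blockPos_strictMono y).monotone (Nat.le_add_right a n))
    have hfst := gamSeq_blockPos y (a + n)
    rw [gam_factor_succ, ih, ← add_assoc, blockPos_succ, hd, add_assoc, add_assoc,
      Nat.add_sub_cancel_left, Nat.add_sub_cancel_left, ← add_assoc, add_assoc, factor_add]
    cases h : y (a + n)
    · simp [factor, ← hd, hfst, h]
    · simp [factor, List.range', ← hd, hfst, h, gamSeq_blockPos_succ y h]

/-- A second primitive of `γ(y)`. It is constant on the first two positions of each block, where
it counts the letters `1` read so far. -/
def codeSum : ℕ → ℤ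
  | 0 => 0
  | 1 => 0
  | n + 2 => 2 * codeSum (n + 1) - codeSum n + gamSeq y n

lemma codeSum_blockPos (i : ℕ) :
    codeSum y (blockPos y i) = onesCount y i ∧ codeSum y (blockPos y i + 1) = onesCount y i := by
  induction i with
  | zero => exact ⟨rfl, rfl⟩
  | succ i ih =>
    have hfst := gamSeq_blockPos y i
    rw [blockPos_succ, onesCount]
    cases h : y i
    · simp only [h, Bool.toNat_false, add_zero] at hfst ⊢
      refine ⟨ih.2, ?_⟩
      rw [codeSum, ih.1, ih.2, hfst]; simp; ring
    · simp only [h, Bool.toNat_true] at hfst ⊢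
      have hnext : codeSum y (blockPos y i + 1 + 1) = onesCount y i + 1 := by
        rw [codeSum, ih.1, ih.2, hfst]; simp; ring
      refine ⟨by rw [hnext]; simp, ?_⟩
      rw [codeSum, hnext, ih.2, gamSeq_blockPos_succ y h]; push_cast; ring

lemma gamSeq_eq_codeSum (n : ℕ) :
    gamSeq y n = codeSum y (n + 2) - 2 * codeSum y (n + 1) + codeSum y n := by
  rw [codeSum]; ring

variable {y}

lemma codeSum_eq {h : ℕ → ℤ} (hfst : ∀ i, h (blockPos y i) = onesCount y i)
    (hsnd : ∀ i, h (blockPos y i + 1) = onesCount y i) (n : ℕ) : codeSum y n = h n := by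
  obtain ⟨i, rfl | ⟨_, rfl⟩⟩ := exists_blockPos y n
  · rw [(codeSum_blockPos y i).1, hfst]
  · rw [(codeSum_blockPos y i).2, hsnd]

lemma exists_index_add_codeSum {n N : ℕ} (hn : n ≤ blockPos y N) :
    ∃ z ≤ N, (n : ℤ) = z + codeSum y n ∧ ((onesCount y z : ℤ) = codeSum y n ∨
      (1 ≤ z ∧ (onesCount y (z - 1) : ℤ) = codeSum y n ∧
        (onesCount y z : ℤ) = codeSum y n + 1)) := by
  obtain ⟨i, rfl | ⟨hi, rfl⟩⟩ := exists_blockPos y n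
  · refine ⟨i, (blockPos_strictMono y).le_iff_le.1 hn, ?_, Or.inl (codeSum_blockPos y i).1.symm⟩
    rw [(codeSum_blockPos y i).1, blockPos]; push_cast; ring
  · rw [(codeSum_blockPos y i).2]
    exact ⟨i + 1, (blockPos_strictMono y).lt_iff_lt.1 hn, by rw [blockPos]; push_cast; ring,
      Or.inr ⟨by omega, rfl, by simp [onesCount, hi]⟩⟩

lemma exists_onesCount_eq_codeSum {n N : ℕ} (hn : n ≤ blockPos y N) :
    ∃ u ≤ N, (onesCount y u : ℤ) = codeSum y n ∧ (n : ℤ) - codeSum y n - 1 ≤ u := by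
  obtain ⟨z, hzN, hz, hcount | ⟨_, hcount, _⟩⟩ := exists_index_add_codeSum hn
  · exact ⟨z, hzN, hcount, by omega⟩
  · exact ⟨z - 1, by omega, hcount, by omega⟩

lemma codeSum_balanced {N : ℕ} (hy : BalancedWord (factor y 0 N))
    {a b l : ℕ} (ha : a + l ≤ blockPos y N) (hb : b + l ≤ blockPos y N) :
    codeSum y (a + l) - codeSum y a - (codeSum y (b + l) - codeSum y b) ≤ 1 := by
  rw [balancedWord_factor_iff] at hy
  by_contra! hcon
  obtain ⟨al, halN, hal, hal_count⟩ := exists_index_add_codeSum ha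
  obtain ⟨bi, _, hbi, hbi_count⟩ := exists_index_add_codeSum (show b ≤ blockPos y N by omega)
  obtain ⟨bl, _, hbl, hbl_count⟩ := exists_index_add_codeSum hb
  obtain ⟨u, _, hu, hau⟩ := exists_onesCount_eq_codeSum (show a ≤ blockPos y N by omega)
  obtain ⟨v, hvN, hv, hblv⟩ := exists_onesCount_eq_codeSum hb
  push_cast at hal hbl hblv
  have hb_mono : codeSum y b ≤ codeSum y (b + l) + 1 := by
    rcases le_or_gt bi bl with h | h
    · have := onesCount_mono y h
      omega
    · omega
  have hu_lt : u < al := by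
    by_contra! hle
    have := onesCount_mono y hle
    omega
  have hbal := hy u bi (al - u) (by omega) (by omega) (by omega) (by omega)
  have hmono := onesCount_mono y (show bi + (al - u) ≤ v by omega)
  rw [Nat.add_sub_cancel' hu_lt.le] at hbal
  omega

lemma exists_blockPos_eq_add_of_gamSeq_eq {i T : ℕ}
    (h : gamSeq y (blockPos y i + T) = gamSeq y (blockPos y i)) :
    ∃ j, blockPos y i + T = blockPos y j := by
  obtain ⟨j, hj | ⟨hj, hj'⟩⟩ := exists_blockPos y (blockPos y i + T)
  · exact ⟨j, hj⟩
  · rw [hj', gamSeq_blockPos_succ y hj, gamSeq_blockPos] at h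
    split_ifs at h

lemma letter_eq_of_gamSeq_blockPos_eq {i j : ℕ}
    (h : gamSeq y (blockPos y i) = gamSeq y (blockPos y j)) : y i = y j := by
  rw [gamSeq_blockPos, gamSeq_blockPos] at h
  cases hi : y i <;> cases hj : y j <;> simp [hi, hj] at h ⊢

lemma eventuallyPeriodic_of_gamSeq (h : EventuallyPeriodic (gamSeq y)) :
    EventuallyPeriodic y := by
  obtain ⟨N, T, hT, h⟩ := h
  have hper : ∀ i, N ≤ i → gamSeq y (blockPos y i + T) = gamSeq y (blockPos y i) := fun i hi =>
    h _ (hi.trans (Nat.le_add_right _ _))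
  obtain ⟨j, hj⟩ := exists_blockPos_eq_add_of_gamSeq_eq (hper N le_rfl)
  have hNj : N < j := (blockPos_strictMono y).lt_iff_lt.1 (by omega)
  have hletter : ∀ i, N ≤ i → blockPos y (i + (j - N)) = blockPos y i + T →
      y (i + (j - N)) = y i := fun i hi hpos =>
    letter_eq_of_gamSeq_blockPos_eq (by rw [hpos, hper i hi])
  have hpos : ∀ i, N ≤ i → blockPos y (i + (j - N)) = blockPos y i + T := by
    refine fun i hi => Nat.le_induction ?_ (fun i hi ih => ?_) i hi
    · rw [hj, Nat.add_sub_cancel' hNj.le]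
    · rw [add_right_comm, blockPos_succ, blockPos_succ, hletter i hi ih, ih]
      ring
  exact ⟨N, j - N, by omega, fun i hi => hletter i hi (hpos i hi)⟩

end Coding

/-! ### Local properties and limit words -/

/-- The factor of a bi-infinite word at the positions `-K, …, K`. -/
def centralFactor (t : ℤ → ℤ) (K : ℕ) : List ℤ := factor (fun j => t (j - K)) 0 (2 * K + 1)

lemma map_natCast_add_one_atTop : map (fun m : ℕ => (m : ℤ) + 1) atTop = atTop := by
  rw [← Function.comp_def (fun n : ℤ => n + 1) (fun m : ℕ => (m : ℤ)), ← Filter.map_map,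
    Nat.map_cast_int_atTop, map_add_atTop_eq]

lemma padZero_succ (s : ℕ → ℤ) (n : ℕ) : padZero s (n + 1) = s n := by
  rw [padZero, if_neg (by omega)]; congr 1; omega

lemma eventually_padZero_iff {s : ℕ → ℤ} {Q : ℤ → ℤ → Prop} :
    (∀ᶠ n : ℤ in atTop, Q n (padZero s n)) ↔ ∀ᶠ n : ℕ in atTop, Q (n + 1) (s n) := by
  rw [← map_natCast_add_one_atTop, eventually_map]
  simp only [padZero_succ]

lemma boundedWord_padZero {s : ℕ → ℤ} {B : ℤ} (h : ∀ᶠ n in atTop, |s n| ≤ B) :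
    BoundedWord (padZero s) := by
  obtain ⟨N, hN⟩ := eventually_atTop.1 h
  refine ⟨|B| + ∑ k ∈ Finset.range N, |s k|, fun n => ?_⟩
  have hpos : 0 ≤ ∑ k ∈ Finset.range N, |s k| := Finset.sum_nonneg fun _ _ => abs_nonneg _
  rw [padZero]
  split_ifs with hn
  · simpa using add_nonneg (abs_nonneg B) hpos
  · rcases le_or_gt N (n - 1).toNat with hk | hk
    · linarith [hN _ hk, le_abs_self B]
    · have := Finset.single_le_sum (f := fun k => |s k|) (fun _ _ => abs_nonneg _)
        (Finset.mem_range.2 hk)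
      linarith [abs_nonneg B]

lemma window_eq_centralFactor (s : ℕ → ℤ) {m K : ℕ} (h : K ≤ m) :
    window s (m - K) (m + K) = centralFactor (fun i => padZero s (m + 1 + i)) K := by
  rw [window_eq_factor, centralFactor, factor, factor]
  refine List.ext_getElem (by simp; omega) fun j h1 h2 => ?_
  simp only [List.getElem_map, List.getElem_range']
  rw [show (m : ℤ) + 1 + ((0 + 1 * j : ℕ) - K) = ((m - K + 1 * j : ℕ) : ℤ) + 1 by omega,
    padZero_succ]

lemma centralFactor_congr {t t' : ℤ → ℤ} {K : ℕ} (h : ∀ i : ℤ, |i| ≤ K → t i = t' i) :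
    centralFactor t K = centralFactor t' K := by
  refine List.map_congr_left fun j hj => h _ ?_
  rw [List.mem_range'_1] at hj
  rw [abs_le]; omega

lemma centralFactor_shift_isInfix (t : ℤ → ℤ) (j : ℤ) (K : ℕ) :
    centralFactor (fun i => t (j + i)) K <:+: centralFactor t (K + j.natAbs) := by
  have hshift : centralFactor (fun i => t (j + i)) K =
      factor (fun i : ℕ => t (i - (K + j.natAbs : ℕ))) (j + j.natAbs).toNat (2 * K + 1) := by
    rw [centralFactor, factor, factor]
    refine List.ext_getElem (by simp) fun i _ _ => ?_
    simp only [List.getElem_map, List.getElem_range']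
    congr 1
    omega
  rw [hshift]
  exact factor_infix_factor _ (Nat.zero_le _) (by omega)

lemma IsLimitAlong.eventually_eq {U w t} (h : IsLimitAlong U w t) (K : ℕ) :
    ∀ᶠ n in (U : Filter ℤ), ∀ i : ℤ, |i| ≤ K → w (n + i) = t i := by
  have : ∀ᶠ n in (U : Filter ℤ), ∀ i ∈ Finset.Icc (-(K : ℤ)) K, w (n + i) = t i :=
    (Filter.eventually_all_finset _).2 fun i _ => h.2 i
  filter_upwards [this] with n hn i hi
  exact hn i (Finset.mem_Icc.2 (_root_.abs_le.1 hi))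

lemma eventually_window_iff_eventually_centralFactor {s : ℕ → ℤ} {P : List ℤ → Prop} {K : ℕ} :
    (∀ᶠ m : ℕ in atTop, P (window s (m - K) (m + K))) ↔
      ∀ᶠ n : ℤ in atTop, P (centralFactor (fun i => padZero s (n + i)) K) := by
  rw [← map_natCast_add_one_atTop, eventually_map]
  refine eventually_congr ?_
  filter_upwards [eventually_ge_atTop K] with m hm
  rw [window_eq_centralFactor s hm]

lemma eventuallyLocally_iff_limitWord {s : ℕ → ℤ} (hs : BoundedWord (padZero s))
    {P : List ℤ → Prop} (hP : ∀ u v, u <:+: v → P v → P u) :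
    EventuallyLocally P s ↔ ∀ t, IsLimitWord (padZero s) t → ∀ K, P (centralFactor t K) := by
  simp only [eventuallyLocally_iff hP, eventually_window_iff_eventually_centralFactor]
  constructor
  · rintro h t ⟨U, hU⟩ K
    have hK : ∀ᶠ n in (U : Filter ℤ), P (centralFactor (fun i => padZero s (n + i)) K) :=
      hU.1 (h K)
    obtain ⟨n, hn, heq⟩ := (hK.and (hU.eventually_eq K)).exists
    rwa [← centralFactor_congr heq]
  · intro h K
    by_contra hcon
    obtain ⟨U, t, hU, hnot⟩ := exists_isLimitAlong_of_frequently hs (not_eventually.1 hcon)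
    obtain ⟨n, hn, heq⟩ := (hnot.and (hU.eventually_eq K)).exists
    rw [centralFactor_congr heq] at hn
    exact hn (h t ⟨U, hU⟩ K)

/-! ### Coded balanced factors have small sums -/

lemma add_apply_neg_eq_two_mul {D : ℤ → ℤ} {i : ℕ}
    (h : ∀ k : ℤ, |k| < i → D (k + 1) - 2 * D k + D (k - 1) = 0) : D i + D (-i) = 2 * D 0 := by
  have hsymm : ∀ j : ℕ, j < i → D j + D (-j) = 2 * D 0 ∧ D (j + 1) + D (-(j + 1)) = 2 * D 0 := by
    intro j hj
    induction j with
    | zero =>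
      have := h 0 (by simpa using hj)
      simp only [zero_add, zero_sub, Nat.cast_zero, neg_zero] at this ⊢
      constructor <;> linarith
    | succ j ih =>
      have hprev := ih (by omega)
      have hright := h (j + 1) (by rw [abs_lt]; omega)
      have hleft := h (-(j + 1)) (by rw [abs_lt]; omega)
      rw [show -((j : ℤ) + 1) + 1 = -j by ring] at hleft
      rw [show (j : ℤ) + 1 - 1 = j by ring] at hright
      push_cast
      rw [show -((j : ℤ) + 1 + 1) = -(j + 1) - 1 by ring]
      exact ⟨hprev.2, by linarith [hprev.1, hprev.2]⟩
  cases i with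
  | zero => simp; ring
  | succ i => exact_mod_cast (hsymm i i.lt_succ_self).2

lemma eq_factor_getD (x : List Bool) : x = factor (fun i => x.getD i false) 0 x.length := by
  refine List.ext_getElem (by simp) fun j hj _ => ?_
  simp [factor, hj]

lemma SignedCodedBalanced.exists_eq_gamSeq {n : ℕ} {f : ℕ → ℤ}
    (h : SignedCodedBalanced (factor f 0 n)) :
    ∃ (σ : ℤ) (y : ℕ → Bool) (N o : ℕ), (σ = 1 ∨ σ = -1) ∧
      BalancedWord (factor y 0 N) ∧ o + n ≤ blockPos y N ∧
      ∀ j < n, f j = σ * gamSeq y (o + j) := by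
  obtain ⟨x, hx, h⟩ := h
  set y : ℕ → Bool := fun i => x.getD i false
  rw [eq_factor_getD x] at hx h
  have hsigned : ∃ σ : ℤ, (σ = 1 ∨ σ = -1) ∧
      factor f 0 n <:+: factor (fun i => σ * gamSeq y i) 0 (blockPos y x.length) := by
    rw [gam_factor, blockPos_zero, zero_add, Nat.sub_zero] at h
    rcases h with h | h
    · exact ⟨1, Or.inl rfl, by simpa only [factor, one_mul] using h⟩
    · exact ⟨-1, Or.inr rfl, by
        simpa only [factor, List.map_map, Function.comp_def, neg_mul, one_mul] using h⟩
  obtain ⟨σ, hσ, hisInfix⟩ := hsigned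
  obtain ⟨o, ho, hfactor⟩ := exists_eq_factor_of_isInfix _ hisInfix
  rw [length_factor] at ho hfactor
  refine ⟨σ, y, x.length, o, hσ, hx, ho, fun j hj => ?_⟩
  have := congrArg (fun l => l[j]?) hfactor
  simpa [factor, hj] using this

lemma SignedCodedBalanced.abs_second_diff_le {t S : ℤ → ℤ}
    (htS : ∀ n, t n = S (n + 1) - 2 * S n + S (n - 1)) {i : ℕ}
    (h : SignedCodedBalanced (centralFactor t i)) : |S i - 2 * S 0 + S (-i)| ≤ 1 := by
  obtain ⟨σ, y, N, o, hσ, hy, ho, hf⟩ := h.exists_eq_gamSeq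
  -- `S` and the shifted second primitive of `γ(y)` differ by an affine function on `[-i, i]`.
  have hD := add_apply_neg_eq_two_mul
    (D := fun k => S k - σ * codeSum y (o + 1 + i + k).toNat) (i := i) fun k hk => by
      rw [abs_lt] at hk
      have hletter := hf (k + i).toNat (by omega)
      rw [show (((k + i).toNat : ℕ) : ℤ) - i = k by omega, htS, gamSeq_eq_codeSum] at hletter
      rw [show (o + 1 + i + (k + 1) : ℤ).toNat = o + (k + i).toNat + 2 by omega,
        show (o + 1 + i + k : ℤ).toNat = o + (k + i).toNat + 1 by omega,
        show (o + 1 + i + (k - 1) : ℤ).toNat = o + (k + i).toNat by omega]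
      linear_combination hletter
  beta_reduce at hD
  rw [show (o + 1 + i + (i : ℤ)).toNat = o + 1 + i + i by omega,
    show (o + 1 + i + 0 : ℤ).toNat = o + 1 + i by omega,
    show (o + 1 + i + -(i : ℤ)).toNat = o + 1 by omega] at hD
  have hup := codeSum_balanced hy (a := o + 1 + i) (b := o + 1) (l := i) (by omega) (by omega)
  have hdown := codeSum_balanced hy (a := o + 1) (b := o + 1 + i) (l := i) (by omega) (by omega)
  rw [abs_le]
  rcases hσ with rfl | rfl <;> omega

lemma greenSum_eq_greenSum_shift_zero (β : ℝ) (t : ℤ → ℤ) (j : ℤ) :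
    greenSum β t j = greenSum β (fun i => t (j + i)) 0 := by
  simp [greenSum, sub_eq_add_neg]

section

variable {β : ℝ} (hβ₀ : 0 ≤ β) (hβ₁ : β < 1)
include hβ₀ hβ₁

lemma abs_greenSum_zero_le_of_centralFactor {t : ℤ → ℤ} (ht : BoundedWord t)
    (h : ∀ K, SignedCodedBalanced (centralFactor t K)) : |greenSum β t 0| ≤ 1 - β := by
  obtain ⟨S, htS⟩ := exists_second_primitive t
  have hdiff := fun i => (h i).abs_second_diff_le htS
  rw [greenSum_eq_of_second_primitive hβ₀ hβ₁ ht htS 0 fun i => by simpa using hdiff i, abs_mul,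
    abs_of_nonneg (sq_nonneg _)]
  have htsum := abs_tsum_mul_pow_le hβ₀ hβ₁ (B := 1)
    (a := fun i : ℕ => ((S (0 + ((i : ℤ) + 1)) - 2 * S 0 + S (0 - ((i : ℤ) + 1)) : ℤ) : ℝ))
    fun i => by
      have := hdiff (i + 1)
      push_cast at this
      rw [← Int.cast_abs]
      simp only [zero_add, zero_sub] at this ⊢
      exact_mod_cast this
  refine (mul_le_mul_of_nonneg_left htsum (sq_nonneg _)).trans_eq ?_
  have : 1 - β ≠ 0 := by linarith
  field_simp

lemma limsupGreenSum_le_of_eventuallyLocally {s : ℕ → ℤ} (hs : BoundedWord (padZero s))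
    (h : EventuallyLocally SignedCodedBalanced s) : limsupGreenSum β (padZero s) ≤ 1 - β := by
  have hloc := (eventuallyLocally_iff_limitWord hs fun _ _ => SignedCodedBalanced.of_isInfix).1 h
  refine (limsupGreenSum_le_iff hβ₀ hβ₁ hs).2 fun t ht j => ?_
  have htb : BoundedWord t := by
    obtain ⟨⟨B, hB⟩, ⟨U, hU⟩⟩ := hs, ht
    exact ⟨B, hU.abs_le (Eventually.of_forall hB)⟩
  rw [greenSum_eq_greenSum_shift_zero]
  exact abs_greenSum_zero_le_of_centralFactor hβ₀ hβ₁ (htb.imp fun _ hB n => hB (j + n)) fun K =>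
    (hloc t ht _).of_isInfix (centralFactor_shift_isInfix t j K)

end

lemma eventually_abs_le_of_eventuallyLocally {s : ℕ → ℤ}
    (h : EventuallyLocally SignedCodedBalanced s) : ∀ᶠ n in atTop, |s n| ≤ 1 := by
  rw [eventuallyLocally_iff fun _ _ => SignedCodedBalanced.of_isInfix] at h
  have hgam : ∀ x, ∀ z ∈ gam x, |z| ≤ 1 := fun x z hz => by
    simp only [gam, List.mem_flatMap] at hz
    obtain ⟨c, -, hc⟩ := hz
    cases c
    · simp_all
    · obtain rfl | rfl : z = 1 ∨ z = -1 := by simpa using hc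
      all_goals simp
  filter_upwards [h 0] with m hm
  obtain ⟨x, -, hx⟩ := hm
  have hmem : s m ∈ window s (m - 0) (m + 0) := by simp [window]
  rcases hx with hx | hx
  · exact hgam x _ (hx.subset hmem)
  · obtain ⟨z, hz, hzs⟩ := List.mem_map.1 (hx.subset hmem)
    rw [← hzs, abs_neg]
    exact hgam x z hz

/-! ### Decoding balanced bi-infinite words -/

/-- The positions at which the blocks `0` and `1, -1` of the second difference of `S` start,
reading rightwards from `a`. -/
def decodePos (S : ℤ → ℤ) (a : ℤ) : ℕ → ℤ
  | 0 => a
  | i + 1 => decodePos S a i + 1 + (S (decodePos S a i + 1) - S (decodePos S a i))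

/-- The preimage under `γ` of the second difference of `S`, read rightwards from `a`. -/
def decodeWord (S : ℤ → ℤ) (a : ℤ) (i : ℕ) : Bool :=
  decide (S (decodePos S a i + 1) - S (decodePos S a i) = 1)

section Decoding

variable {S : ℤ → ℤ} (hstep : ∀ n, S (n + 1) - S n = 0 ∨ S (n + 1) - S n = 1)
include hstep

lemma apply_add_natCast_le_of_step (x : ℤ) (k : ℕ) : S (x + k) ≤ S x + k := by
  induction k with
  | zero => simp
  | succ k ih =>
    have := hstep (x + k)
    push_cast
    rw [← add_assoc]
    omega

lemma toNat_decodeWord (a : ℤ) (i : ℕ) :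
    ((decodeWord S a i).toNat : ℤ) = S (decodePos S a i + 1) - S (decodePos S a i) := by
  rcases hstep (decodePos S a i) with h | h <;> simp [decodeWord, h]

variable (hno : ∀ n, ¬ (S (n + 1) - S n = 1 ∧ S (n + 1 + 1) - S (n + 1) = 1)) {a : ℤ}
  (ha : S a - S (a - 1) = 0)
include hno ha

lemma decodePos_spec (i : ℕ) : decodePos S a i = a + blockPos (decodeWord S a) i ∧
    S (decodePos S a i) = S a + onesCount (decodeWord S a) i ∧
    S (decodePos S a i) - S (decodePos S a i - 1) = 0 := by
  induction i with
  | zero => simp [decodePos, blockPos, onesCount, ha]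
  | succ i ih =>
    obtain ⟨hpos, hcount, hflat⟩ := ih
    have hletter := toNat_decodeWord hstep a i
    have hnext : decodePos S a (i + 1) =
      decodePos S a i + 1 + (S (decodePos S a i + 1) - S (decodePos S a i)) := rfl
    rw [blockPos_succ, onesCount]
    push_cast
    rcases hstep (decodePos S a i) with h | h
    · rw [h, add_zero] at hnext
      rw [hnext, hletter, add_sub_cancel_right]
      exact ⟨by omega, by omega, by omega⟩
    · rw [h] at hnext
      have hstep_next := hstep (decodePos S a i + 1)
      have hno_i := hno (decodePos S a i)
      rw [hnext, hletter, add_sub_cancel_right]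
      exact ⟨by omega, by omega, by omega⟩

lemma gamSeq_decodeWord (n : ℕ) :
    gamSeq (decodeWord S a) n = S (a + n + 1) - 2 * S (a + n) + S (a + n - 1) := by
  obtain ⟨i, rfl | ⟨hi, rfl⟩⟩ := exists_blockPos (decodeWord S a) n
  all_goals
    obtain ⟨hpos, -, hflat⟩ := decodePos_spec hstep hno ha i
    have hletter := toNat_decodeWord hstep a i
  · rw [gamSeq_blockPos, ← hpos]
    cases h : decodeWord S a i <;> simp [h] at hletter ⊢ <;> omega
  · rw [hi, Bool.toNat_true] at hletter
    rw [gamSeq_blockPos_succ _ hi]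
    push_cast
    rw [← add_assoc, ← hpos, add_sub_cancel_right]
    have hstep_next := hstep (decodePos S a i + 1)
    have hno_i := hno (decodePos S a i)
    omega

lemma balancedWord_decodeWord (hS : BalancedPrimitive S) (N : ℕ) :
    BalancedWord (factor (decodeWord S a) 0 N) := by
  rw [balancedWord_factor_iff]
  intro i j l _ _ _ _
  by_contra! hcon
  obtain ⟨hi, hSi, -⟩ := decodePos_spec hstep hno ha i
  obtain ⟨hj, hSj, hflat_j⟩ := decodePos_spec hstep hno ha j
  obtain ⟨hil, hSil, hflat_il⟩ := decodePos_spec hstep hno ha (i + l)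
  obtain ⟨hjl, hSjl, -⟩ := decodePos_spec hstep hno ha (j + l)
  set y := decodeWord S a
  rw [blockPos] at hi hj hil hjl
  push_cast at hi hj hil hjl
  have hmono_j := onesCount_mono y (Nat.le_add_right j l)
  set d := decodePos S a (j + l) - decodePos S a j + 1 with hd
  have hbal := hS d (decodePos S a i) (decodePos S a j - 1) (by omega)
  rw [show decodePos S a j - 1 + d = decodePos S a (j + l) by rw [hd]; ring] at hbal
  have hlip := apply_add_natCast_le_of_step hstep (decodePos S a i + d)
    (decodePos S a (i + l) - 1 - (decodePos S a i + d)).toNat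
  rw [Int.toNat_of_nonneg (by omega), add_sub_cancel] at hlip
  omega

end Decoding

lemma exists_balancedWord_centralFactor_infix_gam {S : ℤ → ℤ} (hS : BalancedPrimitive S)
    (hstep : ∀ n, S (n + 1) - S n = 0 ∨ S (n + 1) - S n = 1)
    (hno : ∀ n, ¬ (S (n + 1) - S n = 1 ∧ S (n + 1 + 1) - S (n + 1) = 1)) (K : ℕ) :
    ∃ x, BalancedWord x ∧
      centralFactor (fun n => S (n + 1) - 2 * S n + S (n - 1)) K <:+: gam x := by
  obtain ⟨e, he, ha⟩ : ∃ e : ℕ, e ≤ 1 ∧ S (-K - e) - S (-K - e - 1) = 0 := by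
    have hstep₁ := hstep (-K - 1)
    have hstep₂ := hstep (-K - 1 - 1)
    have hno₂ := hno (-K - 1 - 1)
    rw [sub_add_cancel] at hstep₁ hstep₂
    rw [sub_add_cancel, sub_add_cancel] at hno₂
    by_cases h : S (-(K : ℤ)) - S (-K - 1) = 0
    · exact ⟨0, by omega, by simpa using h⟩
    · exact ⟨1, le_rfl, by push_cast; omega⟩
  have hcentral : centralFactor (fun n => S (n + 1) - 2 * S n + S (n - 1)) K =
      factor (gamSeq (decodeWord S (-K - e))) e (2 * K + 1) := by
    rw [centralFactor, factor, factor]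
    refine List.ext_getElem (by simp) fun j _ _ => ?_
    simp only [List.getElem_map, List.getElem_range']
    rw [gamSeq_decodeWord hstep hno ha]
    push_cast
    rw [show -(K : ℤ) - e + (e + 1 * j) = 0 + 1 * j - K by ring]
  refine ⟨_, balancedWord_decodeWord hstep hno ha hS (2 * K + 2), ?_⟩
  have hN : 2 * K + 2 ≤ blockPos (decodeWord S (-K - e)) (2 * K + 2) := Nat.le_add_right _ _
  rw [gam_factor, blockPos_zero, zero_add, Nat.sub_zero, hcentral]
  exact factor_infix_factor _ (by omega) (by omega)

lemma signedCodedBalanced_centralFactor {S t : ℤ → ℤ} (hS : BalancedPrimitive S)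
    (hstep : ∀ n, S (n + 1) - S n = 0 ∨ S (n + 1) - S n = 1)
    (htS : ∀ n, t n = S (n + 1) - 2 * S n + S (n - 1)) (K : ℕ) :
    SignedCodedBalanced (centralFactor t K) := by
  by_cases hno : ∀ n, ¬ (S (n + 1) - S n = 1 ∧ S (n + 1 + 1) - S (n + 1) = 1)
  · obtain ⟨x, hx, h⟩ := exists_balancedWord_centralFactor_infix_gam hS hstep hno K
    exact ⟨x, hx, Or.inl (by rwa [funext htS])⟩
  · -- If `11` occurs in the first difference then `00` does not: exchange the two letters.
    push Not at hno
    obtain ⟨m, hm, hm'⟩ := hno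
    obtain ⟨x, hx, h⟩ := exists_balancedWord_centralFactor_infix_gam (S := fun n => n - S n)
      (fun l i j hl => by have := hS l j i hl; beta_reduce; omega)
      (fun n => by have := hstep n; omega)
      (fun n => by
        rintro ⟨hn, hn'⟩
        have := hS 2 m n (by norm_num)
        rw [show m + 2 = m + 1 + 1 by ring, show n + 2 = n + 1 + 1 by ring] at this
        omega) K
    refine ⟨x, hx, Or.inr ?_⟩
    have hneg : centralFactor t K = (centralFactor (fun n => (n + 1 - S (n + 1)) -
        2 * (n - S n) + (n - 1 - S (n - 1))) K).map fun a => -a := by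
      rw [centralFactor, centralFactor, factor, factor, List.map_map]
      refine List.map_congr_left fun j _ => ?_
      simp only [htS, Function.comp]
      ring
    rw [hneg]
    exact h.map _

lemma eventuallyLocally_of_limsupGreenSum_le {β : ℝ} (hβ₀ : 0 < β) (hβ : β < 1 / 3) {s : ℕ → ℤ}
    (hs : ∀ᶠ n in atTop, |s n| ≤ 1) (h : limsupGreenSum β (padZero s) ≤ 1 - β) :
    EventuallyLocally SignedCodedBalanced s := by
  have hbdd := boundedWord_padZero hs
  rw [eventuallyLocally_iff_limitWord hbdd fun _ _ => SignedCodedBalanced.of_isInfix]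
  intro t ht K
  obtain ⟨S, hS, hstep, htS⟩ := exists_balancedPrimitive_of_isLimitWord hβ₀ hβ hbdd
    (eventually_padZero_iff (Q := fun _ z => |z| ≤ 1).2 hs) h ht
  exact signedCodedBalanced_centralFactor hS hstep htS K

/-! ### Eventually balanced words -/

section EventuallyBalanced

variable {y : ℕ → Bool}

lemma onesCount_le (y : ℕ → Bool) (i : ℕ) : onesCount y i ≤ i := by
  induction i with
  | zero => exact le_rfl
  | succ i ih => exact add_le_add ih (Bool.toNat_le (y i))

lemma blockPos_add_le (y : ℕ → Bool) (i d : ℕ) : blockPos y i + d ≤ blockPos y (i + d) := by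
  have := onesCount_mono y (Nat.le_add_right i d)
  rw [blockPos, blockPos]
  omega

lemma window_gamSeq_infix_gam_window {i n : ℕ}
    (hi : n = blockPos y i ∨ (y i = true ∧ n = blockPos y i + 1)) (K : ℕ) :
    window (gamSeq y) (n - K) (n + K) <:+: gam (window y (i - K) (i + K)) := by
  have hleft : blockPos y (i - K) ≤ n - K := by
    rcases le_or_gt K i with h | h
    · have := blockPos_add_le y (i - K) K
      rw [Nat.sub_add_cancel h] at this
      omega
    · rw [Nat.sub_eq_zero_of_le h.le, blockPos_zero]
      exact Nat.zero_le _
  have hright : n + K + 1 ≤ blockPos y (i + K + 1) := by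
    rcases hi with hi | ⟨hyi, hi⟩
    · have := blockPos_add_le y i (K + 1)
      rw [← add_assoc i] at this
      omega
    · have := blockPos_add_le y (i + 1) K
      rw [blockPos_succ, hyi, Bool.toNat_true, add_right_comm i] at this
      omega
  rw [window_eq_factor, window_eq_factor, gam_factor,
    show i - K + (i + K + 1 - (i - K)) = i + K + 1 by omega]
  exact factor_infix_factor _ hleft (by omega)

lemma eventually_gamSeq_window_isInfix (hy : EventuallyBalanced y) (k K : ℕ) :
    ∀ᶠ m in atTop, ∃ x, BalancedWord x ∧
      window (fun i => gamSeq y (k + i)) (m - K) (m + K) <:+: gam x := by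
  rw [EventuallyBalanced, eventuallyLocally_iff fun _ _ => BalancedWord.of_isInfix] at hy
  obtain ⟨M, hM⟩ := eventually_atTop.1 (hy K)
  filter_upwards [eventually_ge_atTop (2 * M + 1)] with m hm
  obtain ⟨i, hi⟩ := exists_blockPos y (k + m)
  have hiM : M ≤ i := by
    have := onesCount_le y i
    rw [blockPos] at hi
    omega
  refine ⟨_, hM i hiM, List.IsInfix.trans ?_ (window_gamSeq_infix_gam_window hi K)⟩
  have hshift : window (fun i => gamSeq y (k + i)) (m - K) (m + K) =
      factor (gamSeq y) (k + (m - K)) (m + K + 1 - (m - K)) := by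
    rw [window, factor]
    refine List.ext_getElem (by simp) fun j _ _ => ?_
    simp only [List.getElem_map, List.getElem_range', add_assoc]
  rw [hshift]
  exact factor_infix_factor _ (by omega) (by omega)

lemma eventuallyLocally_gamSeq (hy : EventuallyBalanced y) (k : ℕ) {σ : ℤ}
    (hσ : σ = 1 ∨ σ = -1) :
    EventuallyLocally SignedCodedBalanced fun i => σ * gamSeq y (k + i) := by
  rw [eventuallyLocally_iff fun _ _ => SignedCodedBalanced.of_isInfix]
  intro K
  filter_upwards [eventually_gamSeq_window_isInfix hy k K] with m ⟨x, hx, hisInfix⟩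
  refine ⟨x, hx, ?_⟩
  rcases hσ with rfl | rfl
  · simpa only [one_mul] using Or.inl hisInfix
  · right
    simpa only [window, List.map_map, Function.comp_def, neg_mul, one_mul] using
      hisInfix.map fun a => -a

lemma not_eventuallyPeriodic_gamSeq (hy : ¬ EventuallyPeriodic y) (k : ℕ) {σ : ℤ}
    (hσ : σ = 1 ∨ σ = -1) : ¬ EventuallyPeriodic fun i => σ * gamSeq y (k + i) := by
  rintro ⟨N, T, hT, h⟩
  refine hy (eventuallyPeriodic_of_gamSeq ⟨N + k, T, hT, fun n hn => ?_⟩)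
  have hper := h (n - k) (by omega)
  beta_reduce at hper
  rw [show k + (n - k + T) = n + T by omega, show k + (n - k) = n by omega] at hper
  rcases hσ with rfl | rfl <;> linarith

end EventuallyBalanced

/-! ### Christoffel words -/

lemma periodicWord_factor {r : ℕ} {y : ℕ → Bool} (hr : 1 ≤ r) (hy : y.Periodic r) :
    periodicWord (factor y 0 r) = y := by
  funext i
  have hlt := Nat.mod_lt i hr
  rw [periodicWord, length_factor, List.getD_eq_getElem _ _ (by simpa using hlt)]
  simp only [factor, List.getElem_map, List.getElem_range', zero_add, one_mul]
  exact hy.map_mod_nat i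

/-- The letters of the word of differences of `i ↦ ⌊(i p + e) / r⌋`. The lower and the upper
Christoffel word of slope `p / r` are its prefixes of length `r` for `e = 0` and `e = r - 1`. -/
def mechLetter (p r : ℕ) (e : ℤ) (i : ℕ) : Bool :=
  decide (((i + 1) * p + e) / r - (i * p + e) / r = 1)

lemma lowerChristoffel_eq_factor (p r : ℕ) :
    lowerChristoffel p r = factor (mechLetter p r 0) 0 r := by
  rw [lowerChristoffel, factor, ← List.range_eq_range']
  refine List.map_congr_left fun i _ => ?_
  have hfloor : ∀ j : ℕ, ⌊(p * j : ℚ) / r⌋ = ((j : ℤ) * p + 0) / r := fun j => by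
    have := Rat.floor_intCast_div_natCast ((j : ℤ) * p) r
    push_cast at this
    rw [mul_comm (p : ℚ), this, add_zero]
  have hfloor_succ := hfloor (i + 1)
  push_cast at hfloor_succ
  rw [hfloor i, hfloor_succ, mechLetter]

lemma upperChristoffel_eq_factor {p r : ℕ} (hr : 1 ≤ r) :
    upperChristoffel p r = factor (mechLetter p r (r - 1)) 0 r := by
  rw [upperChristoffel, factor, ← List.range_eq_range']
  refine List.map_congr_left fun i _ => ?_
  have hr₀ : (0 : ℤ) < r := by omega
  have hceil : ∀ j : ℕ, ⌈(p * j : ℚ) / r⌉ = ((j : ℤ) * p + (r - 1)) / r := fun j => by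
    have := Rat.ceil_intCast_div_natCast ((j : ℤ) * p) r
    push_cast at this
    rw [mul_comm (p : ℚ), this, eq_comm, Int.ediv_eq_iff_of_pos hr₀]
    have h := (Int.ediv_eq_iff_of_pos hr₀).1 (rfl : -((j : ℤ) * p) / r = _)
    constructor <;> linarith [h.1, h.2]
  have hceil_succ := hceil (i + 1)
  push_cast at hceil_succ
  rw [hceil i, hceil_succ, mechLetter]

lemma mechLetter_periodic (p : ℕ) {r : ℕ} (hr : 1 ≤ r) (e : ℤ) : (mechLetter p r e).Periodic r := by
  intro i
  have hr₀ : (r : ℤ) ≠ 0 := by omega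
  rw [mechLetter, mechLetter]
  push_cast
  rw [show ((i : ℤ) + r + 1) * p + e = (i + 1) * p + e + p * r by ring,
    show ((i : ℤ) + r) * p + e = i * p + e + p * r by ring, Int.add_mul_ediv_right _ _ hr₀,
    Int.add_mul_ediv_right _ _ hr₀, add_sub_add_right_eq_sub]

section MechLetter

variable {p r : ℕ} {e : ℤ} (hpr : p ≤ r) (he : 0 ≤ e) (her : e < r)
include hpr he her

lemma onesCount_mechLetter (i : ℕ) :
    (onesCount (mechLetter p r e) i : ℤ) = (i * p + e) / r := by
  have hr₀ : (0 : ℤ) < r := by omega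
  induction i with
  | zero => simp [onesCount, Int.ediv_eq_zero_of_lt he her]
  | succ i ih =>
    rw [onesCount, Nat.cast_add, ih, mechLetter, Nat.cast_add, Nat.cast_one]
    have hlow : ((i : ℤ) * p + e) / r ≤ ((i + 1) * p + e) / r :=
      Int.ediv_le_ediv hr₀ (by nlinarith)
    have hupp : (((i : ℤ) + 1) * p + e) / r ≤ ((i : ℤ) * p + e) / r + 1 := by
      rw [← Int.add_mul_ediv_right _ _ hr₀.ne']
      refine Int.ediv_le_ediv hr₀ ?_
      have : (p : ℤ) ≤ r := by exact_mod_cast hpr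
      linarith
    rcases (by omega : (((i : ℤ) + 1) * p + e) / r = ((i : ℤ) * p + e) / r ∨
      (((i : ℤ) + 1) * p + e) / r = ((i : ℤ) * p + e) / r + 1) with h | h <;> rw [h] <;> simp

lemma codeSum_mechLetter (n : ℕ) :
    codeSum (mechLetter p r e) n = ((n : ℤ) * p + e) / (p + r : ℕ) := by
  have hr₀ : (0 : ℤ) < r := by omega
  have hpr₀ : (0 : ℤ) < (p + r : ℕ) := by omega
  have hbounds : ∀ i : ℕ, (onesCount (mechLetter p r e) i : ℤ) * r ≤ i * p + e ∧
      (i : ℤ) * p + e < onesCount (mechLetter p r e) i * r + r := fun i =>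
    (Int.ediv_eq_iff_of_pos hr₀).1 (onesCount_mechLetter hpr he her i).symm
  refine codeSum_eq (h := fun n : ℕ => ((n : ℤ) * p + e) / (p + r : ℕ)) (fun i => ?_)
    (fun i => ?_) n
  all_goals
    rw [Int.ediv_eq_iff_of_pos hpr₀, blockPos]
    push_cast
    obtain ⟨hlow, hupp⟩ := hbounds i
    constructor <;> linarith

lemma gamSeq_mechLetter (n : ℕ) :
    gamSeq (mechLetter p r e) n = mechWord p (p + r) e (n + 1) := by
  simp only [gamSeq_eq_codeSum, codeSum_mechLetter hpr he her, mechWord]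
  push_cast
  rw [show (n : ℤ) + 1 + 1 = n + 2 by ring, show (n : ℤ) + 1 - 1 = n by ring]

lemma length_gam_factor_mechLetter :
    (gam (factor (mechLetter p r e) 0 r)).length = p + r := by
  have hr₀ : (r : ℤ) ≠ 0 := by omega
  have hcount := onesCount_mechLetter hpr he her r
  rw [mul_comm, Int.add_comm, Int.add_mul_ediv_right _ _ hr₀,
    Int.ediv_eq_zero_of_lt he her] at hcount
  rw [length_gam_factor_zero, blockPos]
  omega

lemma gamSeq_periodicWord_factor_mechLetter (n : ℕ) :
    gamSeq (periodicWord (factor (mechLetter p r e) 0 r)) n = mechWord p (p + r) e (n + 1) := by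
  have hr : 1 ≤ r := by omega
  rw [periodicWord_factor hr (mechLetter_periodic p hr e), gamSeq_mechLetter hpr he her]

end MechLetter

lemma IsChristoffel.exists_mechWord {ν : List Bool} (h : IsChristoffel ν) :
    ∃ (p q : ℕ) (e : ℤ), 1 ≤ q ∧ p.Coprime q ∧ (gam ν).length = q ∧
      ∀ n : ℕ, gamSeq (periodicWord ν) n = mechWord p q e (n + 1) := by
  obtain ⟨p, r, hpr, hcop, h⟩ := h
  have hr : 1 ≤ r := by
    by_contra! hr
    obtain ⟨rfl, rfl⟩ : p = 0 ∧ r = 0 := by omega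
    simp at hcop
  obtain ⟨e, he, her, rfl⟩ : ∃ e : ℤ, 0 ≤ e ∧ e < r ∧ ν = factor (mechLetter p r e) 0 r := by
    rcases h with h | h
    · exact ⟨0, le_rfl, by omega, h.trans (lowerChristoffel_eq_factor p r)⟩
    · exact ⟨r - 1, by omega, by omega, h.trans (upperChristoffel_eq_factor hr)⟩
  exact ⟨p, p + r, e, by omega, by simpa using hcop, length_gam_factor_mechLetter hpr he her,
    gamSeq_periodicWord_factor_mechLetter hpr he her⟩

lemma exists_natCast_eq_add_mul {q : ℕ} (hq : 1 ≤ q) (m : ℤ) :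
    ∃ (k : ℕ) (c : ℤ), k < q ∧ (k : ℤ) = m + c * q := by
  have hq₀ : (0 : ℤ) < q := by omega
  have hnonneg := Int.emod_nonneg m hq₀.ne'
  have hlt := Int.emod_lt_of_pos m hq₀
  refine ⟨(m % q).toNat, -(m / q), by omega, ?_⟩
  rw [Int.toNat_of_nonneg hnonneg, Int.emod_def]
  ring

lemma exists_mechWord_eq_shift {p q : ℕ} (hq : 1 ≤ q) (hcop : p.Coprime q) (a : ℤ) :
    ∃ m : ℤ, ∀ n, mechWord p q a n = mechWord p q 0 (m + n) := by
  have hq₀ : (q : ℤ) ≠ 0 := by omega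
  obtain ⟨m, z, hz⟩ := exists_dvd_mul_add hcop a
  refine ⟨-m, fun n => ?_⟩
  simp only [mechWord]
  rw [show (n + 1) * (p : ℤ) + a = (-m + n + 1) * p + 0 + z * q by linarith,
    show n * (p : ℤ) + a = (-m + n) * p + 0 + z * q by linarith,
    show (n - 1) * (p : ℤ) + a = (-m + n - 1) * p + 0 + z * q by linarith]
  simp only [Int.add_mul_ediv_right _ _ hq₀]
  ring

lemma mechWord_zero_eq_neg_mechWord_sub {p q : ℕ} (hq : 1 ≤ q) (hpq : p ≤ q) (n : ℤ) :
    mechWord p q 0 n = -mechWord (q - p) q (p - 1) (n + 1) := by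
  have hq₀ : (0 : ℤ) < q := by omega
  have hfloor : ∀ x : ℤ,
      (x * p + 0) / q = x - ((x + 1) * ((q - p : ℕ) : ℤ) + (p - 1)) / q := fun x => by
    rw [Int.ediv_eq_iff_of_pos hq₀]
    obtain ⟨hlow, hupp⟩ := (Int.ediv_eq_iff_of_pos hq₀).1
      (rfl : ((x + 1) * ((q - p : ℕ) : ℤ) + (p - 1)) / q = _)
    generalize ((x + 1) * ((q - p : ℕ) : ℤ) + (p - 1)) / q = y at *
    push_cast [Nat.cast_sub hpq] at hlow hupp
    constructor <;> nlinarith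
  rw [mechWord, hfloor, hfloor, hfloor, mechWord, sub_add_cancel, add_sub_cancel_right]
  ring

section

variable {p q : ℕ} (hq : 1 ≤ q) (hpq : p ≤ q) (hcop : p.Coprime q) (m : ℤ)
include hq hpq hcop

lemma exists_isChristoffel_of_two_mul_le (h : 2 * p ≤ q) :
    ∃ (ν : List Bool) (k : ℕ), IsChristoffel ν ∧ (gam ν).length = q ∧ k < q ∧
      ∀ n : ℕ, mechWord p q 0 (m + (n + 1)) = gamSeq (periodicWord ν) (k + n) := by
  obtain ⟨k, c, hk, hkm⟩ := exists_natCast_eq_add_mul hq m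
  have hsum : p + (q - p) = q := by omega
  refine ⟨lowerChristoffel p (q - p), k, ⟨p, q - p, by omega,
    (Nat.coprime_sub_self_right hpq).2 hcop, Or.inl rfl⟩, ?_, hk, fun n => ?_⟩
  · rw [lowerChristoffel_eq_factor,
      length_gam_factor_mechLetter (by omega) le_rfl (by omega), hsum]
  · rw [lowerChristoffel_eq_factor,
      gamSeq_periodicWord_factor_mechLetter (by omega) le_rfl (by omega), hsum, Nat.cast_add, hkm,
      ← mechWord_add_period hq 0 _ c]
    congr 1
    ring

lemma exists_isChristoffel_of_le_two_mul (h : q ≤ 2 * p) :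
    ∃ (ν : List Bool) (k : ℕ), IsChristoffel ν ∧ (gam ν).length = q ∧ k < q ∧
      ∀ n : ℕ, mechWord p q 0 (m + (n + 1)) = -gamSeq (periodicWord ν) (k + n) := by
  have hp : 1 ≤ p := by omega
  obtain ⟨k, c, hk, hkm⟩ := exists_natCast_eq_add_mul hq (m + 1)
  have hsum : q - p + p = q := by omega
  refine ⟨upperChristoffel (q - p) p, k, ⟨q - p, p, by omega,
    (Nat.coprime_sub_self_left hpq).2 hcop.symm, Or.inr rfl⟩, ?_, hk, fun n => ?_⟩
  · rw [upperChristoffel_eq_factor hp,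
      length_gam_factor_mechLetter (by omega) (by omega) (by omega), hsum]
  · rw [upperChristoffel_eq_factor hp,
      gamSeq_periodicWord_factor_mechLetter (by omega) (by omega) (by omega), hsum,
      mechWord_zero_eq_neg_mechWord_sub hq hpq, Nat.cast_add, hkm,
      ← mechWord_add_period hq (p - 1) _ c]
    congr 2
    ring

lemma exists_isChristoffel_eq_mechWord (a : ℤ) :
    ∃ (ν : List Bool) (σ : ℤ) (k : ℕ), IsChristoffel ν ∧ (gam ν).length = q ∧ k < q ∧
      (σ = 1 ∨ σ = -1) ∧
      ∀ n : ℕ, mechWord p q a (n + 1) = σ * gamSeq (periodicWord ν) (k + n) := by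
  obtain ⟨m, hm⟩ := exists_mechWord_eq_shift hq hcop a
  rcases le_total (2 * p) q with h | h
  · obtain ⟨ν, k, hν, hlen, hk, heq⟩ := exists_isChristoffel_of_two_mul_le hq hpq hcop m h
    exact ⟨ν, 1, k, hν, hlen, hk, Or.inl rfl, fun n => by rw [hm, heq, one_mul]⟩
  · obtain ⟨ν, k, hν, hlen, hk, heq⟩ := exists_isChristoffel_of_le_two_mul hq hpq hcop m h
    exact ⟨ν, -1, k, hν, hlen, hk, Or.inr rfl, fun n => by rw [hm, heq, neg_one_mul]⟩

end

/-! ### Reduction of the limit superior to Green function sums -/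

lemma limsup_le_limsup_of_tendsto_sub {f g : ℕ → ℝ} (hf : ∀ n, 0 ≤ f n)
    (hg : IsBoundedUnder (· ≤ ·) atTop g) (h : Tendsto (fun n => f n - g n) atTop (𝓝 0)) :
    limsup f atTop ≤ limsup g atTop := by
  refine le_of_forall_pos_le_add fun ε hε => ?_
  refine limsup_le_of_le (isCoboundedUnder_le_of_le atTop hf) ?_
  filter_upwards [eventually_lt_of_limsup_lt (lt_add_of_pos_right _ (half_pos hε)) hg,
    h.eventually (eventually_lt_nhds (half_pos hε))] with n hgn hfgn
  linarith

lemma limsup_eq_limsup_of_tendsto_sub {f g : ℕ → ℝ} (hf : ∀ n, 0 ≤ f n) (hg : ∀ n, 0 ≤ g n)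
    (hf' : IsBoundedUnder (· ≤ ·) atTop f) (hg' : IsBoundedUnder (· ≤ ·) atTop g)
    (h : Tendsto (fun n => f n - g n) atTop (𝓝 0)) : limsup f atTop = limsup g atTop := by
  refine le_antisymm (limsup_le_limsup_of_tendsto_sub hf hg' h)
    (limsup_le_limsup_of_tendsto_sub hg hf' ?_)
  simpa only [neg_sub, neg_zero] using h.neg

lemma nint_nonneg (x : ℝ) : 0 ≤ nint x := abs_nonneg _

lemma nint_le_half (x : ℝ) : nint x ≤ 1 / 2 := abs_sub_round x

lemma nint_eq_abs_sub {x : ℝ} {u : ℤ} (h : |x - u| < 1 / 2) : nint x = |x - u| := by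
  rw [abs_lt] at h
  rw [nint, (round_eq_iff (n := u)).2 ⟨by linarith, by linarith⟩]

lemma isBoundedUnder_nint (α ξ : ℝ) :
    IsBoundedUnder (· ≤ ·) atTop fun n : ℕ => nint (ξ * α ^ n) :=
  isBoundedUnder_of ⟨1 / 2, fun _ => nint_le_half _⟩

lemma limsupDist_nonneg (α ξ : ℝ) : 0 ≤ limsupDist α ξ :=
  le_limsup_of_frequently_le (Frequently.of_forall fun _ => nint_nonneg _) (isBoundedUnder_nint α ξ)

/-- The inhomogeneous term of the recurrence `u (n + 2) = b u (n + 1) - u n + s n` that an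
arbitrary sequence `u` satisfies. For the nearest integers `u n` of `ξ α ^ n` it is the word which
encodes `ξ`. -/
def recurrenceDefect (b : ℕ) (u : ℕ → ℤ) (n : ℕ) : ℤ := u (n + 2) - b * u (n + 1) + u n

lemma exists_recurrenceDefect_eq (b : ℕ) (s : ℕ → ℤ) (u₀ u₁ : ℤ) :
    ∃ u : ℕ → ℤ, u 0 = u₀ ∧ u 1 = u₁ ∧ recurrenceDefect b u = s := by
  let pairs : ℕ → ℤ × ℤ := fun n =>
    Nat.rec (u₀, u₁) (fun n v => (v.2, b * v.2 - v.1 + s n)) n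
  refine ⟨fun n => (pairs n).1, rfl, rfl, funext fun n => ?_⟩
  change (b * (pairs n).2 - (pairs n).1 + s n) - b * (pairs n).2 + (pairs n).1 = s n
  ring

/-- The number `ξ` for which `ξ α ^ n - u n` stays bounded, for a sequence `u` of integers with
bounded defect and the conjugate `β = α⁻¹`. -/
noncomputable def recurrencePoint (α β : ℝ) (b : ℕ) (u : ℕ → ℤ) : ℝ :=
  realize α β (padZero (recurrenceDefect b u)) + (u 1 - β * u 0) / (α - β)

lemma tsum_padZero (s : ℕ → ℤ) (f : ℤ → ℝ) :
    ∑' i : ℤ, (padZero s i : ℝ) * f i = ∑' j : ℕ, (s j : ℝ) * f (j + 1) := by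
  have hinj : Function.Injective fun j : ℕ => (j : ℤ) + 1 := fun i j h => by simpa using h
  rw [← hinj.tsum_eq]
  · exact tsum_congr fun j => by rw [padZero_succ]
  · intro i hi
    rcases le_or_gt i 0 with hnonpos | hpos
    · simp [padZero, hnonpos] at hi
    · exact ⟨(i - 1).toNat, by simp; omega⟩

lemma realize_padZero_mul (α β : ℝ) (s : ℕ → ℤ) (σ : ℤ) :
    realize α β (padZero fun n => σ * s n) = σ * realize α β (padZero s) := by
  rw [realize, realize, tsum_padZero, tsum_padZero, ← tsum_mul_left]
  exact tsum_congr fun j => by push_cast; ring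

section Realization

variable {α β : ℝ}

lemma realize_padZero (hprod : α * β = 1) (s : ℕ → ℤ) :
    realize α β (padZero s) = β * rightSum β (padZero s) 1 / (α - β) := by
  have hβ : β = α⁻¹ := (inv_eq_of_mul_eq_one_right hprod).symm
  rw [realize, tsum_padZero, rightSum, ← tsum_mul_left, ← tsum_div_const]
  refine tsum_congr fun j => ?_
  rw [add_comm 1 (j : ℤ), padZero_succ, tau, if_neg (by omega), hβ, zpow_neg,
    ← Nat.cast_succ, zpow_natCast, ← inv_pow, Nat.succ_eq_add_one, pow_succ]
  ring

lemma leftSum_padZero_zero (β : ℝ) (s : ℕ → ℤ) : leftSum β (padZero s) 0 = 0 := by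
  simp [leftSum, padZero]

lemma exists_eq_add_mul_of_mem_adjoin {b : ℕ} (hprod : α * β = 1) (hsum : α + β = b) {z : ℝ}
    (hz : z ∈ Algebra.adjoin ℤ ({α} : Set ℝ)) : ∃ c d : ℤ, z = c + d * α := by
  induction hz using Algebra.adjoin_induction with
  | mem x hx => exact ⟨0, 1, by rw [Set.mem_singleton_iff.1 hx]; simp⟩
  | algebraMap r => exact ⟨r, 0, by simp⟩
  | add x y _ _ hx hy =>
    obtain ⟨c, d, rfl⟩ := hx
    obtain ⟨c', d', rfl⟩ := hy
    exact ⟨c + c', d + d', by push_cast; ring⟩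
  | mul x y _ _ hx hy =>
    obtain ⟨c, d, rfl⟩ := hx
    obtain ⟨c', d', rfl⟩ := hy
    refine ⟨c * c' - d * d', c * d' + d * c' + d * d' * b, ?_⟩
    push_cast
    rw [← hsum]
    linear_combination (-(d : ℝ) * d') * hprod

lemma mem_baseSet_iff {b : ℕ} (hprod : α * β = 1) (hsum : α + β = b) {x : ℝ} :
    x ∈ baseSet α β ↔ ∃ u₀ u₁ : ℤ, x = (u₁ - β * u₀) / (α - β) := by
  constructor
  · rintro ⟨z, hz, rfl⟩
    obtain ⟨c, d, rfl⟩ := exists_eq_add_mul_of_mem_adjoin hprod hsum hz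
    refine ⟨d, c + b * d, ?_⟩
    push_cast
    rw [← hsum]
    ring
  · rintro ⟨u₀, u₁, rfl⟩
    refine ⟨((u₁ - b * u₀ : ℤ) : ℝ) + (u₀ : ℝ) * α, add_mem (intCast_mem _ _)
      (mul_mem (intCast_mem _ _) (Algebra.self_mem_adjoin_singleton ℤ α)), ?_⟩
    push_cast
    rw [← hsum]
    ring

variable (hβ₀ : 0 < β) (hβ₁ : β < 1) (hprod : α * β = 1)
include hβ₀ hβ₁ hprod

lemma one_lt_of_conj : 1 < α := by
  by_contra! hα
  nlinarith

lemma sub_conj_pos : 0 < α - β := by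
  linarith [one_lt_of_conj hβ₀ hβ₁ hprod]

lemma conj_div_eq : (1 - β) / (α - β) = 1 / (1 + α) := by
  rw [div_eq_div_iff (sub_conj_pos hβ₀ hβ₁ hprod).ne'
    (by linarith [one_lt_of_conj hβ₀ hβ₁ hprod])]
  linarith

variable {b : ℕ} (hsum : α + β = b) {u : ℕ → ℤ}
include hsum

omit hβ₀ hβ₁ hprod in
lemma recurrenceDefect_cast (n : ℕ) :
    (recurrenceDefect b u n : ℝ) = u (n + 2) - (α + β) * u (n + 1) + u n := by
  rw [recurrenceDefect, hsum]
  push_cast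
  ring

section

variable (hu : BoundedWord (padZero (recurrenceDefect b u)))
include hu

lemma recurrencePoint_mul_pow (n : ℕ) : (α - β) * recurrencePoint α β b u * α ^ n =
    u (n + 1) - β * u n + β * rightSum β (padZero (recurrenceDefect b u)) (n + 1) := by
  induction n with
  | zero =>
    have hne := (sub_conj_pos hβ₀ hβ₁ hprod).ne'
    rw [recurrencePoint, realize_padZero hprod]
    simp only [Nat.cast_zero, zero_add, pow_zero, mul_one]
    field_simp
    ring
  | succ n ih =>
    rw [pow_succ, ← mul_assoc, ih, rightSum_eq_add_mul hβ₀.le hβ₁ hu, padZero_succ,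
      recurrenceDefect_cast hsum]
    push_cast
    linear_combination (rightSum β (padZero (recurrenceDefect b u)) (n + 1 + 1) * β + u (n + 2) -
      (α + β) * u (n + 1)) * hprod

lemma recurrence_sub_eq_leftSum (n : ℕ) : (u (n + 1) : ℝ) - α * u n =
    (u 1 - α * u 0) * β ^ n + leftSum β (padZero (recurrenceDefect b u)) n := by
  induction n with
  | zero => rw [Nat.cast_zero, leftSum_padZero_zero, zero_add, pow_zero, mul_one, add_zero]
  | succ n ih =>
    rw [leftSum_eq_add_mul hβ₀.le hβ₁ hu]
    push_cast
    rw [padZero_succ, recurrenceDefect_cast hsum, add_sub_cancel_right]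
    linear_combination β * ih + (u n : ℝ) * hprod

lemma recurrencePoint_mul_pow_sub (n : ℕ) :
    (α - β) * (recurrencePoint α β b u * α ^ n - u n) =
      greenSum β (padZero (recurrenceDefect b u)) n + (u 1 - α * u 0) * β ^ n := by
  rw [greenSum_eq_rightSum_add_leftSum hβ₀.le hβ₁ hu, add_assoc, ← sub_eq_iff_eq_add.2
    (leftSum_eq_add_mul hβ₀.le hβ₁ hu n)]
  linear_combination recurrencePoint_mul_pow hβ₀ hβ₁ hprod hsum hu n +
    recurrence_sub_eq_leftSum hβ₀ hβ₁ hprod hsum hu n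

lemma abs_recurrencePoint_mul_pow_sub (n : ℕ) : |recurrencePoint α β b u * α ^ n - u n| =
    |greenSum β (padZero (recurrenceDefect b u)) n + (u 1 - α * u 0) * β ^ n| / (α - β) := by
  have hpos := sub_conj_pos hβ₀ hβ₁ hprod
  rw [← recurrencePoint_mul_pow_sub hβ₀ hβ₁ hprod hsum hu, abs_mul, abs_of_pos hpos,
    mul_div_cancel_left₀ _ hpos.ne']

omit hsum hprod hu in
lemma tendsto_abs_const_mul_pow (c : ℝ) : Tendsto (fun n : ℕ => |c * β ^ n|) atTop (𝓝 0) := by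
  simpa using ((tendsto_pow_atTop_nhds_zero_of_lt_one hβ₀.le hβ₁).const_mul c).abs

lemma limsupDist_recurrencePoint (hround : ∀ᶠ n : ℕ in atTop,
      nint (recurrencePoint α β b u * α ^ n) = |recurrencePoint α β b u * α ^ n - u n|) :
    limsupDist α (recurrencePoint α β b u) =
      limsupGreenSum β (padZero (recurrenceDefect b u)) / (α - β) := by
  have hpos := sub_conj_pos hβ₀ hβ₁ hprod
  have hmono : Monotone fun x : ℝ => x / (α - β) := fun x y h => by
    dsimp only; gcongr
  have hbdd := isBounded_abs_greenSum hβ₀.le hβ₁ hu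
  have hscale : limsupGreenSum β (padZero (recurrenceDefect b u)) / (α - β) =
      limsup (fun n : ℕ => |greenSum β (padZero (recurrenceDefect b u)) n| / (α - β)) atTop :=
    hmono.map_limsup_of_continuousAt (F := atTop) _ (by fun_prop) hbdd
      (isCobounded_abs_greenSum β _)
  rw [hscale, limsupDist]
  refine limsup_eq_limsup_of_tendsto_sub (fun _ => nint_nonneg _)
    (fun _ => div_nonneg (abs_nonneg _) hpos.le) (isBoundedUnder_nint α _) ?_ ?_
  · exact hbdd.comp hmono
  · have hlim := (tendsto_abs_const_mul_pow hβ₀ hβ₁ (u 1 - α * u 0 : ℝ)).div_const (α - β)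
    rw [zero_div] at hlim
    refine squeeze_zero_norm' ?_ hlim
    filter_upwards [hround] with n hn
    rw [hn, abs_recurrencePoint_mul_pow_sub hβ₀ hβ₁ hprod hsum hu, ← sub_div, Real.norm_eq_abs,
      abs_div, abs_of_pos hpos]
    refine hmono ((abs_abs_sub_abs_le _ _).trans_eq ?_)
    rw [add_sub_cancel_left]

lemma eq_recurrencePoint_of_abs_sub_le {ξ M : ℝ} (hM : ∀ n : ℕ, |ξ * α ^ n - u n| ≤ M) :
    ξ = recurrencePoint α β b u := by
  set η := recurrencePoint α β b u
  have hα := one_lt_of_conj hβ₀ hβ₁ hprod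
  have hpos := sub_conj_pos hβ₀ hβ₁ hprod
  obtain ⟨G, hG⟩ := isBounded_abs_greenSum hβ₀.le hβ₁ hu
  rw [eventually_map] at hG
  by_contra hne
  have hgrowth := (tendsto_pow_atTop_atTop_of_one_lt hα).const_mul_atTop
    (abs_pos.2 (sub_ne_zero.2 hne))
  obtain ⟨n, hGn, hn, hsmall⟩ := (hG.and ((hgrowth.eventually (eventually_gt_atTop
    (M + (G + 1) / (α - β)))).and ((tendsto_abs_const_mul_pow hβ₀ hβ₁
      (u 1 - α * u 0 : ℝ)).eventually (eventually_le_nhds one_pos)))).exists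
  have hη : |η * α ^ n - u n| ≤ (G + 1) / (α - β) := by
    rw [abs_recurrencePoint_mul_pow_sub hβ₀ hβ₁ hprod hsum hu]
    gcongr
    exact (abs_add_le _ _).trans (add_le_add hGn hsmall)
  have habs : |ξ - η| * α ^ n = |(ξ * α ^ n - u n) - (η * α ^ n - u n)| := by
    rw [← abs_of_pos (pow_pos (one_pos.trans hα) n), ← abs_mul,
      abs_of_pos (pow_pos (one_pos.trans hα) n)]
    ring_nf
  linarith [abs_sub (ξ * α ^ n - u n) (η * α ^ n - u n), hM n]

end

theorem limsupDist_realize_add {s : ℕ → ℤ} (hs : BoundedWord (padZero s))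
    (h : limsupGreenSum β (padZero s) < (α - β) / 2) {x : ℝ} (hx : x ∈ baseSet α β) :
    limsupDist α (realize α β (padZero s) + x) = limsupGreenSum β (padZero s) / (α - β) := by
  obtain ⟨u₀, u₁, rfl⟩ := (mem_baseSet_iff hprod hsum).1 hx
  obtain ⟨u, rfl, rfl, rfl⟩ := exists_recurrenceDefect_eq b s u₀ u₁
  refine limsupDist_recurrencePoint hβ₀ hβ₁ hprod hsum hs ?_
  obtain ⟨c, hsc, hc⟩ := exists_between h
  filter_upwards [eventually_lt_of_limsup_lt hsc (isBounded_abs_greenSum hβ₀.le hβ₁ hs),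
    (tendsto_abs_const_mul_pow hβ₀ hβ₁ (u 1 - α * u 0 : ℝ)).eventually
      (eventually_lt_nhds (sub_pos.2 hc))] with n hmain herror
  refine nint_eq_abs_sub ?_
  rw [abs_recurrencePoint_mul_pow_sub hβ₀ hβ₁ hprod hsum hs,
    div_lt_iff₀ (sub_conj_pos hβ₀ hβ₁ hprod)]
  linarith [abs_add_le (greenSum β (padZero (recurrenceDefect b u)) n) ((u 1 - α * u 0) * β ^ n)]

omit hβ₀ hβ₁ in
lemma abs_recurrenceDefect_round_le (ξ : ℝ) {n : ℕ} {c : ℝ}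
    (h : ∀ m, n ≤ m → nint (ξ * α ^ m) ≤ c) :
    |(recurrenceDefect b (fun m => round (ξ * α ^ m)) n : ℝ)| ≤ (b + 2) * c := by
  simp only [nint, abs_le] at h
  obtain ⟨hl₀, hr₀⟩ := h n le_rfl
  obtain ⟨hl₁, hr₁⟩ := h (n + 1) (by omega)
  obtain ⟨hl₂, hr₂⟩ := h (n + 2) (by omega)
  have : (0 : ℝ) ≤ b := b.cast_nonneg
  -- `m ↦ ξ α ^ m` has defect `0`.
  have hdefect : (recurrenceDefect b (fun m => round (ξ * α ^ m)) n : ℝ) =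
      -((ξ * α ^ (n + 2) - round (ξ * α ^ (n + 2))) -
        b * (ξ * α ^ (n + 1) - round (ξ * α ^ (n + 1))) + (ξ * α ^ n - round (ξ * α ^ n))) := by
    rw [recurrenceDefect_cast hsum, ← hsum, pow_succ, pow_succ]
    linear_combination -ξ * α ^ n * hprod
  rw [hdefect, abs_neg, abs_le]
  constructor <;> nlinarith

lemma eventually_abs_recurrenceDefect_round_le_one {ξ : ℝ} (hξ : limsupDist α ξ ≤ 1 / (1 + α)) :
    ∀ᶠ n in atTop, |recurrenceDefect b (fun m => round (ξ * α ^ m)) n| ≤ 1 := by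
  have hb : (0 : ℝ) < b + 2 := by positivity
  have hlt : limsupDist α ξ < 2 / (b + 2) := by
    have hα := one_lt_of_conj hβ₀ hβ₁ hprod
    refine hξ.trans_lt ?_
    rw [div_lt_div_iff₀ (by linarith) hb, ← hsum]
    linarith
  obtain ⟨c, hξc, hc⟩ := exists_between hlt
  obtain ⟨N, hN⟩ := eventually_atTop.1 (eventually_lt_of_limsup_lt hξc (isBoundedUnder_nint α ξ))
  filter_upwards [eventually_ge_atTop N] with n hn
  refine Int.lt_add_one_iff.1 ?_
  have hle := abs_recurrenceDefect_round_le hprod hsum ξ fun m hm => (hN m (hn.trans hm)).le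
  exact_mod_cast hle.trans_lt ((lt_div_iff₀' hb).1 hc)

theorem exists_eq_realize_add (ξ : ℝ) :
    ∃ s : ℕ → ℤ, ∃ x ∈ baseSet α β, BoundedWord (padZero s) ∧ ξ = realize α β (padZero s) + x ∧
      limsupDist α ξ = limsupGreenSum β (padZero s) / (α - β) ∧
      (limsupDist α ξ ≤ 1 / (1 + α) → ∀ᶠ n in atTop, |s n| ≤ 1) := by
  set u : ℕ → ℤ := fun n => round (ξ * α ^ n)
  have hu : BoundedWord (padZero (recurrenceDefect b u)) := by
    refine boundedWord_padZero (B := ⌈((b : ℝ) + 2) * (1 / 2)⌉) (Eventually.of_forall fun n => ?_)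
    exact_mod_cast (abs_recurrenceDefect_round_le hprod hsum ξ fun m _ => nint_le_half _).trans
      (Int.le_ceil _)
  have hξ : ξ = recurrencePoint α β b u :=
    eq_recurrencePoint_of_abs_sub_le hβ₀ hβ₁ hprod hsum hu fun n => nint_le_half (ξ * α ^ n)
  refine ⟨recurrenceDefect b u, (u 1 - β * u 0) / (α - β),
    (mem_baseSet_iff hprod hsum).2 ⟨u 0, u 1, rfl⟩, hu, hξ, ?_,
    eventually_abs_recurrenceDefect_round_le_one hβ₀ hβ₁ hprod hsum⟩
  have hround : ∀ᶠ n : ℕ in atTop,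
      nint (recurrencePoint α β b u * α ^ n) = |recurrencePoint α β b u * α ^ n - u n| := by
    rw [← hξ]
    exact Eventually.of_forall fun _ => rfl
  conv_lhs => rw [hξ]
  exact limsupDist_recurrencePoint hβ₀ hβ₁ hprod hsum hu hround

end Realization

/-! ### The sequences `p` and `q` -/

lemma recSeq_add_two (b u v : ℤ) (n : ℕ) :
    recSeq b u v (n + 2) = b * recSeq b u v (n + 1) - recSeq b u v n := rfl

lemma recSeq_one_one_add (b : ℤ) (n : ℕ) :
    recSeq b 1 (1 + b) n = recSeq b 0 1 (n + 1) + recSeq b 0 1 n := by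
  induction n using Nat.twoStepInduction with
  | zero => simp [recSeq]
  | one => simp [recSeq]; ring
  | more n ih₀ ih₁ =>
    rw [recSeq, ih₀, ih₁, recSeq, recSeq, recSeq]
    ring

lemma recSeq_nonneg_and_lt_succ {b : ℤ} (hb : 2 ≤ b) (n : ℕ) :
    0 ≤ recSeq b 0 1 n ∧ recSeq b 0 1 n < recSeq b 0 1 (n + 1) := by
  induction n with
  | zero => simp [recSeq]
  | succ n ih =>
    refine ⟨by linarith [ih.1, ih.2], ?_⟩
    rw [recSeq_add_two]
    nlinarith [ih.1, ih.2]

lemma recSeq_isCoprime_succ (b : ℤ) (n : ℕ) :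
    IsCoprime (recSeq b 0 1 n) (recSeq b 0 1 (n + 1)) := by
  induction n with
  | zero => exact isCoprime_one_right
  | succ n ih =>
    obtain ⟨x, y, hxy⟩ := ih
    refine ⟨b * x + y, -x, ?_⟩
    rw [recSeq_add_two]
    linear_combination hxy

lemma pSeq_two_mul (b n : ℕ) : pSeq b (2 * n) = recSeq b 0 1 n := by
  simp [pSeq, interleave]

lemma qSeq_two_mul (b n : ℕ) : qSeq b (2 * n) = recSeq b 0 1 (n + 1) + recSeq b 0 1 n := by
  simp [qSeq, interleave, recSeq_one_one_add]

lemma pSeq_two_mul_add_one (b n : ℕ) :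
    pSeq b (2 * n + 1) = recSeq b 0 1 n + recSeq b 0 1 (n + 1) := by
  have hhalf : (2 * n + 1) / 2 = n := by omega
  simp [pSeq, interleave, hhalf]

lemma qSeq_two_mul_add_one (b n : ℕ) :
    qSeq b (2 * n + 1) = (recSeq b 0 1 (n + 1) + recSeq b 0 1 n) +
      (recSeq b 0 1 (n + 2) + recSeq b 0 1 (n + 1)) := by
  have hhalf : (2 * n + 1) / 2 = n := by omega
  simp [qSeq, interleave, hhalf, recSeq_one_one_add]

section Convergents

variable {b : ℕ} (hb : 2 ≤ b)
include hb

lemma recSeq_succ_ne_zero (n : ℕ) : (recSeq b 0 1 (n + 1) : ℚ) ≠ 0 := by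
  have := recSeq_nonneg_and_lt_succ (b := b) (by exact_mod_cast hb) n
  exact_mod_cast (by omega)

lemma negCF_replicate (n : ℕ) :
    negCF (List.replicate n (b : ℚ)) = (recSeq b 0 1 n : ℚ) / recSeq b 0 1 (n + 1) := by
  induction n with
  | zero => simp [negCF, recSeq]
  | succ n ih =>
    have hne := recSeq_succ_ne_zero hb n
    rw [List.replicate_succ, negCF, ih, recSeq_add_two, Int.cast_sub, Int.cast_mul,
      Int.cast_natCast, ← one_div_div _ (recSeq b 0 1 (n + 1) : ℚ), sub_div,
      mul_div_cancel_right₀ _ hne]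

lemma negConv_eq (n : ℕ) : negConv b n =
    (recSeq b 0 1 n : ℚ) / ((recSeq b 0 1 (n + 1) + recSeq b 0 1 n : ℤ) : ℚ) := by
  cases n with
  | zero => simp [negConv, negCF, recSeq]
  | succ n =>
    have hne := recSeq_succ_ne_zero hb n
    rw [negConv, negCF, negCF_replicate hb, ← one_div_div _ (recSeq b 0 1 (n + 1) : ℚ),
      recSeq_add_two]
    congr 1
    push_cast
    field_simp
    ring

lemma negConv_num_den (n : ℕ) : (negConv b n).num = recSeq b 0 1 n ∧
    ((negConv b n).den : ℤ) = recSeq b 0 1 (n + 1) + recSeq b 0 1 n := by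
  have hmono := recSeq_nonneg_and_lt_succ (b := b) (by exact_mod_cast hb) n
  have hpos : 0 < recSeq b 0 1 (n + 1) + recSeq b 0 1 n := by omega
  have hcop : (recSeq b 0 1 n).natAbs.Coprime (recSeq b 0 1 (n + 1) + recSeq b 0 1 n).natAbs := by
    refine Int.isCoprime_iff_gcd_eq_one.1 ?_
    simpa only [mul_one] using (recSeq_isCoprime_succ b n).add_mul_left_right 1
  rw [negConv_eq hb]
  exact ⟨Rat.num_div_eq_of_coprime hpos hcop, Rat.den_div_eq_of_coprime hpos hcop⟩

lemma pSeq_div_qSeq_even (n : ℕ) :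
    (pSeq b (2 * n) : ℚ) / (qSeq b (2 * n) : ℚ) = negConv b n := by
  rw [negConv_eq hb, pSeq_two_mul, qSeq_two_mul]

lemma pSeq_div_qSeq_odd (n : ℕ) : (pSeq b (2 * n + 1) : ℚ) / (qSeq b (2 * n + 1) : ℚ) =
    ((negConv b n).num + (negConv b (n + 1)).num : ℚ) /
      ((negConv b n).den + (negConv b (n + 1)).den : ℚ) := by
  obtain ⟨hnum, hden⟩ := negConv_num_den hb n
  obtain ⟨hnum', hden'⟩ := negConv_num_den hb (n + 1)
  rw [pSeq_two_mul_add_one, qSeq_two_mul_add_one, hnum, hnum', ← hden, ← hden']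
  push_cast
  rfl

end Convergents

section Limit

variable {α β : ℝ} (hβ₀ : 0 < β) (hβ₁ : β < 1) (hprod : α * β = 1) {b : ℕ} (hsum : α + β = b)
include hprod hsum

lemma sub_mul_recSeq (n : ℕ) : (α - β) * recSeq b 0 1 n = α ^ n * (1 - β ^ (2 * n)) := by
  have hbinet : (α - β) * recSeq b 0 1 n = α ^ n - β ^ n := by
    induction n using Nat.twoStepInduction with
    | zero => simp [recSeq]
    | one => simp [recSeq]
    | more n ih₀ ih₁ =>
      rw [recSeq]
      push_cast
      rw [← hsum]
      linear_combination (α + β) * ih₁ - ih₀ + (α ^ n - β ^ n) * hprod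
  have hpow : α ^ n * β ^ n = 1 := by rw [← mul_pow, hprod, one_pow]
  rw [hbinet, two_mul, pow_add]
  linear_combination β ^ n * hpow

lemma sub_mul_recSeq_add_succ (n : ℕ) : (α - β) * (recSeq b 0 1 n + recSeq b 0 1 (n + 1)) =
    α ^ n * (1 + α) * (1 - β ^ (2 * n + 1)) := by
  rw [mul_add, sub_mul_recSeq hprod hsum, sub_mul_recSeq hprod hsum, mul_add, pow_add, pow_add,
    pow_add]
  linear_combination α ^ n * β ^ (2 * n) * (1 - β) * hprod

include hβ₀ hβ₁

lemma two_le_trace : 2 ≤ b := by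
  have := one_lt_of_conj hβ₀ hβ₁ hprod
  have : (2 : ℝ) ≤ b := by nlinarith
  exact_mod_cast this

lemma pSeq_div_qSeq (n : ℕ) : (pSeq b n : ℝ) / (qSeq b n : ℝ) =
    (1 - β ^ n) / ((1 + α) * (1 - β ^ (n + 1))) := by
  have hα := one_lt_of_conj hβ₀ hβ₁ hprod
  have hα₁ : 1 + α ≠ 0 := by linarith
  have hαpow (m : ℕ) : α ^ m ≠ 0 := pow_ne_zero m (by linarith)
  rw [← mul_div_mul_left _ _ (sub_conj_pos hβ₀ hβ₁ hprod).ne']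
  rcases Nat.even_or_odd' n with ⟨m, rfl | rfl⟩
  · rw [pSeq_two_mul, qSeq_two_mul, add_comm (recSeq _ _ _ _), Int.cast_add,
      sub_mul_recSeq hprod hsum, sub_mul_recSeq_add_succ hprod hsum, mul_assoc,
      mul_div_mul_left _ _ (hαpow m)]
  · have hq : (α - β) * qSeq b (2 * m + 1) =
        α ^ m * (1 + α) * ((1 + α) * (1 - β ^ (2 * m + 1 + 1))) := by
      rw [qSeq_two_mul_add_one, add_comm (recSeq _ _ _ (m + 1)),
        add_comm (recSeq _ _ _ (m + 2)), Int.cast_add, mul_add, Int.cast_add, Int.cast_add,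
        sub_mul_recSeq_add_succ hprod hsum, sub_mul_recSeq_add_succ hprod hsum]
      linear_combination α ^ m * (1 + α) * β ^ (2 * m + 1) * (1 - β) * hprod
    rw [hq, pSeq_two_mul_add_one, Int.cast_add, sub_mul_recSeq_add_succ hprod hsum,
      mul_div_mul_left _ _ (mul_ne_zero (hαpow m) hα₁)]

lemma pSeq_div_qSeq_eq_christoffelValue (n : ℕ) :
    (pSeq b n : ℝ) / (qSeq b n : ℝ) = christoffelValue β (n + 1) / (α - β) := by
  have hne : 1 - β ^ (n + 1) ≠ 0 := (sub_pos.2 (pow_lt_one₀ hβ₀.le hβ₁ (by omega))).ne'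
  rw [pSeq_div_qSeq hβ₀ hβ₁ hprod hsum, christoffelValue, Nat.add_sub_cancel, mul_div_right_comm,
    conj_div_eq hβ₀ hβ₁ hprod]
  field_simp
  ring

lemma strictMono_pSeq_div_qSeq : StrictMono fun n : ℕ => (pSeq b n : ℝ) / (qSeq b n : ℝ) := by
  have hα := one_lt_of_conj hβ₀ hβ₁ hprod
  refine strictMono_nat_of_lt_succ fun n => ?_
  have hpow : ∀ n : ℕ, 0 < 1 - β ^ (n + 1) := fun n =>
    sub_pos.2 (pow_lt_one₀ hβ₀.le hβ₁ (by omega))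
  rw [pSeq_div_qSeq hβ₀ hβ₁ hprod hsum, pSeq_div_qSeq hβ₀ hβ₁ hprod hsum, div_lt_div_iff₀
    (mul_pos (by linarith) (hpow n)) (mul_pos (by linarith) (hpow (n + 1)))]
  have hgap : 0 < (1 + α) * (β ^ n * (1 - β) ^ 2) :=
    mul_pos (by linarith) (mul_pos (pow_pos hβ₀ n) (pow_pos (by linarith) 2))
  linear_combination hgap

lemma tendsto_pSeq_div_qSeq :
    Tendsto (fun n : ℕ => (pSeq b n : ℝ) / (qSeq b n : ℝ)) atTop (𝓝 (1 / (1 + α))) := by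
  have hα := one_lt_of_conj hβ₀ hβ₁ hprod
  have hlim := tendsto_pow_atTop_nhds_zero_of_lt_one hβ₀.le hβ₁
  have hquot := (hlim.const_sub 1).div
    (((hlim.comp (tendsto_add_atTop_nat 1)).const_sub 1).const_mul (1 + α)) (by simp; linarith)
  simpa [Pi.div_def, pSeq_div_qSeq hβ₀ hβ₁ hprod hsum] using hquot

lemma tendsto_negConv : Tendsto (fun n : ℕ => (negConv b n : ℝ)) atTop (𝓝 (1 / (1 + α))) := by
  refine ((tendsto_pSeq_div_qSeq hβ₀ hβ₁ hprod hsum).comp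
    (tendsto_id.const_mul_atTop' two_pos)).congr fun n => ?_
  rw [← pSeq_div_qSeq_even (two_le_trace hβ₀ hβ₁ hprod hsum)]
  simp

end Limit

/-! ### Eventually periodic words -/

lemma eq_add_mul_of_forall_succ_sub_eq {f : ℤ → ℤ} {c : ℤ} (h : ∀ n, f (n + 1) - f n = c) (n : ℤ) :
    f n = f 0 + n * c := by
  induction n using Int.induction_on with
  | zero => simp
  | succ k ih => linarith [h k]
  | pred k ih =>
    have := h (-k - 1)
    rw [sub_add_cancel] at this
    linarith

lemma exists_sub_eq_add_mul_of_periodic {S t : ℤ → ℤ}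
    (htS : ∀ n, t n = S (n + 1) - 2 * S n + S (n - 1)) {T : ℤ} (hT : t.Periodic T) :
    ∃ c, ∀ n, S (n + T) - S n = S (0 + T) - S 0 + n * c := by
  have hconst : ∀ n, (S (n + 1 + 1 + T) - S (n + 1 + 1) - (S (n + 1 + T) - S (n + 1))) -
      (S (n + 1 + T) - S (n + 1) - (S (n + T) - S n)) = 0 := fun n => by
    have := hT (n + 1)
    rw [htS, htS, add_sub_cancel_right, add_right_comm (n + 1) T,
      show n + 1 + T - 1 = n + T by ring] at this
    linarith
  refine ⟨S (0 + 1 + T) - S (0 + 1) - (S (0 + T) - S 0),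
    eq_add_mul_of_forall_succ_sub_eq (f := fun n => S (n + T) - S n) fun n => ?_⟩
  simpa using eq_add_mul_of_forall_succ_sub_eq
    (f := fun n => S (n + 1 + T) - S (n + 1) - (S (n + T) - S n)) hconst n

lemma BalancedPrimitive.sub_eq_of_periodic {S t : ℤ → ℤ} (hS : BalancedPrimitive S)
    (htS : ∀ n, t n = S (n + 1) - 2 * S n + S (n - 1)) {T : ℤ} (hT₀ : 0 ≤ T) (hT : t.Periodic T)
    (n : ℤ) : S (n + T) - S n = S (0 + T) - S 0 := by
  obtain ⟨c, hc⟩ := exists_sub_eq_add_mul_of_periodic htS hT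
  have : c = 0 := by
    have := hc 2
    have := hS T 2 0 hT₀
    have := hS T 0 2 hT₀
    omega
  rw [hc n, this, mul_zero, add_zero]

lemma BalancedPrimitive.second_diff_eq_zero_of_periodic {S t : ℤ → ℤ} (hS : BalancedPrimitive S)
    (htS : ∀ n, t n = S (n + 1) - 2 * S n + S (n - 1)) {T : ℤ} (hT₀ : 0 ≤ T) (hT : t.Periodic T)
    (n : ℤ) {i : ℤ} (hi : T ∣ i) : S (n + i) - 2 * S n + S (n - i) = 0 := by
  obtain ⟨k, rfl⟩ := hi
  have hmul : ∀ k, S (n + T * k) = S n + k * (S (0 + T) - S 0) := fun k => by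
    have := eq_add_mul_of_forall_succ_sub_eq (f := fun k => S (n + T * k))
      (fun k => by
        rw [mul_add_one, ← add_assoc, hS.sub_eq_of_periodic htS hT₀ hT (n + T * k)]) k
    simpa using this
  have hneg := hmul (-k)
  rw [mul_neg, ← sub_eq_add_neg] at hneg
  rw [hmul, hneg]
  ring

lemma EventuallyPeriodic.exists_periodic_isLimitWord {s : ℕ → ℤ} (hs : EventuallyPeriodic s) :
    ∃ T : ℕ, 1 ≤ T ∧ ∀ t, IsLimitWord (padZero s) t → t.Periodic T := by
  obtain ⟨N, T, hT, hper⟩ := hs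
  have hpad : ∀ᶠ m : ℤ in atTop, padZero s (m + T) = padZero s m := by
    rw [eventually_padZero_iff (Q := fun m z => padZero s (m + T) = z)]
    filter_upwards [eventually_ge_atTop N] with m hm
    rw [← hper m hm, ← padZero_succ s (m + T), Nat.cast_add, add_right_comm]
  refine ⟨T, hT, fun t ⟨U, hU, hUt⟩ n => ?_⟩
  have hshift : ∀ᶠ m in U, padZero s (m + n + T) = padZero s (m + n) :=
    hU <| (tendsto_atTop_add_const_right atTop n tendsto_id).eventually hpad
  obtain ⟨m, hn, hnT, hm⟩ := ((hUt n).and ((hUt (n + T)).and hshift)).exists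
  rw [← hn, ← hnT, ← hm, add_assoc]

lemma limsupGreenSum_lt_of_eventuallyPeriodic {β : ℝ} (hβ₀ : 0 < β) (hβ : β < 1 / 3) {s : ℕ → ℤ}
    (hs : ∀ᶠ n in atTop, |s n| ≤ 1) (h : limsupGreenSum β (padZero s) ≤ 1 - β)
    (hper : EventuallyPeriodic s) : limsupGreenSum β (padZero s) < 1 - β := by
  have hβ₁ : β < 1 := by linarith
  have hbdd := boundedWord_padZero hs
  have hs' : ∀ᶠ n : ℤ in atTop, |padZero s n| ≤ 1 :=
    eventually_padZero_iff (Q := fun _ z => |z| ≤ 1).2 hs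
  obtain ⟨T, hT, hperiodic⟩ := hper.exists_periodic_isLimitWord
  refine lt_of_le_of_lt ((limsupGreenSum_le_iff hβ₀.le hβ₁ hbdd).2 fun t ht j => ?_)
    (christoffelValue_lt hβ₀ hβ₁ hT)
  obtain ⟨S, hS, -, htS⟩ := exists_balancedPrimitive_of_isLimitWord hβ₀ hβ hbdd hs' h ht
  exact hS.abs_greenSum_le_christoffelValue hβ₀.le hβ₁ htS hT j fun i hi =>
    hS.second_diff_eq_zero_of_periodic htS T.cast_nonneg (hperiodic t ht) j
      (Int.natCast_dvd_natCast.2 hi)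

lemma eventuallyPeriodic_of_eventually_mechWord {p q : ℕ} (hq : 1 ≤ q) {a : ℤ} {s : ℕ → ℤ}
    (h : ∀ᶠ n in atTop, padZero s n = mechWord p q a n) : EventuallyPeriodic s := by
  rw [eventually_padZero_iff (Q := fun n z => z = mechWord p q a n)] at h
  obtain ⟨N, hN⟩ := eventually_atTop.1 h
  refine ⟨N, q, hq, fun n hn => ?_⟩
  rw [hN n hn, hN (n + q) (by omega), ← mechWord_add_period hq a (n + 1) 1, Nat.cast_add, one_mul,
    add_right_comm]

/-! ### Level sets -/

lemma mechWord_add (p q : ℕ) (a k n : ℤ) :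
    mechWord p q a (k + n) = mechWord p q (a + k * p) n := by
  have hshift : ∀ m : ℤ, (k + m) * p + a = m * p + (a + k * p) := fun m => by ring
  rw [mechWord, mechWord, hshift, add_assoc, hshift, add_sub_assoc, hshift]

lemma nint_neg (x : ℝ) : nint (-x) = nint x := by
  rw [nint, nint, ← UnitAddCircle.norm_eq, ← UnitAddCircle.norm_eq, AddCircle.coe_neg, norm_neg]

lemma limsupDist_neg (α ξ : ℝ) : limsupDist α (-ξ) = limsupDist α ξ := by
  simp only [limsupDist, neg_mul, nint_neg]

section BaseSet

variable {α β x : ℝ}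

lemma neg_mem_baseSet (hx : x ∈ baseSet α β) : -x ∈ baseSet α β := by
  obtain ⟨z, hz, rfl⟩ := hx
  exact ⟨-z, neg_mem hz, (neg_div _ _).symm⟩

lemma add_mem_baseSet {y : ℝ} (hx : x ∈ baseSet α β) (hy : y ∈ baseSet α β) :
    x + y ∈ baseSet α β := by
  obtain ⟨z, hz, rfl⟩ := hx
  obtain ⟨w, hw, rfl⟩ := hy
  exact ⟨z + w, add_mem hz hw, (add_div _ _ _).symm⟩

lemma mem_of_mem_baseSet {K : Subfield ℝ} (hα : α ∈ K) (hβ : β ∈ K) (hx : x ∈ baseSet α β) :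
    x ∈ K := by
  obtain ⟨z, hz, rfl⟩ := hx
  have hle : Algebra.adjoin ℤ {α} ≤ subalgebraOfSubring K.toSubring :=
    Algebra.adjoin_le (Set.singleton_subset_iff.2 hα)
  exact div_mem (hle hz) (sub_mem hα hβ)

end BaseSet

section Realize

variable {α β : ℝ} (hβ₀ : 0 < β) (hβ₁ : β < 1) (hprod : α * β = 1)
include hβ₀ hβ₁ hprod

lemma realize_padZero_eq_sum_add {s : ℕ → ℤ} (hs : BoundedWord (padZero s)) (N : ℕ) :
    (α - β) * realize α β (padZero s) =
      ∑ i ∈ Finset.range N, (s i : ℝ) * β ^ (i + 1) + ∑' i, (s (i + N) : ℝ) * β ^ (i + N + 1) := by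
  have hsummable : Summable fun i : ℕ => (s i : ℝ) * β ^ (i + 1) := by
    refine ((hs.summable_comp hβ₀.le hβ₁ fun i => i + 1).mul_left β).congr fun i => ?_
    rw [padZero_succ]
    ring
  rw [hsummable.sum_add_tsum_nat_add N, realize_padZero hprod, rightSum,
    mul_div_cancel₀ _ (sub_conj_pos hβ₀ hβ₁ hprod).ne', ← tsum_mul_left]
  refine tsum_congr fun i => ?_
  rw [add_comm 1 (i : ℤ), padZero_succ]
  ring

lemma realize_padZero_of_periodic {s : ℕ → ℤ} (hs : BoundedWord (padZero s)) {T : ℕ} (hT : 1 ≤ T)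
    (hper : s.Periodic T) : realize α β (padZero s) =
      (∑ i ∈ Finset.range T, (s i : ℝ) * β ^ (i + 1)) / ((α - β) * (1 - β ^ T)) := by
  have hne : (α - β) * (1 - β ^ T) ≠ 0 := mul_ne_zero (sub_conj_pos hβ₀ hβ₁ hprod).ne'
    (sub_pos.2 (pow_lt_one₀ hβ₀.le hβ₁ (by omega))).ne'
  have hsplit := realize_padZero_eq_sum_add hβ₀ hβ₁ hprod hs T
  have hwhole := realize_padZero_eq_sum_add hβ₀ hβ₁ hprod hs 0
  simp only [Finset.range_zero, Finset.sum_empty, zero_add, add_zero] at hwhole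
  have htail : ∑' i, (s (i + T) : ℝ) * β ^ (i + T + 1) = β ^ T * ∑' i, (s i : ℝ) * β ^ (i + 1) := by
    rw [← tsum_mul_left]
    refine tsum_congr fun i => ?_
    rw [hper]
    ring
  rw [htail, ← hwhole] at hsplit
  rw [eq_div_iff hne]
  linear_combination hsplit

lemma exists_realize_eq_add_of_eventually_eq {b : ℕ} (hsum : α + β = b) {s s' : ℕ → ℤ}
    (hs : BoundedWord (padZero s)) (hs' : BoundedWord (padZero s'))
    (h : ∀ᶠ n in atTop, s n = s' n) :
    ∃ x ∈ baseSet α β, realize α β (padZero s) = realize α β (padZero s') + x := by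
  obtain ⟨N, hN⟩ := eventually_atTop.1 h
  have hsplit := realize_padZero_eq_sum_add hβ₀ hβ₁ hprod hs N
  have hsplit' := realize_padZero_eq_sum_add hβ₀ hβ₁ hprod hs' N
  have htail : ∑' i, (s (i + N) : ℝ) * β ^ (i + N + 1) =
      ∑' i, (s' (i + N) : ℝ) * β ^ (i + N + 1) :=
    tsum_congr fun i => by rw [hN _ (by omega)]
  have hβmem : β ∈ Algebra.adjoin ℤ {α} := by
    rw [eq_sub_of_add_eq' hsum]
    exact sub_mem (natCast_mem _ _) (Algebra.self_mem_adjoin_singleton ℤ α)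
  refine ⟨_, ⟨∑ i ∈ Finset.range N, ((s i - s' i : ℤ) : ℝ) * β ^ (i + 1),
    sum_mem fun i _ => mul_mem (intCast_mem _ _) (pow_mem hβmem _), rfl⟩, ?_⟩
  rw [← sub_eq_iff_eq_add', eq_div_iff (sub_conj_pos hβ₀ hβ₁ hprod).ne']
  push_cast
  simp only [sub_mul, Finset.sum_sub_distrib]
  linear_combination hsplit - hsplit' + htail

end Realize

section LevelSet

variable {α β : ℝ} (hβ₀ : 0 < β) (hβ₁ : β < 1) (hprod : α * β = 1) {b : ℕ} (hsum : α + β = b)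
include hβ₀ hβ₁ hprod

lemma one_sub_conj_lt : 1 - β < (α - β) / 2 := by
  have := one_lt_of_conj hβ₀ hβ₁ hprod
  nlinarith

lemma realize_gamSeq_periodicWord_mem {K : Subfield ℝ} (hα : α ∈ K) (hβ : β ∈ K) {ν : List Bool}
    (hν : IsChristoffel ν) (k : ℕ) :
    realize α β (padZero fun i => gamSeq (periodicWord ν) (k + i)) ∈ K := by
  obtain ⟨p, q, e, hq, -, -, hmech⟩ := hν.exists_mechWord
  obtain ⟨B, hB⟩ := boundedWord_mechWord (p := p) hq e
  have hs : BoundedWord (padZero fun i => gamSeq (periodicWord ν) (k + i)) :=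
    boundedWord_padZero (B := B) (Eventually.of_forall fun m => by rw [hmech]; exact hB _)
  have hper : (fun i => gamSeq (periodicWord ν) (k + i)).Periodic q := fun m => by
    beta_reduce
    rw [hmech, hmech, ← mechWord_add_period hq e ((k + m : ℕ) + 1) 1]
    push_cast
    ring_nf
  rw [realize_padZero_of_periodic hβ₀ hβ₁ hprod hs hq hper]
  exact div_mem (sum_mem fun i _ => mul_mem (intCast_mem _ _) (pow_mem hβ _))
    (mul_mem (sub_mem hα hβ) (sub_mem (one_mem _) (pow_mem hβ _)))

include hsum

lemma limsupDist_of_eventually_eq_mechWord {p q : ℕ} (hq : 1 ≤ q) (hpq : p.Coprime q) {a : ℤ}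
    {s : ℕ → ℤ} (h : ∀ᶠ n in atTop, padZero s n = mechWord p q a n) {x : ℝ}
    (hx : x ∈ baseSet α β) :
    limsupDist α (realize α β (padZero s) + x) = christoffelValue β q / (α - β) := by
  have hmech := boundedWord_mechWord (p := p) hq a
  have hs : BoundedWord (padZero s) := by
    obtain ⟨B, hB⟩ := hmech
    refine boundedWord_padZero (B := B) ?_
    rw [← eventually_padZero_iff (Q := fun _ z => |z| ≤ B)]
    filter_upwards [h] with n hn
    exact hn ▸ hB n
  have hlim : limsupGreenSum β (padZero s) = christoffelValue β q := by
    rw [limsupGreenSum_congr hβ₀.le hβ₁ hs hmech h, limsupGreenSum_mechWord hβ₀.le hβ₁ hq hpq]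
  have hlt : limsupGreenSum β (padZero s) < (α - β) / 2 :=
    hlim.trans_lt ((christoffelValue_lt hβ₀ hβ₁ hq).trans (one_sub_conj_lt hβ₀ hβ₁ hprod))
  rw [limsupDist_realize_add hβ₀ hβ₁ hprod hsum hs hlt hx, hlim]

lemma IsChristoffel.limsupDist_eq {ν : List Bool} (hν : IsChristoffel ν) {n : ℕ}
    (hn : (gam ν).length = n + 1) (k : ℕ) {x : ℝ} (hx : x ∈ baseSet α β) :
    limsupDist α (realize α β (padZero fun i => gamSeq (periodicWord ν) (k + i)) + x) =
      pSeq b n / qSeq b n := by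
  obtain ⟨p, q, e, hq, hpq, hlen, hmech⟩ := hν.exists_mechWord
  obtain rfl : q = n + 1 := by omega
  rw [pSeq_div_qSeq_eq_christoffelValue hβ₀ hβ₁ hprod hsum]
  refine limsupDist_of_eventually_eq_mechWord hβ₀ hβ₁ hprod hsum hq hpq (a := e + k * p) ?_ hx
  rw [eventually_padZero_iff (Q := fun m z => z = mechWord p (n + 1) (e + k * p) m)]
  refine Eventually.of_forall fun m => ?_
  rw [hmech, ← mechWord_add, Nat.cast_add, add_assoc]

lemma exists_word_of_limsupDist_le {ξ : ℝ} (h : limsupDist α ξ ≤ 1 / (1 + α)) :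
    ∃ s : ℕ → ℤ, ∃ x ∈ baseSet α β, (∀ᶠ n in atTop, |s n| ≤ 1) ∧
      ξ = realize α β (padZero s) + x ∧
      limsupDist α ξ = limsupGreenSum β (padZero s) / (α - β) ∧
      limsupGreenSum β (padZero s) ≤ 1 - β := by
  obtain ⟨s, x, hx, -, hξ, hlim, hone⟩ := exists_eq_realize_add hβ₀ hβ₁ hprod hsum ξ
  refine ⟨s, x, hx, hone h, hξ, hlim, ?_⟩
  rwa [hlim, ← conj_div_eq hβ₀ hβ₁ hprod,
    div_le_div_iff_of_pos_right (sub_conj_pos hβ₀ hβ₁ hprod)] at h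

lemma pSeq_div_qSeq_lt (n : ℕ) : (pSeq b n : ℝ) / (qSeq b n : ℝ) < 1 / (1 + α) :=
  have hmono := strictMono_pSeq_div_qSeq hβ₀ hβ₁ hprod hsum
  (hmono n.lt_succ_self).trans_le
    (hmono.monotone.ge_of_tendsto (tendsto_pSeq_div_qSeq hβ₀ hβ₁ hprod hsum) _)

lemma christoffelSet_subset_levelSet (n : ℕ) :
    christoffelSet α β n ⊆ levelSet α ((pSeq b n : ℝ) / (qSeq b n : ℝ)) := by
  rintro ξ ⟨ν, hν, hlen, k, -, x, hx, rfl | rfl⟩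
  · exact hν.limsupDist_eq hβ₀ hβ₁ hprod hsum hlen k hx
  · have := hν.limsupDist_eq hβ₀ hβ₁ hprod hsum hlen k (neg_mem_baseSet hx)
    rwa [← limsupDist_neg, neg_add, neg_neg] at this

lemma christoffelSet_subset_adjoin (n : ℕ) :
    christoffelSet α β n ⊆ (IntermediateField.adjoin ℚ ({α} : Set ℝ) : Set ℝ) := by
  set K := (IntermediateField.adjoin ℚ ({α} : Set ℝ)).toSubfield
  have hα : α ∈ K := IntermediateField.mem_adjoin_simple_self ℚ α
  have hβ : β ∈ K := by
    rw [eq_sub_of_add_eq' hsum]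
    exact sub_mem (natCast_mem _ _) hα
  rintro ξ ⟨ν, hν, -, k, -, x, hx, rfl | rfl⟩
  · exact add_mem (realize_gamSeq_periodicWord_mem hβ₀ hβ₁ hprod hα hβ hν k)
      (mem_of_mem_baseSet hα hβ hx)
  · exact add_mem (neg_mem (realize_gamSeq_periodicWord_mem hβ₀ hβ₁ hprod hα hβ hν k))
      (mem_of_mem_baseSet hα hβ hx)

end LevelSet

section Markoff

variable {α β : ℝ} (hβ₀ : 0 < β) (hβ : β < 1 / 3) (hprod : α * β = 1) {b : ℕ} (hsum : α + β = b)
include hβ₀ hβ hprod hsum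

lemma exists_mem_christoffelSet_of_limsupDist_lt {ξ : ℝ} (h : limsupDist α ξ < 1 / (1 + α)) :
    ∃ n, limsupDist α ξ = pSeq b n / qSeq b n ∧ ξ ∈ christoffelSet α β n := by
  have hβ₁ : β < 1 := by linarith
  obtain ⟨s, x, hx, hone, rfl, hlim, -⟩ := exists_word_of_limsupDist_le hβ₀ hβ₁ hprod hsum h.le
  have hs := boundedWord_padZero hone
  rw [hlim, ← conj_div_eq hβ₀ hβ₁ hprod,
    div_lt_div_iff_of_pos_right (sub_conj_pos hβ₀ hβ₁ hprod)] at h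
  obtain ⟨p, q, a, hq, hpq, hcop, hmech⟩ := eventually_eq_mechWord_of_limsupGreenSum_lt hβ₀ hβ hs
    (eventually_padZero_iff (Q := fun _ z => |z| ≤ 1).2 hone) h
  obtain ⟨n, rfl⟩ : ∃ n, q = n + 1 := ⟨q - 1, by omega⟩
  refine ⟨n, by rw [limsupDist_of_eventually_eq_mechWord hβ₀ hβ₁ hprod hsum hq hcop hmech hx,
    pSeq_div_qSeq_eq_christoffelValue hβ₀ hβ₁ hprod hsum], ?_⟩
  obtain ⟨ν, σ, k, hν, hlen, hk, hσ, hgam⟩ := exists_isChristoffel_eq_mechWord hq hpq hcop a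
  rw [eventually_padZero_iff (Q := fun m z => z = mechWord p (n + 1) a m)] at hmech
  have hs' : ∀ᶠ m in atTop, s m = σ * gamSeq (periodicWord ν) (k + m) :=
    hmech.mono fun m hm => by rw [hm, hgam]
  obtain ⟨y, hy, hrealize⟩ := exists_realize_eq_add_of_eventually_eq hβ₀ hβ₁ hprod hsum hs
    (boundedWord_padZero (B := 1) ((hs'.and hone).mono fun m hm => hm.1 ▸ hm.2)) hs'
  refine ⟨ν, hν, hlen, k, by omega, y + x, add_mem_baseSet hy hx, ?_⟩
  rw [hrealize, realize_padZero_mul α β (fun i => gamSeq (periodicWord ν) (k + i)), add_assoc]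
  rcases hσ with rfl | rfl
  · left; simp
  · right; simp

theorem levelSet_eq_christoffelSet (n : ℕ) :
    levelSet α ((pSeq b n : ℝ) / (qSeq b n : ℝ)) = christoffelSet α β n := by
  have hβ₁ : β < 1 := by linarith
  refine Set.Subset.antisymm (fun ξ (hξ : limsupDist α ξ = _) => ?_)
    (christoffelSet_subset_levelSet hβ₀ hβ₁ hprod hsum n)
  obtain ⟨m, hm, hmem⟩ := exists_mem_christoffelSet_of_limsupDist_lt hβ₀ hβ hprod hsum
    (hξ.trans_lt (pSeq_div_qSeq_lt hβ₀ hβ₁ hprod hsum n))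
  obtain rfl : m = n :=
    (strictMono_pSeq_div_qSeq hβ₀ hβ₁ hprod hsum).injective (hm.symm.trans hξ)
  exact hmem

theorem levelSet_eq_signedEventuallyBalancedSet :
    levelSet α (1 / (1 + α)) = signedEventuallyBalancedSet α β := by
  have hβ₁ : β < 1 := by linarith
  ext ξ
  constructor
  · intro (hξ : limsupDist α ξ = 1 / (1 + α))
    obtain ⟨s, x, hx, hone, rfl, hlim, hle⟩ :=
      exists_word_of_limsupDist_le hβ₀ hβ₁ hprod hsum hξ.le
    refine ⟨s, eventuallyLocally_of_limsupGreenSum_le hβ₀ hβ hone hle, fun hper => ?_, x, hx, rfl⟩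
    rw [hlim, ← conj_div_eq hβ₀ hβ₁ hprod,
      div_left_inj' (sub_conj_pos hβ₀ hβ₁ hprod).ne'] at hξ
    exact (limsupGreenSum_lt_of_eventuallyPeriodic hβ₀ hβ hone hle hper).ne hξ
  · rintro ⟨s, hloc, hper, x, hx, rfl⟩
    have hone := eventually_abs_le_of_eventuallyLocally hloc
    have hs := boundedWord_padZero hone
    have hle := limsupGreenSum_le_of_eventuallyLocally hβ₀.le hβ₁ hs hloc
    have heq : limsupGreenSum β (padZero s) = 1 - β := by
      refine hle.eq_of_not_lt fun hlt => hper ?_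
      obtain ⟨p, q, a, hq, -, -, hmech⟩ := eventually_eq_mechWord_of_limsupGreenSum_lt hβ₀ hβ hs
        (eventually_padZero_iff (Q := fun _ z => |z| ≤ 1).2 hone) hlt
      exact eventuallyPeriodic_of_eventually_mechWord hq hmech
    change limsupDist α _ = _
    rw [limsupDist_realize_add hβ₀ hβ₁ hprod hsum hs
      (hle.trans_lt (one_sub_conj_lt hβ₀ hβ₁ hprod)) hx, heq, conj_div_eq hβ₀ hβ₁ hprod]

lemma eventuallyBalancedSet_subset :
    eventuallyBalancedSet α β ⊆ levelSet α (1 / (1 + α)) := by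
  rw [levelSet_eq_signedEventuallyBalancedSet hβ₀ hβ hprod hsum]
  rintro ξ ⟨y, hy, hper, k, -, x, hx, h⟩
  obtain ⟨σ, hσ, rfl⟩ : ∃ σ : ℤ, (σ = 1 ∨ σ = -1) ∧
      ξ = σ * realize α β (padZero fun i => gamSeq y (k + i)) + x := by
    rcases h with rfl | rfl
    · exact ⟨1, Or.inl rfl, by simp⟩
    · exact ⟨-1, Or.inr rfl, by simp⟩
  exact ⟨_, eventuallyLocally_gamSeq hy k hσ, not_eventuallyPeriodic_gamSeq hper k hσ, x, hx,
    by rw [realize_padZero_mul α β (fun i => gamSeq y (k + i))]⟩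

end Markoff

/-! ### Uncountability at the critical value -/

/-- The Sturmian word of slope `θ`, coded over `{0,1,-1}`: it is the second difference of
`n ↦ ⌊nθ⌋`. For irrational `θ` it realizes the critical value. -/
noncomputable def rotationWord (θ : ℝ) (n : ℤ) : ℤ :=
  ⌊((n + 1 : ℤ) : ℝ) * θ⌋ - 2 * ⌊(n : ℝ) * θ⌋ + ⌊((n - 1 : ℤ) : ℝ) * θ⌋

lemma balancedPrimitive_floor (θ : ℝ) : BalancedPrimitive fun n => ⌊(n : ℝ) * θ⌋ := by
  intro l i j _
  rw [← Int.lt_add_one_iff, ← Int.cast_lt (R := ℝ)]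
  push_cast
  linarith [Int.floor_le (((i : ℝ) + l) * θ), Int.lt_floor_add_one ((i : ℝ) * θ),
    Int.lt_floor_add_one (((j : ℝ) + l) * θ), Int.floor_le ((j : ℝ) * θ)]

lemma boundedWord_rotationWord (θ : ℝ) : BoundedWord (rotationWord θ) :=
  (balancedPrimitive_floor θ).boundedWord fun _ => rfl

lemma eventually_padZero_rotationWord_eq (θ : ℝ) :
    ∀ᶠ n in atTop, padZero (fun n : ℕ => rotationWord θ (n + 1)) n = rotationWord θ n :=
  (eventually_padZero_iff (Q := fun n z => z = rotationWord θ n)).2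
    (Eventually.of_forall fun _ => rfl)

lemma boundedWord_padZero_rotationWord (θ : ℝ) :
    BoundedWord (padZero fun n : ℕ => rotationWord θ (n + 1)) := by
  obtain ⟨B, hB⟩ := boundedWord_rotationWord θ
  exact boundedWord_padZero (B := B) (Eventually.of_forall fun n => hB _)

section FloorSeries

variable {β : ℝ}

lemma summable_floor_mul_pow (hβ₀ : 0 ≤ β) (hβ₁ : β < 1) (θ : ℝ) :
    Summable fun n : ℕ => (⌊(n : ℝ) * θ⌋ : ℝ) * β ^ n := by
  have hβ : ‖β‖ < 1 := by rwa [Real.norm_of_nonneg hβ₀]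
  have hmajorant : Summable fun n : ℕ => (|θ| * n + 1) * β ^ n := by
    simpa [add_mul, mul_assoc] using
      ((summable_pow_mul_geometric_of_norm_lt_one 1 hβ).mul_left |θ|).add
        (summable_geometric_of_norm_lt_one hβ)
  refine hmajorant.of_norm_bounded fun n => ?_
  rw [norm_mul, norm_pow, Real.norm_of_nonneg hβ₀, Real.norm_eq_abs]
  gcongr
  have habs : |(n : ℝ) * θ| = |θ| * n := by rw [abs_mul, Nat.abs_cast, mul_comm]
  rw [abs_le]
  constructor <;> linarith [Int.floor_le ((n : ℝ) * θ), Int.lt_floor_add_one ((n : ℝ) * θ),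
    neg_abs_le ((n : ℝ) * θ), le_abs_self ((n : ℝ) * θ)]

lemma strictMono_tsum_floor_mul_pow (hβ₀ : 0 < β) (hβ₁ : β < 1) :
    StrictMono fun θ : ℝ => ∑' n : ℕ, (⌊(n : ℝ) * θ⌋ : ℝ) * β ^ n := by
  intro θ θ' hlt
  obtain ⟨N, hN⟩ := exists_nat_gt (1 / (θ' - θ))
  rw [div_lt_iff₀ (sub_pos.2 hlt)] at hN
  refine Summable.tsum_lt_tsum (i := N) (fun n => ?_) ?_ (summable_floor_mul_pow hβ₀.le hβ₁ θ)
    (summable_floor_mul_pow hβ₀.le hβ₁ θ')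
  · dsimp only
    gcongr
  · gcongr
    rw [← Int.cast_lt (R := ℝ)]
    linarith [Int.floor_le ((N : ℝ) * θ), Int.lt_floor_add_one ((N : ℝ) * θ')]

lemma sq_mul_tsum_second_diff {f : ℕ → ℝ} (hf : Summable fun n => f n * β ^ n) (hf₀ : f 0 = 0)
    (hf₁ : f 1 = 0) : β ^ 2 * ∑' n, (f (n + 2) - 2 * f (n + 1) + f n) * β ^ n =
      (1 - β) ^ 2 * ∑' n, f n * β ^ n := by
  have hsummable₁ := (summable_nat_add_iff 1).2 hf
  have hsummable₂ := (summable_nat_add_iff 2).2 hf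
  have hshift₁ := hf.sum_add_tsum_nat_add 1
  have hshift₂ := hf.sum_add_tsum_nat_add 2
  simp only [Finset.sum_range_succ, Finset.sum_range_zero, hf₀, hf₁, zero_mul, zero_add]
    at hshift₁ hshift₂
  calc β ^ 2 * ∑' n, (f (n + 2) - 2 * f (n + 1) + f n) * β ^ n
      = ∑' n, (f (n + 2) * β ^ (n + 2) - 2 * β * (f (n + 1) * β ^ (n + 1)) +
          β ^ 2 * (f n * β ^ n)) := by
        rw [← tsum_mul_left]
        exact tsum_congr fun n => by ring
    _ = (1 - β) ^ 2 * ∑' n, f n * β ^ n := by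
        rw [(hsummable₂.sub (hsummable₁.mul_left (2 * β))).tsum_add (hf.mul_left (β ^ 2)),
          hsummable₂.tsum_sub (hsummable₁.mul_left (2 * β)), tsum_mul_left, tsum_mul_left, hshift₁,
          hshift₂]
        ring

end FloorSeries

lemma countable_adjoin_simple_of_isIntegral {K L : Type*} [Field K] [Field L] [Algebra K L]
    [Countable K] {x : L} (hx : IsIntegral K x) :
    (IntermediateField.adjoin K ({x} : Set L) : Set L).Countable := by
  have := IntermediateField.isAlgebraic_adjoin_simple hx
  exact (Algebraic.countable K L).mono fun y hy =>
    (Algebra.IsAlgebraic.isAlgebraic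
      (⟨y, hy⟩ : IntermediateField.adjoin K ({x} : Set L))).algebraMap

lemma isIntegral_of_mul_eq_one {α β : ℝ} (hprod : α * β = 1) {b : ℕ} (hsum : α + β = b) :
    IsIntegral ℚ α := by
  refine ⟨.X ^ 2 - .C (b : ℚ) * .X + 1, by monicity!, ?_⟩
  simp only [Polynomial.eval₂_add, Polynomial.eval₂_sub, Polynomial.eval₂_pow,
    Polynomial.eval₂_mul, Polynomial.eval₂_X, Polynomial.eval₂_one, map_natCast,
    Polynomial.eval₂_natCast]
  rw [← hsum]
  linear_combination -hprod

section RealizeRotation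

variable {α β : ℝ} (hβ₀ : 0 < β) (hβ₁ : β < 1) (hprod : α * β = 1)
include hβ₀ hβ₁ hprod

lemma realize_rotationWord {θ : ℝ} (hθ : θ ∈ Set.Ico (0 : ℝ) 1) :
    realize α β (padZero fun n : ℕ => rotationWord θ (n + 1)) =
      (1 - β) ^ 2 / (β * (α - β)) * ∑' n : ℕ, (⌊(n : ℝ) * θ⌋ : ℝ) * β ^ n := by
  have hletter : ∀ n : ℕ, (padZero (fun n : ℕ => rotationWord θ (n + 1)) (1 + n) : ℝ) =
      ⌊((n + 2 : ℕ) : ℝ) * θ⌋ - 2 * ⌊((n + 1 : ℕ) : ℝ) * θ⌋ + ⌊(n : ℝ) * θ⌋ := fun n => by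
    rw [add_comm 1 (n : ℤ), padZero_succ, rotationWord]
    push_cast
    ring_nf
  have hdiff := sq_mul_tsum_second_diff (summable_floor_mul_pow hβ₀.le hβ₁ θ) (by simp)
    (by simpa using hθ)
  have hpos := sub_conj_pos hβ₀ hβ₁ hprod
  rw [realize_padZero hprod, rightSum]
  simp only [hletter]
  rw [div_mul_eq_mul_div, div_eq_div_iff hpos.ne' (mul_pos hβ₀ hpos).ne']
  linear_combination (α - β) * hdiff

lemma injOn_realize_rotationWord :
    Set.InjOn (fun θ => realize α β (padZero fun n : ℕ => rotationWord θ (n + 1)))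
      (Set.Ico 0 1) := by
  intro θ hθ θ' hθ' heq
  have hpos : 0 < (1 - β) ^ 2 / (β * (α - β)) :=
    div_pos (pow_pos (by linarith) 2) (mul_pos hβ₀ (sub_conj_pos hβ₀ hβ₁ hprod))
  beta_reduce at heq
  rw [realize_rotationWord hβ₀ hβ₁ hprod hθ, realize_rotationWord hβ₀ hβ₁ hprod hθ',
    mul_right_inj' hpos.ne'] at heq
  exact (strictMono_tsum_floor_mul_pow hβ₀ hβ₁).injective heq

lemma limsupDist_realize_rotationWord_le {b : ℕ} (hsum : α + β = b) (θ : ℝ) :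
    limsupDist α (realize α β (padZero fun n : ℕ => rotationWord θ (n + 1))) ≤ 1 / (1 + α) := by
  have hs := boundedWord_padZero_rotationWord θ
  have hle : limsupGreenSum β (padZero fun n : ℕ => rotationWord θ (n + 1)) ≤ 1 - β := by
    rw [limsupGreenSum_congr hβ₀.le hβ₁ hs (boundedWord_rotationWord θ)
      (eventually_padZero_rotationWord_eq θ)]
    exact limsup_le_of_le (isCobounded_abs_greenSum β _) (Eventually.of_forall fun n =>
      (balancedPrimitive_floor θ).abs_greenSum_le hβ₀.le hβ₁ (fun _ => rfl) n)
  have hlim := limsupDist_realize_add hβ₀ hβ₁ hprod hsum hs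
    (hle.trans_lt (one_sub_conj_lt hβ₀ hβ₁ hprod)) ⟨0, zero_mem _, (zero_div _).symm⟩
  rw [add_zero] at hlim
  rw [hlim, ← conj_div_eq hβ₀ hβ₁ hprod]
  exact div_le_div_of_nonneg_right hle (sub_conj_pos hβ₀ hβ₁ hprod).le

end RealizeRotation

theorem not_countable_levelSet {α β : ℝ} (hβ₀ : 0 < β) (hβ : β < 1 / 3) (hprod : α * β = 1) {b : ℕ}
    (hsum : α + β = b) : ¬ (levelSet α (1 / (1 + α))).Countable := by
  intro hcountable
  have hβ₁ : β < 1 := by linarith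
  have hfield := countable_adjoin_simple_of_isIntegral (isIntegral_of_mul_eq_one hprod hsum)
  have hmaps : Set.MapsTo (fun θ => realize α β (padZero fun n : ℕ => rotationWord θ (n + 1)))
      (Set.Ico 0 1) (levelSet α (1 / (1 + α)) ∪ IntermediateField.adjoin ℚ ({α} : Set ℝ)) := by
    intro θ _
    rcases (limsupDist_realize_rotationWord_le hβ₀ hβ₁ hprod hsum θ).eq_or_lt with heq | hlt
    · exact Or.inl heq
    · obtain ⟨n, -, hn⟩ := exists_mem_christoffelSet_of_limsupDist_lt hβ₀ hβ hprod hsum hlt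
      exact Or.inr (christoffelSet_subset_adjoin hβ₀ hβ₁ hprod hsum n hn)
  have hIco := hmaps.countable_of_injOn (injOn_realize_rotationWord hβ₀ hβ₁ hprod)
    (hcountable.union hfield)
  rw [← Cardinal.le_aleph0_iff_set_countable, Cardinal.mk_Ico_real zero_lt_one] at hIco
  exact hIco.not_gt Cardinal.aleph0_lt_continuum

/-! ### The spectrum -/

lemma isLeast_accPt_of_inter_Iic_eq {X : Type*} [TopologicalSpace X] [LinearOrder X]
    [OrderTopology X] {S : Set X} {f : ℕ → X} {L : X} (hf : StrictMono f)
    (hlim : Tendsto f atTop (𝓝 L)) (hS : S ∩ Set.Iic L = Set.range f ∪ {L}) :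
    IsLeast {t | AccPt t (𝓟 S)} L := by
  have hlt (n : ℕ) : f n < L :=
    (hf n.lt_succ_self).trans_le (hf.monotone.ge_of_tendsto hlim _)
  refine ⟨accPt_iff_frequently.2 (hlim.frequently (Frequently.of_forall fun n =>
    ⟨(hlt n).ne, (hS.ge (Or.inl ⟨n, rfl⟩)).1⟩)), fun t ht => ?_⟩
  by_contra! htL
  obtain ⟨N, hN⟩ := (hlim.eventually (eventually_gt_nhds htL)).exists
  have hsub : Set.Iio (f N) ∩ S ⊆ f '' Set.Iio N := by
    rintro y ⟨hyN, hyS⟩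
    rcases hS.le ⟨hyS, ((Set.mem_Iio.1 hyN).trans (hlt N)).le⟩ with ⟨n, rfl⟩ | rfl
    · exact ⟨n, hf.lt_iff_lt.1 hyN, rfl⟩
    · exact absurd (hlt N) (Set.mem_Iio.1 hyN).not_gt
  exact Set.Infinite.of_accPt (ht.nhds_inter (Iio_mem_nhds hN))
    (((Set.finite_Iio N).image f).subset hsub)

lemma pSeq_div_qSeq_mem_lagrangeSpectrum {α β : ℝ} (hβ₀ : 0 < β) (hβ₁ : β < 1) (hprod : α * β = 1)
    {b : ℕ} (hsum : α + β = b) (n : ℕ) :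
    (pSeq b n : ℝ) / (qSeq b n : ℝ) ∈ lagrangeSpectrum α := by
  have hword := (eventually_padZero_iff (s := fun m : ℕ => mechWord 1 (n + 1) 0 (m + 1))
    (Q := fun m z => z = mechWord 1 (n + 1) 0 m)).2 (Eventually.of_forall fun _ => rfl)
  rw [pSeq_div_qSeq_eq_christoffelValue hβ₀ hβ₁ hprod hsum]
  exact ⟨_, limsupDist_of_eventually_eq_mechWord hβ₀ hβ₁ hprod hsum (p := 1) (q := n + 1) (a := 0)
    (by omega) (Nat.coprime_one_left _) hword ⟨0, zero_mem _, (zero_div _).symm⟩⟩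

section Spectrum

variable {α β : ℝ} (hβ₀ : 0 < β) (hβ : β < 1 / 3) (hprod : α * β = 1) {b : ℕ} (hsum : α + β = b)

include hβ₀ hβ hprod hsum

theorem lagrangeSpectrum_inter_Iic :
    lagrangeSpectrum α ∩ Set.Iic (1 / (1 + α)) =
      Set.range (fun n : ℕ => (pSeq b n : ℝ) / (qSeq b n : ℝ)) ∪ {1 / (1 + α)} := by
  have hβ₁ : β < 1 := by linarith
  ext t
  constructor
  · rintro ⟨⟨ξ, rfl⟩, hle⟩
    rcases (Set.mem_Iic.1 hle).eq_or_lt with heq | hlt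
    · exact Or.inr heq
    · obtain ⟨n, hn, -⟩ := exists_mem_christoffelSet_of_limsupDist_lt hβ₀ hβ hprod hsum hlt
      exact Or.inl ⟨n, hn.symm⟩
  · rintro (⟨n, rfl⟩ | rfl)
    · exact ⟨pSeq_div_qSeq_mem_lagrangeSpectrum hβ₀ hβ₁ hprod hsum n,
        (pSeq_div_qSeq_lt hβ₀ hβ₁ hprod hsum n).le⟩
    · have hne : (levelSet α (1 / (1 + α))).Nonempty := Set.nonempty_iff_ne_empty.2 fun hempty =>
        not_countable_levelSet hβ₀ hβ hprod hsum (hempty ▸ Set.countable_empty)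
      exact ⟨hne, Set.self_mem_Iic⟩

theorem lagrangeSpectrum_inter_Icc :
    lagrangeSpectrum α ∩ Set.Icc 0 (1 / (1 + α)) =
      Set.range (fun n : ℕ => (pSeq b n : ℝ) / (qSeq b n : ℝ)) ∪ {1 / (1 + α)} := by
  have hnonneg : lagrangeSpectrum α ⊆ Set.Ici 0 :=
    Set.range_subset_iff.2 fun ξ => limsupDist_nonneg α ξ
  rw [← Set.Ici_inter_Iic, ← Set.inter_assoc, Set.inter_eq_left.2 hnonneg,
    lagrangeSpectrum_inter_Iic hβ₀ hβ hprod hsum]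

end Spectrum

section Conjugate

variable {α β : ℝ} (hα : 3 < α) (hprod : α * β = 1)

include hα hprod

lemma conj_pos : 0 < β :=
  (mul_pos_iff_of_pos_left (by linarith : 0 < α)).1 (hprod ▸ one_pos)

lemma conj_lt_one_third : β < 1 / 3 := by
  nlinarith [conj_pos hα hprod]

end Conjugate

theorem mainTheorem1 (b : ℕ) (α α₂ : ℝ) (hα : 3 < α)
    (hsum : α + α₂ = b) (hprod : α * α₂ = 1) :
    StrictMono (fun n : ℕ => (pSeq b n : ℝ) / (qSeq b n : ℝ)) ∧
    Tendsto (fun n : ℕ => (pSeq b n : ℝ) / (qSeq b n : ℝ)) atTop (𝓝 (1 / (1 + α))) ∧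
    (Tendsto (fun n : ℕ => (negConv b n : ℝ)) atTop (𝓝 (1 / (1 + α))) ∧
      (∀ n : ℕ, (pSeq b (2 * n) : ℚ) / (qSeq b (2 * n) : ℚ) = negConv b n) ∧
      (∀ n : ℕ, (pSeq b (2 * n + 1) : ℚ) / (qSeq b (2 * n + 1) : ℚ) =
        ((negConv b n).num + (negConv b (n + 1)).num : ℚ) /
          ((negConv b n).den + (negConv b (n + 1)).den : ℚ))) ∧
    lagrangeSpectrum α ∩ Set.Icc 0 (1 / (1 + α)) =
      Set.range (fun n : ℕ => (pSeq b n : ℝ) / (qSeq b n : ℝ)) ∪ {1 / (1 + α)} ∧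
    IsLeast {t : ℝ | AccPt t (𝓟 (lagrangeSpectrum α))} (1 / (1 + α)) ∧
    (∀ n : ℕ,
      levelSet α ((pSeq b n : ℝ) / (qSeq b n : ℝ)) ⊆
        (IntermediateField.adjoin ℚ ({α} : Set ℝ) : Set ℝ) ∧
      levelSet α ((pSeq b n : ℝ) / (qSeq b n : ℝ)) = christoffelSet α α₂ n) ∧
    ¬ (levelSet α (1 / (1 + α))).Countable ∧
    eventuallyBalancedSet α α₂ ⊆ levelSet α (1 / (1 + α)) ∧
    levelSet α (1 / (1 + α)) = signedEventuallyBalancedSet α α₂ := by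
  have hβ₀ : 0 < α₂ := conj_pos hα hprod
  have hβ : α₂ < 1 / 3 := conj_lt_one_third hα hprod
  have hβ₁ : α₂ < 1 := by linarith
  have hmono := strictMono_pSeq_div_qSeq hβ₀ hβ₁ hprod hsum
  have hlim := tendsto_pSeq_div_qSeq hβ₀ hβ₁ hprod hsum
  have hb := two_le_trace hβ₀ hβ₁ hprod hsum
  refine ⟨hmono, hlim, ⟨tendsto_negConv hβ₀ hβ₁ hprod hsum, pSeq_div_qSeq_even hb,
      pSeq_div_qSeq_odd hb⟩,
    lagrangeSpectrum_inter_Icc hβ₀ hβ hprod hsum,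
    isLeast_accPt_of_inter_Iic_eq hmono hlim (lagrangeSpectrum_inter_Iic hβ₀ hβ hprod hsum),
    fun n => ⟨?_, levelSet_eq_christoffelSet hβ₀ hβ hprod hsum n⟩,
    not_countable_levelSet hβ₀ hβ hprod hsum, eventuallyBalancedSet_subset hβ₀ hβ hprod hsum,
    levelSet_eq_signedEventuallyBalancedSet hβ₀ hβ hprod hsum⟩
  rw [levelSet_eq_christoffelSet hβ₀ hβ hprod hsum n]
  exact christoffelSet_subset_adjoin hβ₀ hβ₁ hprod hsum n
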